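/- Let $n\ge 1$ and let $\Omega\subset\mathbb{R}^n$ be a bounded domain (open, connected, non-empty) with Lipschitz boundary. All functions are real-valued. Let $H^1(\Omega)\subset L^2(\Omega)$ be the Sobolev space of functions with weak first derivatives in $L^2(\Omega)$, with norm $\|u\|_{H^1(\Omega)}^2=\|u\|_{L^2(\Omega)}^2+\sum_{i=1}^n\|\partial_i u\|_{L^2(\Omega)}^2$, and let $H^1_0(\Omega)$ be the closure of $C_c^\infty(\Omega)$ in $H^1(\Omega)$. Let $\gamma\colon H^1(\Omega)\to L^2(\partial\Omega)$ be the Sobolev trace map, i.e. the continuous extension of the restriction $\psi\mapsto\psi|_{\partial\Omega}$ of functions smooth up to the boundary, and let $$H^{1/2}(\partial\Omega)=\Big\{f\in L^2(\partial\Omega):\int_{\partial\Omega}\int_{\partial\Omega}\frac{|f(x)-f(y)|^2}{|x-y|^{n}}\,d\sigma(x)\,d\sigma(y)<\infty\Big\},$$ where $\sigma$ is the surface measure, i.e. $(n-1)$-dimensional Hausdorff measure, on $\partial\Omega$. Let $L^2_c(\Omega)$ be a closed linear subspace of $L^2(\Omega)$ whose orthogonal complement is spanned by finitely many functions in $H^1(\Omega)$: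 $L^2_c(\Omega)^\perp=\operatorname{span}\{\phi_1,\dots,\phi_m\}$ with $\phi_1,\dots,\phi_m\in H^1(\Omega)$. Then: (i) $\gamma\big(H^1(\Omega)\cap L^2_c(\Omega)\big)=H^{1/2}(\partial\Omega)$; (ii) $\overline{H^1_0(\Omega)\cap L^2_c(\Omega)}=L^2_c(\Omega)$, the closure being taken in $L^2(\Omega)$; (iii) $L^2_c(\Omega)^\perp$ is continuously embedded in $H^1(\Omega)$: $L^2_c(\Omega)^\perp\subset H^1(\Omega)$, and there is a constant $C>0$ such that $\|\phi\|_{H^1(\Omega)}\le C\|\phi\|_{L^2(\Omega)}$ for all $\phi\in L^2_c(\Omega)^\perp$. -/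

import Mathlib

open MeasureTheory Filter Topology
open scoped NNReal ContDiff

noncomputable section

namespace ConstrainedSobolev

variable {n : ℕ}

/-- The Euclidean space `ℝⁿ`. -/
abbrev Euc (n : ℕ) : Type := EuclideanSpace ℝ (Fin n)

/-- A bounded domain with Lipschitz boundary: near each boundary point the domain coincides,
up to the choice of a direction `ν`, with the region strictly above the graph of a Lipschitz
function on the hyperplane orthogonal to `ν`. -/
structure IsBoundedLipschitzDomain (Ω : Set (Euc n)) : Prop where
  isOpen : IsOpen Ω
  isConnected : IsConnected Ω
  isBounded : Bornology.IsBounded Ω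
  boundary : ∀ x₀ ∈ frontier Ω, ∃ (W : Set (Euc n)) (ν : Euc n)
    (ζ : (ℝ ∙ ν)ᗮ → ℝ) (K : ℝ≥0),
    IsOpen W ∧ x₀ ∈ W ∧ ‖ν‖ = 1 ∧ LipschitzWith K ζ ∧
      Ω ∩ W = {x | ζ ((ℝ ∙ ν)ᗮ.orthogonalProjectionOnto x) < inner ℝ ν x} ∩ W

/-- Real `L²(Ω)` with respect to Lebesgue measure. -/
abbrev L2 (Ω : Set (Euc n)) := Lp ℝ 2 (volume.restrict Ω)

/-- Surface measure on `∂Ω`: the `(n-1)`-dimensional Hausdorff measure. -/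
def surfaceMeasure (Ω : Set (Euc n)) : Measure (Euc n) :=
  (Measure.hausdorffMeasure ((n : ℝ) - 1)).restrict (frontier Ω)

/-- Real `L²(∂Ω)`. -/
abbrev L2Boundary (Ω : Set (Euc n)) := Lp ℝ 2 (surfaceMeasure Ω)

/-- The classical `i`-th partial derivative. -/
def partialDeriv (i : Fin n) (ψ : Euc n → ℝ) (x : Euc n) : ℝ :=
  fderiv ℝ ψ x (EuclideanSpace.single i 1)

/-- Test functions `C_c^∞(Ω)`. -/
def IsTestFunction (Ω : Set (Euc n)) (ψ : Euc n → ℝ) : Prop :=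
  ContDiff ℝ ∞ ψ ∧ HasCompactSupport ψ ∧ tsupport ψ ⊆ Ω

/-- `g` is the weak `i`-th partial derivative of `u` in `Ω`. -/
def HasWeakPartial (Ω : Set (Euc n)) (i : Fin n) (u g : L2 Ω) : Prop :=
  ∀ ψ : Euc n → ℝ, IsTestFunction Ω ψ →
    ∫ x in Ω, u x * partialDeriv i ψ x = - ∫ x in Ω, g x * ψ x

/-- The Sobolev space `H¹(Ω)`, as a subset of `L²(Ω)`. -/
def H1 (Ω : Set (Euc n)) : Set (L2 Ω) :=
  {u | ∀ i : Fin n, ∃ g : L2 Ω, HasWeakPartial Ω i u g}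

open Classical in
/-- The weak `i`-th partial derivative of `u` (set to `0` when there is none). -/
def weakPartial (Ω : Set (Euc n)) (i : Fin n) (u : L2 Ω) : L2 Ω :=
  if h : ∃ g : L2 Ω, HasWeakPartial Ω i u g then h.choose else 0

/-- The norm of `H¹(Ω)`. -/
def h1Norm (Ω : Set (Euc n)) (u : L2 Ω) : ℝ :=
  Real.sqrt (‖u‖ ^ 2 + ∑ i : Fin n, ‖weakPartial Ω i u‖ ^ 2)

/-- The restrictions to `Ω` of the (smooth) functions `ψ k` converge to `u` in `H¹(Ω)`. -/
def TendstoInH1 (Ω : Set (Euc n)) (ψ : ℕ → Euc n → ℝ) (u : L2 Ω) : Prop :=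
  Tendsto (fun k => eLpNorm (fun x => ψ k x - u x) 2 (volume.restrict Ω)) atTop (𝓝 0) ∧
  ∀ i : Fin n, Tendsto
    (fun k => eLpNorm (fun x => partialDeriv i (ψ k) x - weakPartial Ω i u x) 2
      (volume.restrict Ω)) atTop (𝓝 0)

/-- `H¹₀(Ω)`: the closure of `C_c^∞(Ω)` in `H¹(Ω)`. -/
def H10 (Ω : Set (Euc n)) : Set (L2 Ω) :=
  {u | u ∈ H1 Ω ∧ ∃ ψ : ℕ → Euc n → ℝ, (∀ k, IsTestFunction Ω (ψ k)) ∧ TendstoInH1 Ω ψ u}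

/-- `g` is the boundary trace of `u ∈ H¹(Ω)`: some functions smooth up to the boundary converge
to `u` in `H¹(Ω)` while their restrictions to `∂Ω` converge to `g` in `L²(∂Ω)`. -/
def IsTrace (Ω : Set (Euc n)) (u : L2 Ω) (g : L2Boundary Ω) : Prop :=
  u ∈ H1 Ω ∧ ∃ ψ : ℕ → Euc n → ℝ, (∀ k, ContDiff ℝ ∞ (ψ k)) ∧ TendstoInH1 Ω ψ u ∧
    Tendsto (fun k => eLpNorm (fun x => ψ k x - g x) 2 (surfaceMeasure Ω)) atTop (𝓝 0)

open Classical in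
/-- The Sobolev trace map, the extension by continuity of `ψ ↦ ψ|_∂Ω` from smooth functions to
`H¹(Ω)`. On a bounded Lipschitz domain every `u ∈ H¹(Ω)` has exactly one trace; the value `0` is
only used for `u` outside `H¹(Ω)`. -/
def trace (Ω : Set (Euc n)) (u : L2 Ω) : L2Boundary Ω :=
  if h : ∃ g : L2Boundary Ω, IsTrace Ω u g then h.choose else 0

/-- The Sobolev–Slobodeckij space `H^{1/2}(∂Ω)`: the functions in `L²(∂Ω)` with
`∬ |f(x) - f(y)|² / |x - y|ⁿ dσ(x) dσ(y) < ∞`. -/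
def HHalf (Ω : Set (Euc n)) : Set (L2Boundary Ω) :=
  {f | ∫⁻ x, ∫⁻ y, ‖f x - f y‖ₑ ^ 2 / edist x y ^ n ∂(surfaceMeasure Ω)
    ∂(surfaceMeasure Ω) < ⊤}

end ConstrainedSobolev

end

/-!
Near a boundary point the domain lies above a Lipschitz graph, so it contains a cone with vertex at
every nearby boundary point. Comparing the boundary values of a smooth function with its averages
over these cones, and applying Hardy's inequality along rays, bounds the `L²(∂Ω)` norm and the
Gagliardo energy of the boundary values by the `H¹(Ω)` norm. Hence traces are unique and belong to
`H^{1/2}(∂Ω)`.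

Conversely, `f ∈ H^{1/2}(∂Ω)` is the trace of the limit, as `ε → 0`, of its averages over `∂Ω` with
weights `(|x - y|² + ε²)^{-n}`. Lower `(n - 1)`-regularity of the surface measure dominates these
averages and their derivatives by an integrable potential of `f` and by its Gagliardo energy.

Test functions have zero trace and are dense in `L²(Ω)`. Therefore, subtracting a suitable test
function from any `u ∈ L²(Ω)` makes it satisfy the finitely many constraints defining `L²_c(Ω)`,
without changing the trace. The embedding (iii) holds because `L²_c(Ω)^⊥` is finite-dimensional.
-/

noncomputable section

namespace ConstrainedSobolev

variable {n : ℕ}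

section FiniteCodimension

variable {𝕜 H : Type*} [RCLike 𝕜] [NormedAddCommGroup H] [InnerProductSpace 𝕜 H]
  {D : Submodule 𝕜 H}

lemma exists_section_orthogonalProjectionOnto_of_dense (hD : Dense (D : Set H))
    (V : Submodule 𝕜 H) [FiniteDimensional 𝕜 V] :
    ∃ T : V →L[𝕜] H, (∀ v, T v ∈ D) ∧ ∀ v, V.orthogonalProjectionOnto (T v) = v := by
  let p : D →ₗ[𝕜] V := V.orthogonalProjectionOnto.toLinearMap ∘ₗ D.subtype
  have hV : Function.Surjective V.orthogonalProjectionOnto :=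
    fun v ↦ ⟨v, V.orthogonalProjectionOnto_mem_subspace_eq_self v⟩
  have hp_dense : DenseRange p :=
    hV.denseRange.comp hD.denseRange_val V.orthogonalProjectionOnto.continuous
  have hp_closed : IsClosed (LinearMap.range p : Set V) := Submodule.closed_of_finiteDimensional _
  have hp : LinearMap.range p = ⊤ := by
    rw [← SetLike.coe_set_eq, Submodule.top_coe, ← hp_closed.closure_eq]
    exact hp_dense.closure_range
  obtain ⟨s, hs⟩ := p.exists_rightInverse_of_surjective hp
  exact ⟨(D.subtype ∘ₗ s).toContinuousLinearMap, fun v ↦ (s v).2, LinearMap.congr_fun hs⟩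

variable [CompleteSpace H] {L : Submodule 𝕜 H}

lemma mem_of_orthogonalProjectionOnto_orthogonal_eq_zero (hL : IsClosed (L : Set H))
    [Lᗮ.HasOrthogonalProjection] {x : H} (hx : Lᗮ.orthogonalProjectionOnto x = 0) : x ∈ L := by
  rwa [Submodule.orthogonalProjectionOnto_eq_zero_iff, Submodule.orthogonal_orthogonal_eq_closure,
    hL.submodule_topologicalClosure_eq] at hx

lemma exists_mem_sub_mem_of_dense (hD : Dense (D : Set H)) (hL : IsClosed (L : Set H))
    [FiniteDimensional 𝕜 Lᗮ] (u : H) : ∃ v ∈ D, u - v ∈ L := by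
  obtain ⟨T, hT, hPT⟩ := exists_section_orthogonalProjectionOnto_of_dense hD Lᗮ
  refine ⟨T (Lᗮ.orthogonalProjectionOnto u), hT _,
    mem_of_orthogonalProjectionOnto_orthogonal_eq_zero hL ?_⟩
  rw [map_sub, hPT, sub_self]

lemma closure_inter_eq_of_dense (hD : Dense (D : Set H)) (hL : IsClosed (L : Set H))
    [FiniteDimensional 𝕜 Lᗮ] : closure ((D : Set H) ∩ L) = L := by
  refine subset_antisymm (hL.closure_subset_iff.2 Set.inter_subset_right) fun u hu ↦ ?_
  obtain ⟨T, hT, hPT⟩ := exists_section_orthogonalProjectionOnto_of_dense hD Lᗮ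
  obtain ⟨d, hd, hlim⟩ := mem_closure_iff_seq_limit.1 (hD u)
  have hPu : Lᗮ.orthogonalProjectionOnto u = 0 :=
    Submodule.orthogonalProjectionOnto_eq_zero_iff.2 (L.le_orthogonal_orthogonal hu)
  refine mem_closure_iff_seq_limit.2
    ⟨fun k ↦ d k - T (Lᗮ.orthogonalProjectionOnto (d k)), fun k ↦ ⟨D.sub_mem (hd k) (hT _), ?_⟩, ?_⟩
  · refine mem_of_orthogonalProjectionOnto_orthogonal_eq_zero hL ?_
    rw [map_sub, hPT, sub_self]
  · have hcorr := ((T.continuous.comp Lᗮ.orthogonalProjectionOnto.continuous).tendsto u).comp hlim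
    simpa [hPu] using hlim.sub hcorr

end FiniteCodimension

section WeakDerivative

variable {Ω : Set (Euc n)} {i : Fin n} {ψ χ : Euc n → ℝ} {u v g h : L2 Ω}

lemma contDiff_partialDeriv (hψ : ContDiff ℝ ∞ ψ) (i : Fin n) :
    ContDiff ℝ ∞ (partialDeriv i ψ) :=
  (hψ.fderiv_right (m := ∞) (by simp)).clm_apply contDiff_const

lemma partialDeriv_sub (hψ : Differentiable ℝ ψ) (hχ : Differentiable ℝ χ) (i : Fin n)
    (x : Euc n) :
    partialDeriv i (fun y ↦ ψ y - χ y) x = partialDeriv i ψ x - partialDeriv i χ x := by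
  simp [partialDeriv, fderiv_fun_sub (hψ x) (hχ x)]

namespace IsTestFunction

protected lemma add (hψ : IsTestFunction Ω ψ) (hχ : IsTestFunction Ω χ) :
    IsTestFunction Ω (fun x ↦ ψ x + χ x) :=
  ⟨hψ.1.add hχ.1, hψ.2.1.add hχ.2.1,
    (tsupport_add (f := ψ) (g := χ)).trans (Set.union_subset hψ.2.2 hχ.2.2)⟩

protected lemma const_mul (hψ : IsTestFunction Ω ψ) (c : ℝ) : IsTestFunction Ω (fun x ↦ c * ψ x) :=
  ⟨contDiff_const.mul hψ.1, hψ.2.1.mul_left, tsupport_mul_subset_right.trans hψ.2.2⟩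

protected lemma partialDeriv (hψ : IsTestFunction Ω ψ) (i : Fin n) :
    IsTestFunction Ω (partialDeriv i ψ) :=
  ⟨contDiff_partialDeriv hψ.1 i, hψ.2.1.fderiv_apply ℝ _,
    (tsupport_fderiv_apply_subset ℝ _).trans hψ.2.2⟩

lemma memLp (hψ : IsTestFunction Ω ψ) : MemLp ψ 2 (volume.restrict Ω) :=
  (hψ.1.continuous.memLp_of_hasCompactSupport hψ.2.1).restrict Ω

lemma eq_zero_of_notMem (hψ : IsTestFunction Ω ψ) {x : Euc n} (hx : x ∉ Ω) : ψ x = 0 :=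
  image_eq_zero_of_notMem_tsupport fun hx' ↦ hx (hψ.2.2 hx')

lemma setIntegral_mul (hψ : IsTestFunction Ω ψ) (f : Euc n → ℝ) :
    ∫ x in Ω, f x * ψ x = ∫ x, f x * ψ x :=
  setIntegral_eq_integral_of_forall_compl_eq_zero fun x hx ↦ by
    rw [hψ.eq_zero_of_notMem hx, mul_zero]

lemma integrable_mul (hψ : IsTestFunction Ω ψ) {f : Euc n → ℝ} (hf : Continuous f) :
    Integrable fun x ↦ f x * ψ x :=
  (hf.mul hψ.1.continuous).integrable_of_hasCompactSupport hψ.2.1.mul_left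

end IsTestFunction

lemma setIntegral_mul_eq_inner (u : L2 Ω) (hψ : MemLp ψ 2 (volume.restrict Ω)) :
    ∫ x in Ω, u x * ψ x = inner ℝ (hψ.toLp ψ) u := by
  rw [L2.inner_def]
  refine integral_congr_ae ?_
  filter_upwards [hψ.coeFn_toLp] with x hx
  simp [hx]

lemma hasWeakPartial_iff_inner :
    HasWeakPartial Ω i u g ↔ ∀ ψ (hψ : IsTestFunction Ω ψ),
      inner ℝ ((hψ.partialDeriv i).memLp.toLp _) u = - inner ℝ (hψ.memLp.toLp _) g := by
  refine forall₂_congr fun ψ hψ ↦ ?_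
  rw [setIntegral_mul_eq_inner u (hψ.partialDeriv i).memLp, setIntegral_mul_eq_inner g hψ.memLp]

namespace HasWeakPartial

protected lemma add (hu : HasWeakPartial Ω i u g) (hv : HasWeakPartial Ω i v h) :
    HasWeakPartial Ω i (u + v) (g + h) := by
  rw [hasWeakPartial_iff_inner] at *
  intro ψ hψ
  rw [inner_add_right, inner_add_right, hu ψ hψ, hv ψ hψ, neg_add]

protected lemma const_smul (hu : HasWeakPartial Ω i u g) (c : ℝ) :
    HasWeakPartial Ω i (c • u) (c • g) := by
  rw [hasWeakPartial_iff_inner] at *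
  intro ψ hψ
  rw [inner_smul_right, inner_smul_right, hu ψ hψ, mul_neg]

protected lemma sub (hu : HasWeakPartial Ω i u g) (hv : HasWeakPartial Ω i v h) :
    HasWeakPartial Ω i (u - v) (g - h) := by
  simpa [sub_eq_add_neg] using hu.add (hv.const_smul (-1))

lemma of_tendsto {ι : Type*} {l : Filter ι} [l.NeBot] {U G : ι → L2 Ω}
    (h : ∀ k, HasWeakPartial Ω i (U k) (G k)) (hU : Tendsto U l (𝓝 u))
    (hG : Tendsto G l (𝓝 g)) : HasWeakPartial Ω i u g := by
  simp only [hasWeakPartial_iff_inner] at *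
  intro ψ hψ
  refine tendsto_nhds_unique (tendsto_const_nhds.inner hU) ?_
  simp_rw [h _ ψ hψ]
  exact (tendsto_const_nhds.inner hG).neg

lemma of_contDiff (hψ : ContDiff ℝ ∞ ψ) (hu : u =ᵐ[volume.restrict Ω] ψ)
    (hg : g =ᵐ[volume.restrict Ω] partialDeriv i ψ) : HasWeakPartial Ω i u g := by
  intro χ hχ
  have hψ' := (contDiff_partialDeriv hψ i).continuous
  have hu_int : ∫ x in Ω, u x * partialDeriv i χ x = ∫ x in Ω, ψ x * partialDeriv i χ x :=
    integral_congr_ae (hu.mono fun x hx ↦ by simp only [hx])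
  have hg_int : ∫ x in Ω, g x * χ x = ∫ x in Ω, partialDeriv i ψ x * χ x :=
    integral_congr_ae (hg.mono fun x hx ↦ by simp only [hx])
  rw [hu_int, hg_int, (hχ.partialDeriv i).setIntegral_mul, hχ.setIntegral_mul]
  exact integral_mul_fderiv_eq_neg_fderiv_mul_of_integrable (hχ.integrable_mul hψ')
    ((hχ.partialDeriv i).integrable_mul hψ.continuous) (hχ.integrable_mul hψ.continuous)
    (fun x _ ↦ hψ.differentiable (by simp) x) (fun x _ ↦ hχ.1.differentiable (by simp) x)

end HasWeakPartial

lemma locallyIntegrableOn_coeFn (hΩ : IsOpen Ω) (u : L2 Ω) : LocallyIntegrableOn u Ω := by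
  refine (locallyIntegrableOn_iff hΩ.isLocallyClosed).2 fun k hk hkc ↦ ?_
  have huk : MemLp u 2 (volume.restrict k) := by
    simpa only [Measure.restrict_restrict hkc.measurableSet, Set.inter_eq_left.2 hk]
      using (Lp.memLp u).restrict k
  have : IsFiniteMeasure (volume.restrict k : Measure (Euc n)) :=
    isFiniteMeasure_restrict.2 hkc.measure_lt_top.ne
  exact huk.integrable one_le_two

lemma eq_zero_of_forall_inner_testFunction_eq_zero (hΩ : IsOpen Ω)
    (h : ∀ ψ (hψ : IsTestFunction Ω ψ), inner ℝ (hψ.memLp.toLp _) u = 0) : u = 0 := by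
  rw [Lp.eq_zero_iff_ae_eq_zero]
  refine (ae_restrict_iff' hΩ.measurableSet).2 <|
    hΩ.ae_eq_zero_of_integral_contDiff_smul_eq_zero (locallyIntegrableOn_coeFn hΩ u)
      fun ψ hψ hψ_compact hψΩ ↦ ?_
  have hψ : IsTestFunction Ω ψ := ⟨hψ, hψ_compact, hψΩ⟩
  simp_rw [smul_eq_mul, mul_comm (ψ _), ← hψ.setIntegral_mul, setIntegral_mul_eq_inner u hψ.memLp,
    h ψ hψ]

lemma HasWeakPartial.unique (hΩ : IsOpen Ω) (hg : HasWeakPartial Ω i u g)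
    (hh : HasWeakPartial Ω i u h) : g = h := by
  rw [hasWeakPartial_iff_inner] at *
  rw [← sub_eq_zero]
  refine eq_zero_of_forall_inner_testFunction_eq_zero hΩ fun ψ hψ ↦ ?_
  rw [inner_sub_right]
  linarith [hg ψ hψ, hh ψ hψ]

lemma hasWeakPartial_weakPartial (hu : u ∈ H1 Ω) (i : Fin n) :
    HasWeakPartial Ω i u (weakPartial Ω i u) := by
  rw [weakPartial, dif_pos (hu i)]
  exact (hu i).choose_spec

lemma HasWeakPartial.weakPartial_eq (hΩ : IsOpen Ω) (hg : HasWeakPartial Ω i u g) :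
    weakPartial Ω i u = g := by
  have hex : ∃ g : L2 Ω, HasWeakPartial Ω i u g := ⟨g, hg⟩
  rw [weakPartial, dif_pos hex]
  exact hex.choose_spec.unique hΩ hg

lemma sub_mem_H1 (hu : u ∈ H1 Ω) (hv : v ∈ H1 Ω) : u - v ∈ H1 Ω := fun i ↦
  ⟨_, (hasWeakPartial_weakPartial hu i).sub (hasWeakPartial_weakPartial hv i)⟩

lemma weakPartial_sub (hΩ : IsOpen Ω) (hu : u ∈ H1 Ω) (hv : v ∈ H1 Ω) (i : Fin n) :
    weakPartial Ω i (u - v) = weakPartial Ω i u - weakPartial Ω i v :=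
  ((hasWeakPartial_weakPartial hu i).sub (hasWeakPartial_weakPartial hv i)).weakPartial_eq hΩ

lemma exists_h1Norm_le_of_finiteDimensional (hΩ : IsOpen Ω) (V : Submodule ℝ (L2 Ω))
    [FiniteDimensional ℝ V] (hV : ∀ v ∈ V, v ∈ H1 Ω) :
    ∃ C : ℝ, 0 < C ∧ ∀ v ∈ V, h1Norm Ω v ≤ C * ‖v‖ := by
  let d (i : Fin n) : V →ₗ[ℝ] L2 Ω :=
    { toFun := fun v ↦ weakPartial Ω i v
      map_add' := fun u v ↦ ((hasWeakPartial_weakPartial (hV u u.2) i).add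
        (hasWeakPartial_weakPartial (hV v v.2) i)).weakPartial_eq hΩ
      map_smul' := fun c v ↦
        ((hasWeakPartial_weakPartial (hV v v.2) i).const_smul c).weakPartial_eq hΩ }
  let D (i : Fin n) : V →L[ℝ] L2 Ω := (d i).toContinuousLinearMap
  refine ⟨√(1 + ∑ i, ‖D i‖ ^ 2), Real.sqrt_pos.2 (by positivity), fun v hv ↦ ?_⟩
  rw [h1Norm, ← Real.sqrt_sq (norm_nonneg v), ← Real.sqrt_mul (by positivity),
    Real.sqrt_sq (norm_nonneg v), add_mul, one_mul, Finset.sum_mul]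
  gcongr with i
  rw [← mul_pow]
  gcongr
  exact (D i).le_opNorm ⟨v, hv⟩

end WeakDerivative

section TestFunctions

variable {Ω : Set (Euc n)} {ψ : Euc n → ℝ} {u v : L2 Ω}

/-- The image of `C_c^∞(Ω)` in `L²(Ω)`. -/
def testSubmodule (Ω : Set (Euc n)) : Submodule ℝ (L2 Ω) where
  carrier := {u | ∃ ψ, IsTestFunction Ω ψ ∧ u =ᵐ[volume.restrict Ω] ψ}
  add_mem' := by
    rintro u v ⟨ψ, hψ, hu⟩ ⟨χ, hχ, hv⟩
    refine ⟨_, hψ.add hχ, ?_⟩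
    filter_upwards [Lp.coeFn_add u v, hu, hv] with x hadd hux hvx
    rw [hadd, Pi.add_apply, hux, hvx]
  zero_mem' :=
    ⟨fun _ ↦ 0, ⟨contDiff_const, HasCompactSupport.zero, by simp [tsupport]⟩, Lp.coeFn_zero _ _ _⟩
  smul_mem' := by
    rintro c u ⟨ψ, hψ, hu⟩
    refine ⟨_, hψ.const_mul c, ?_⟩
    filter_upwards [Lp.coeFn_smul c u, hu] with x hsmul hux
    rw [hsmul, Pi.smul_apply, hux, smul_eq_mul]

lemma dense_testSubmodule (hΩ : IsOpen Ω) : Dense (testSubmodule Ω : Set (L2 Ω)) := by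
  rw [Submodule.dense_iff_topologicalClosure_eq_top, Submodule.topologicalClosure_eq_top_iff,
    Submodule.eq_bot_iff]
  exact fun u hu ↦ eq_zero_of_forall_inner_testFunction_eq_zero hΩ fun ψ hψ ↦
    (Submodule.mem_orthogonal _ _).1 hu _ ⟨ψ, hψ, hψ.memLp.coeFn_toLp⟩

namespace IsTestFunction

lemma hasWeakPartial (hψ : IsTestFunction Ω ψ) (hu : u =ᵐ[volume.restrict Ω] ψ) (i : Fin n) :
    HasWeakPartial Ω i u ((hψ.partialDeriv i).memLp.toLp _) :=
  .of_contDiff hψ.1 hu (MemLp.coeFn_toLp _)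

lemma tendstoInH1 (hψ : IsTestFunction Ω ψ) (hΩ : IsOpen Ω) (hu : u =ᵐ[volume.restrict Ω] ψ) :
    TendstoInH1 Ω (fun _ ↦ ψ) u := by
  refine ⟨tendsto_const_nhds.congr fun _ ↦ ?_, fun i ↦ tendsto_const_nhds.congr fun _ ↦ ?_⟩
  · rw [eq_comm, ← eLpNorm_zero (ε := ℝ) (p := 2) (μ := volume.restrict Ω)]
    exact eLpNorm_congr_ae (hu.mono fun x hx ↦ by simp [hx])
  · rw [eq_comm, ← eLpNorm_zero (ε := ℝ) (p := 2) (μ := volume.restrict Ω),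
      (hψ.hasWeakPartial hu i).weakPartial_eq hΩ]
    exact eLpNorm_congr_ae
      ((hψ.partialDeriv i).memLp.coeFn_toLp.mono fun x hx ↦ by simp [hx])

end IsTestFunction

lemma testSubmodule_subset_H10 (hΩ : IsOpen Ω) : (testSubmodule Ω : Set (L2 Ω)) ⊆ H10 Ω := by
  rintro u ⟨ψ, hψ, hu⟩
  exact ⟨fun i ↦ ⟨_, hψ.hasWeakPartial hu i⟩, fun _ ↦ ψ, fun _ ↦ hψ, hψ.tendstoInH1 hΩ hu⟩

lemma ae_mem_frontier (Ω : Set (Euc n)) : ∀ᵐ x ∂surfaceMeasure Ω, x ∈ frontier Ω :=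
  ae_restrict_mem isClosed_frontier.measurableSet

lemma isTrace_zero_of_mem_testSubmodule (hΩ : IsOpen Ω) (hu : u ∈ testSubmodule Ω) :
    IsTrace Ω u 0 := by
  obtain ⟨ψ, hψ, huψ⟩ := hu
  refine ⟨fun i ↦ ⟨_, hψ.hasWeakPartial huψ i⟩, fun _ ↦ ψ, fun _ ↦ hψ.1, hψ.tendstoInH1 hΩ huψ,
    tendsto_const_nhds.congr fun _ ↦ ?_⟩
  rw [eq_comm, ← eLpNorm_zero (ε := ℝ) (p := 2) (μ := surfaceMeasure Ω)]
  refine eLpNorm_congr_ae ?_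
  filter_upwards [ae_mem_frontier Ω, Lp.coeFn_zero ℝ 2 (surfaceMeasure Ω)] with x hx h0
  rw [hΩ.frontier_eq] at hx
  rw [h0, hψ.eq_zero_of_notMem hx.2, Pi.zero_apply, sub_zero]

lemma tendsto_eLpNorm_sub_sub {α : Type*} [MeasurableSpace α] {μ : Measure α} {ι : Type*}
    {l : Filter ι} {a b : ι → α → ℝ} {u v w : Lp ℝ 2 μ} (hw : w = u - v)
    (ha : ∀ k, AEStronglyMeasurable (a k) μ) (hb : ∀ k, AEStronglyMeasurable (b k) μ)
    (hau : Tendsto (fun k ↦ eLpNorm (fun x ↦ a k x - u x) 2 μ) l (𝓝 0))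
    (hbv : Tendsto (fun k ↦ eLpNorm (fun x ↦ b k x - v x) 2 μ) l (𝓝 0)) :
    Tendsto (fun k ↦ eLpNorm (fun x ↦ (a k x - b k x) - w x) 2 μ) l (𝓝 0) := by
  refine tendsto_of_tendsto_of_tendsto_of_le_of_le tendsto_const_nhds
    (by simpa only [add_zero] using hau.add hbv) (fun _ ↦ zero_le) fun k ↦ ?_
  have hsplit : (fun x ↦ (a k x - b k x) - w x) =ᵐ[μ]
      (fun x ↦ a k x - u x) - fun x ↦ b k x - v x := by
    filter_upwards [Lp.coeFn_sub u v] with x hx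
    rw [hw, hx, Pi.sub_apply, Pi.sub_apply]
    ring
  rw [eLpNorm_congr_ae hsplit]
  exact eLpNorm_sub_le ((ha k).sub (Lp.aestronglyMeasurable u))
    ((hb k).sub (Lp.aestronglyMeasurable v)) one_le_two

lemma TendstoInH1.sub {ψ χ : ℕ → Euc n → ℝ} (hΩ : IsOpen Ω) (hu : u ∈ H1 Ω) (hv : v ∈ H1 Ω)
    (hψ : ∀ k, ContDiff ℝ ∞ (ψ k)) (hχ : ∀ k, ContDiff ℝ ∞ (χ k)) (hψu : TendstoInH1 Ω ψ u)
    (hχv : TendstoInH1 Ω χ v) : TendstoInH1 Ω (fun k x ↦ ψ k x - χ k x) (u - v) := by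
  refine ⟨tendsto_eLpNorm_sub_sub rfl (fun k ↦ (hψ k).continuous.aestronglyMeasurable)
    (fun k ↦ (hχ k).continuous.aestronglyMeasurable) hψu.1 hχv.1, fun i ↦ ?_⟩
  simp_rw [partialDeriv_sub ((hψ _).differentiable (by simp)) ((hχ _).differentiable (by simp))]
  exact tendsto_eLpNorm_sub_sub (weakPartial_sub hΩ hu hv i)
    (fun k ↦ (contDiff_partialDeriv (hψ k) i).continuous.aestronglyMeasurable)
    (fun k ↦ (contDiff_partialDeriv (hχ k) i).continuous.aestronglyMeasurable) (hψu.2 i) (hχv.2 i)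

lemma IsTrace.sub {g h : L2Boundary Ω} (hΩ : IsOpen Ω) (hu : IsTrace Ω u g) (hv : IsTrace Ω v h) :
    IsTrace Ω (u - v) (g - h) := by
  obtain ⟨hu, ψ, hψ, hψu, hψg⟩ := hu
  obtain ⟨hv, χ, hχ, hχv, hχh⟩ := hv
  exact ⟨sub_mem_H1 hu hv, _, fun k ↦ (hψ k).sub (hχ k), hψu.sub hΩ hu hv hψ hχ hχv,
    tendsto_eLpNorm_sub_sub rfl (fun k ↦ (hψ k).continuous.aestronglyMeasurable)
      (fun k ↦ (hχ k).continuous.aestronglyMeasurable) hψg hχh⟩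

end TestFunctions

section Graph

variable {Ω W : Set (Euc n)} {ν x : Euc n} {ζ : (ℝ ∙ ν)ᗮ → ℝ} {K : ℝ≥0}

lemma orthogonalProjectionOnto_add_smul (x : Euc n) (t : ℝ) :
    (ℝ ∙ ν)ᗮ.orthogonalProjectionOnto (x + t • ν) = (ℝ ∙ ν)ᗮ.orthogonalProjectionOnto x := by
  have hν : (ℝ ∙ ν)ᗮ.orthogonalProjectionOnto ν = 0 :=
    Submodule.orthogonalProjectionOnto_eq_zero_iff.2
      (Submodule.le_orthogonal_orthogonal _ (Submodule.mem_span_singleton_self ν))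
  rw [map_add, map_smul, hν, smul_zero, add_zero]

lemma lipschitzWith_orthogonalProjectionOnto (V : Submodule ℝ (Euc n)) :
    LipschitzWith 1 V.orthogonalProjectionOnto :=
  V.orthogonalProjectionOnto.lipschitz.weaken (mod_cast V.orthogonalProjectionOnto_norm_le)

lemma one_le_of_norm_eq_one (hν : ‖ν‖ = 1) : 1 ≤ n := by
  rcases n.eq_zero_or_pos with rfl | hn
  · rw [Subsingleton.elim ν 0, norm_zero] at hν
    exact absurd hν zero_ne_one
  · exact hn

lemma finrank_orthogonal_span_singleton_eq (hν : ‖ν‖ = 1) :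
    Module.finrank ℝ (ℝ ∙ ν)ᗮ = n - 1 := by
  have h := Submodule.finrank_add_finrank_orthogonal (ℝ ∙ ν)
  rw [finrank_span_singleton (by rintro rfl; simp at hν), finrank_euclideanSpace_fin] at h
  omega

lemma natCast_sub_one_nonneg (hν : ‖ν‖ = 1) : (0 : ℝ) ≤ (n : ℝ) - 1 :=
  sub_nonneg.2 (mod_cast one_le_of_norm_eq_one hν)

lemma exists_hausdorffMeasure_closedBall (hν : ‖ν‖ = 1) :
    ∃ a : ℝ≥0, 0 < a ∧ ∀ (v : (ℝ ∙ ν)ᗮ) (r : ℝ), 0 ≤ r →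
      Measure.hausdorffMeasure ((n : ℝ) - 1) (Metric.closedBall v r) =
        a * ENNReal.ofReal r ^ (n - 1) := by
  have hdim := finrank_orthogonal_span_singleton_eq hν
  have hd : (n : ℝ) - 1 = (Module.finrank ℝ (ℝ ∙ ν)ᗮ : ℝ) := by
    rw [hdim, Nat.cast_sub (one_le_of_norm_eq_one hν), Nat.cast_one]
  rw [hd]
  have hH : (Measure.hausdorffMeasure (Module.finrank ℝ (ℝ ∙ ν)ᗮ : ℝ) :
      Measure (ℝ ∙ ν)ᗮ).IsAddHaarMeasure := isAddHaarMeasure_hausdorffMeasure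
  set μ : Measure (ℝ ∙ ν)ᗮ := Measure.hausdorffMeasure (Module.finrank ℝ (ℝ ∙ ν)ᗮ : ℝ)
  have hfin : μ (Metric.ball 0 1) ≠ ⊤ := Metric.isBounded_ball.measure_lt_top.ne
  have hpos : μ (Metric.ball 0 1) ≠ 0 := (Metric.measure_ball_pos μ 0 one_pos).ne'
  refine ⟨(μ (Metric.ball 0 1)).toNNReal, ENNReal.toNNReal_pos hpos hfin, fun v r hr ↦ ?_⟩
  rw [Measure.addHaar_closedBall μ v hr, hdim, ENNReal.ofReal_pow hr, mul_comm,
    ENNReal.coe_toNNReal hfin]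

/-- The parametrization of the graph of `ζ` by the hyperplane orthogonal to `ν`. -/
def graphMap (ν : Euc n) (ζ : (ℝ ∙ ν)ᗮ → ℝ) (v : (ℝ ∙ ν)ᗮ) : Euc n := (v : Euc n) + ζ v • ν

lemma orthogonalProjectionOnto_graphMap (v : (ℝ ∙ ν)ᗮ) :
    (ℝ ∙ ν)ᗮ.orthogonalProjectionOnto (graphMap ν ζ v) = v := by
  rw [graphMap, orthogonalProjectionOnto_add_smul,
    Submodule.orthogonalProjectionOnto_mem_subspace_eq_self]

lemma graphMap_orthogonalProjectionOnto (hν : ‖ν‖ = 1)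
    (hx : ζ ((ℝ ∙ ν)ᗮ.orthogonalProjectionOnto x) = inner ℝ ν x) :
    graphMap ν ζ ((ℝ ∙ ν)ᗮ.orthogonalProjectionOnto x) = x := by
  have h := Submodule.starProjection_add_starProjection_orthogonal (K := ℝ ∙ ν) x
  rw [Submodule.starProjection_unit_singleton ℝ hν] at h
  rw [graphMap, hx, add_comm]
  exact h

lemma inner_graphMap (hν : ‖ν‖ = 1) (v : (ℝ ∙ ν)ᗮ) : inner ℝ ν (graphMap ν ζ v) = ζ v := by
  rw [graphMap, inner_add_right, inner_smul_right, real_inner_self_eq_norm_sq, hν,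
    Submodule.mem_orthogonal_singleton_iff_inner_right.1 v.2, one_pow, mul_one, zero_add]

lemma lipschitzWith_graphMap (hν : ‖ν‖ = 1) (hζ : LipschitzWith K ζ) :
    LipschitzWith (1 + K) (graphMap ν ζ) := by
  have hsmul : LipschitzWith K fun v ↦ ζ v • ν := .of_dist_le_mul fun v w ↦ by
    rw [dist_eq_norm, ← sub_smul, norm_smul, hν, mul_one, ← dist_eq_norm]
    exact hζ.dist_le_mul v w
  exact LipschitzWith.subtype_val ((ℝ ∙ ν)ᗮ : Set (Euc n)) |>.add hsmul

/-- A chart in which `Ω` is a Lipschitz epigraph: within the open set `W`, it is the region lying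
above the graph of the `K`-Lipschitz function `ζ` in the direction of the unit vector `ν`. -/
structure IsLipschitzChart (Ω W : Set (Euc n)) (ν : Euc n) (ζ : (ℝ ∙ ν)ᗮ → ℝ) (K : ℝ≥0) :
    Prop where
  isOpen : IsOpen W
  norm_eq_one : ‖ν‖ = 1
  lipschitz : LipschitzWith K ζ
  inter_eq : Ω ∩ W = {x | ζ ((ℝ ∙ ν)ᗮ.orthogonalProjectionOnto x) < inner ℝ ν x} ∩ W

namespace IsLipschitzChart

lemma mem_iff (h : IsLipschitzChart Ω W ν ζ K) (hxW : x ∈ W) :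
    x ∈ Ω ↔ ζ ((ℝ ∙ ν)ᗮ.orthogonalProjectionOnto x) < inner ℝ ν x := by
  simpa [hxW] using Set.ext_iff.1 h.inter_eq x

lemma le_inner_of_mem_closure (h : IsLipschitzChart Ω W ν ζ K) (hx : x ∈ closure Ω)
    (hxW : x ∈ W) : ζ ((ℝ ∙ ν)ᗮ.orthogonalProjectionOnto x) ≤ inner ℝ ν x := by
  have hxΩW : x ∈ closure (Ω ∩ W) := by
    rw [Set.inter_comm]
    exact h.isOpen.inter_closure ⟨hxW, hx⟩
  rw [h.inter_eq] at hxΩW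
  have hζ := h.lipschitz.continuous
  exact closure_lt_subset_le (by fun_prop) (by fun_prop) (closure_mono Set.inter_subset_left hxΩW)

lemma mem_frontier_iff (h : IsLipschitzChart Ω W ν ζ K) (hΩ : IsOpen Ω) (hxW : x ∈ W) :
    x ∈ frontier Ω ↔ ζ ((ℝ ∙ ν)ᗮ.orthogonalProjectionOnto x) = inner ℝ ν x := by
  rw [hΩ.frontier_eq, Set.mem_sdiff, h.mem_iff hxW, not_lt]
  refine ⟨fun hx ↦ (h.le_inner_of_mem_closure hx.1 hxW).antisymm hx.2, fun hx ↦ ⟨?_, hx.ge⟩⟩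
  have hlim : Tendsto (fun t : ℝ ↦ x + t • ν) (𝓝[>] 0) (𝓝 x) := by
    have : ContinuousAt (fun t : ℝ ↦ x + t • ν) 0 := by fun_prop
    simpa [ContinuousAt] using this.tendsto.mono_left nhdsWithin_le_nhds
  refine mem_closure_of_tendsto hlim ?_
  filter_upwards [hlim (h.isOpen.mem_nhds hxW), self_mem_nhdsWithin] with t htW ht
  rw [h.mem_iff htW, orthogonalProjectionOnto_add_smul, hx, inner_add_right, inner_smul_right,
    real_inner_self_eq_norm_sq, h.norm_eq_one, one_pow, mul_one]
  exact lt_add_of_pos_right _ ht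

end IsLipschitzChart

end Graph

section Geometry

variable {Ω W : Set (Euc n)} {ν x : Euc n} {ζ : (ℝ ∙ ν)ᗮ → ℝ} {K : ℝ≥0}

/-- A bounded open set with Lipschitz boundary, not necessarily connected or nonempty. -/
structure IsBoundedLipschitzOpen (Ω : Set (Euc n)) : Prop where
  isOpen : IsOpen Ω
  isBounded : Bornology.IsBounded Ω
  exists_chart : ∀ x₀ ∈ frontier Ω, ∃ (W : Set (Euc n)) (ν : Euc n) (ζ : (ℝ ∙ ν)ᗮ → ℝ) (K : ℝ≥0),
    x₀ ∈ W ∧ IsLipschitzChart Ω W ν ζ K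

lemma IsBoundedLipschitzDomain.isBoundedLipschitzOpen (hΩ : IsBoundedLipschitzDomain Ω) :
    IsBoundedLipschitzOpen Ω where
  isOpen := hΩ.isOpen
  isBounded := hΩ.isBounded
  exists_chart x₀ hx₀ :=
    let ⟨W, ν, ζ, K, hW, hxW, hν, hζ, hΩW⟩ := hΩ.boundary x₀ hx₀
    ⟨W, ν, ζ, K, hxW, hW, hν, hζ, hΩW⟩

/-- Upper Ahlfors regularity in dimension `d`: a ball of radius `r` has mass at most `C * r ^ d`. -/
def IsUpperRegular (σ : Measure (Euc n)) (d : ℕ) (C : ℝ≥0) : Prop :=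
  ∀ (z : Euc n) (r : ℝ), 0 ≤ r → σ (Metric.closedBall z r) ≤ C * ENNReal.ofReal r ^ d

/-- Lower Ahlfors regularity in dimension `d` at the points of `S` and the scales up to `R`: a ball
of radius `r` has mass at least `c * r ^ d`. -/
def IsLowerRegularOn (σ : Measure (Euc n)) (d : ℕ) (c : ℝ≥0) (S : Set (Euc n)) (R : ℝ) : Prop :=
  ∀ x ∈ S, ∀ r : ℝ, 0 < r → r ≤ R → c * ENNReal.ofReal r ^ d ≤ σ (Metric.closedBall x r)

/-- Each point of `P` is the vertex of a truncated cone contained in `Ω`, with axis `ν`, height `T`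
and aperture `c`: the cone is described by the balls inscribed in it, enlarged by a factor two so
that the points of the cone stay away from the complement of `Ω`. -/
def HasCones (Ω P : Set (Euc n)) (ν : Euc n) (c T : ℝ) : Prop :=
  ∀ x ∈ P, ∀ s : ℝ, 0 < s → s < T → Metric.ball (x + s • ν) (2 * c * s) ⊆ Ω

lemma HasCones.mono {P Q : Set (Euc n)} {c T : ℝ} (h : HasCones Ω Q ν c T) (hPQ : P ⊆ Q) :
    HasCones Ω P ν c T :=
  fun x hx ↦ h x (hPQ hx)

lemma IsLowerRegularOn.mono {σ : Measure (Euc n)} {d : ℕ} {c c' : ℝ≥0} {S T : Set (Euc n)}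
    {R R' : ℝ} (h : IsLowerRegularOn σ d c S R) (hc : c' ≤ c) (hT : T ⊆ S) (hR : R' ≤ R) :
    IsLowerRegularOn σ d c' T R' :=
  fun x hx r hr hrR ↦ le_trans (by gcongr) (h x (hT hx) r hr (hrR.trans hR))

lemma IsLowerRegularOn.exists_of_le {σ : Measure (Euc n)} {d : ℕ} {c : ℝ≥0} {S : Set (Euc n)}
    {δ : ℝ} (h : IsLowerRegularOn σ d c S δ) (hc : 0 < c) (hδ : 0 < δ) (R : ℝ) :
    ∃ c' : ℝ≥0, 0 < c' ∧ IsLowerRegularOn σ d c' S R := by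
  set q := min 1 (δ / max R 1)
  have hq : 0 < q := lt_min one_pos (by positivity)
  refine ⟨c * q.toNNReal ^ d, mul_pos hc (pow_pos (Real.toNNReal_pos.2 hq) _),
    fun x hx r hr hrR ↦ ?_⟩
  have hqr : q * r ≤ δ := calc
    q * r ≤ δ / max R 1 * max R 1 := by
      gcongr
      · exact min_le_right _ _
      · exact hrR.trans (le_max_left _ _)
    _ = δ := div_mul_cancel₀ _ (by positivity)
  calc ((c * q.toNNReal ^ d : ℝ≥0) : ENNReal) * ENNReal.ofReal r ^ d
      = c * ENNReal.ofReal (q * r) ^ d := by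
        rw [ENNReal.ofReal_mul hq.le, mul_pow, ENNReal.coe_mul, mul_assoc, ENNReal.coe_pow]
        rfl
    _ ≤ σ (Metric.closedBall x (q * r)) := h x hx _ (by positivity) hqr
    _ ≤ σ (Metric.closedBall x r) := measure_mono
        (Metric.closedBall_subset_closedBall (mul_le_of_le_one_left hr.le (min_le_left _ _)))

namespace IsLipschitzChart

lemma exists_hausdorffMeasure_closedBall_inter_le (h : IsLipschitzChart Ω W ν ζ K)
    (hΩ : IsOpen Ω) :
    ∃ C : ℝ≥0, ∀ (z : Euc n) (r : ℝ), 0 ≤ r →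
      Measure.hausdorffMeasure ((n : ℝ) - 1) (Metric.closedBall z r ∩ (frontier Ω ∩ W)) ≤
        C * ENNReal.ofReal r ^ (n - 1) := by
  obtain ⟨a, -, ha⟩ := exists_hausdorffMeasure_closedBall h.norm_eq_one
  have hd := natCast_sub_one_nonneg h.norm_eq_one
  refine ⟨(1 + K) ^ ((n : ℝ) - 1) * a, fun z r hr ↦ ?_⟩
  have hsub : Metric.closedBall z r ∩ (frontier Ω ∩ W) ⊆
      graphMap ν ζ '' Metric.closedBall ((ℝ ∙ ν)ᗮ.orthogonalProjectionOnto z) r := by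
    rintro x ⟨hxz, hx, hxW⟩
    refine ⟨(ℝ ∙ ν)ᗮ.orthogonalProjectionOnto x, ?_,
      graphMap_orthogonalProjectionOnto h.norm_eq_one ((h.mem_frontier_iff hΩ hxW).1 hx)⟩
    simpa using (lipschitzWith_orthogonalProjectionOnto (ℝ ∙ ν)ᗮ).mapsTo_closedBall z r hxz
  refine (measure_mono hsub).trans
    (((lipschitzWith_graphMap h.norm_eq_one h.lipschitz).hausdorffMeasure_image_le hd _).trans ?_)
  rw [ha _ _ hr, ENNReal.coe_mul, mul_assoc, ENNReal.coe_rpow_of_nonneg _ hd]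

lemma closedBall_subset_image_orthogonalProjectionOnto (h : IsLipschitzChart Ω W ν ζ K)
    (hΩ : IsOpen Ω) {r : ℝ} (hx : x ∈ frontier Ω) (hxW : Metric.closedBall x r ⊆ W)
    (hr : 0 ≤ r) :
    Metric.closedBall ((ℝ ∙ ν)ᗮ.orthogonalProjectionOnto x) ((1 + K : ℝ)⁻¹ * r) ⊆
      (ℝ ∙ ν)ᗮ.orthogonalProjectionOnto '' (Metric.closedBall x r ∩ frontier Ω) := by
  intro w hw
  have hgraph : graphMap ν ζ ((ℝ ∙ ν)ᗮ.orthogonalProjectionOnto x) = x :=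
    graphMap_orthogonalProjectionOnto h.norm_eq_one
      ((h.mem_frontier_iff hΩ (hxW (Metric.mem_closedBall_self hr))).1 hx)
  have hdist : graphMap ν ζ w ∈ Metric.closedBall x r := by
    have hmaps := (lipschitzWith_graphMap h.norm_eq_one h.lipschitz).mapsTo_closedBall _ _ hw
    rwa [hgraph, NNReal.coe_add, NNReal.coe_one, mul_inv_cancel_left₀ (by positivity)] at hmaps
  refine ⟨graphMap ν ζ w, ⟨hdist, ?_⟩, orthogonalProjectionOnto_graphMap w⟩
  rw [h.mem_frontier_iff hΩ (hxW hdist), orthogonalProjectionOnto_graphMap,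
    inner_graphMap h.norm_eq_one]

lemma exists_isLowerRegularOn (h : IsLipschitzChart Ω W ν ζ K) (hΩ : IsOpen Ω) {ε : ℝ}
    (hW : Metric.ball x ε ⊆ W) :
    ∃ c : ℝ≥0, 0 < c ∧ IsLowerRegularOn (surfaceMeasure Ω) (n - 1) c
      (frontier Ω ∩ Metric.ball x (ε / 2)) (ε / 3) := by
  obtain ⟨a, ha0, ha⟩ := exists_hausdorffMeasure_closedBall h.norm_eq_one
  refine ⟨a * (1 + K)⁻¹ ^ (n - 1), by positivity, ?_⟩
  rintro y ⟨hy, hyx⟩ r hr hrε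
  have hyW : Metric.closedBall y r ⊆ W := fun z hz ↦ hW <| by
    rw [Metric.mem_ball] at hyx ⊢
    rw [Metric.mem_closedBall] at hz
    linarith [dist_triangle z y x]
  have hproj := (measure_mono (h.closedBall_subset_image_orthogonalProjectionOnto hΩ hy hyW
    hr.le)).trans ((lipschitzWith_orthogonalProjectionOnto (ℝ ∙ ν)ᗮ).hausdorffMeasure_image_le
      (natCast_sub_one_nonneg h.norm_eq_one) _)
  rw [ha _ _ (by positivity), ENNReal.coe_one, ENNReal.one_rpow, one_mul,
    ENNReal.ofReal_mul (by positivity), mul_pow, ← mul_assoc] at hproj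
  rw [surfaceMeasure, Measure.restrict_apply Metric.isClosed_closedBall.measurableSet]
  refine le_of_eq_of_le ?_ hproj
  rw [ENNReal.coe_mul, ENNReal.coe_pow, ← ENNReal.ofReal_coe_nnreal (p := (1 + K)⁻¹)]
  simp only [NNReal.coe_inv, NNReal.coe_add, NNReal.coe_one]

lemma exists_hasCones (h : IsLipschitzChart Ω W ν ζ K) {ε : ℝ} (hW : Metric.ball x ε ⊆ W) :
    ∃ c : ℝ, 0 < c ∧ c ≤ 1 ∧ HasCones Ω (closure Ω ∩ Metric.ball x (ε / 2)) ν c (ε / 4) := by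
  have : (1 : ℝ) ≤ 1 + K := le_add_of_nonneg_right K.2
  refine ⟨(2 * (1 + K))⁻¹, by positivity, inv_le_one_of_one_le₀ (by linarith), ?_⟩
  rintro y ⟨hy, hyx⟩ s hs hsε z hz
  have hyW : y ∈ W := hW (Metric.ball_subset_ball (by linarith [Metric.pos_of_mem_ball hyx]) hyx)
  obtain ⟨v, rfl⟩ : ∃ v, z = y + s • ν + v := ⟨z - (y + s • ν), by abel⟩
  have hv : (1 + K) * ‖v‖ < s := by
    rw [mem_ball_iff_norm, add_sub_cancel_left] at hz
    have : 2 * (2 * (1 + K : ℝ))⁻¹ * s = s / (1 + K) := by field_simp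
    rwa [this, lt_div_iff₀' (by positivity)] at hz
  have hzW : y + s • ν + v ∈ W := hW <| by
    have hνs : ‖s • ν‖ = s := by rw [norm_smul, h.norm_eq_one, mul_one, Real.norm_of_nonneg hs.le]
    have hdist := norm_add_le (s • ν) v
    have htri := dist_triangle (y + s • ν + v) y x
    rw [dist_eq_norm _ y, add_assoc, add_sub_cancel_left] at htri
    rw [Metric.mem_ball, add_assoc] at *
    nlinarith [norm_nonneg v]
  rw [h.mem_iff hzW]
  set P := (ℝ ∙ ν)ᗮ.orthogonalProjectionOnto
  have hPv : ζ (P (y + s • ν + v)) ≤ ζ (P y) + K * ‖v‖ := by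
    have hP : P (y + s • ν + v) = P y + P v := by
      rw [map_add]
      exact congrArg (· + P v) (orthogonalProjectionOnto_add_smul y s)
    have hζ := h.lipschitz.dist_le_mul (P y + P v) (P y)
    have hKv : (K : ℝ) * ‖P v‖ ≤ K * ‖v‖ := by
      gcongr
      exact Submodule.norm_orthogonalProjectionOnto_apply_le _ v
    rw [dist_self_add_left, Real.dist_eq] at hζ
    rw [hP]
    linarith [le_of_abs_le hζ]
  have hνv : -‖v‖ ≤ inner ℝ ν v := by
    have := (abs_le.1 (abs_real_inner_le_norm ν v)).1
    rwa [h.norm_eq_one, one_mul] at this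
  calc ζ (P (y + s • ν + v)) ≤ inner ℝ ν y + K * ‖v‖ := by
        linarith [h.le_inner_of_mem_closure hy hyW]
    _ < inner ℝ ν y + s + inner ℝ ν v := by linarith
    _ = inner ℝ ν (y + s • ν + v) := by
        rw [inner_add_right, inner_add_right, inner_smul_right, real_inner_self_eq_norm_sq,
          h.norm_eq_one, one_pow, mul_one]

end IsLipschitzChart

namespace IsBoundedLipschitzOpen

lemma isCompact_frontier (hΩ : IsBoundedLipschitzOpen Ω) : IsCompact (frontier Ω) :=
  Metric.isCompact_of_isClosed_isBounded isClosed_frontier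
    (hΩ.isBounded.closure.subset frontier_subset_closure)

lemma exists_isUpperRegular (hΩ : IsBoundedLipschitzOpen Ω) :
    ∃ C : ℝ≥0, IsUpperRegular (surfaceMeasure Ω) (n - 1) C := by
  suffices ∃ C : ℝ≥0, ∀ (z : Euc n) (r : ℝ), 0 ≤ r →
      Measure.hausdorffMeasure ((n : ℝ) - 1) (Metric.closedBall z r ∩ frontier Ω) ≤
        C * ENNReal.ofReal r ^ (n - 1) by
    simpa only [IsUpperRegular, surfaceMeasure,
      Measure.restrict_apply Metric.isClosed_closedBall.measurableSet] using this
  refine hΩ.isCompact_frontier.induction_on (p := fun S ↦ ∃ C : ℝ≥0, ∀ (z : Euc n) (r : ℝ), 0 ≤ r →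
      Measure.hausdorffMeasure ((n : ℝ) - 1) (Metric.closedBall z r ∩ S) ≤
        C * ENNReal.ofReal r ^ (n - 1)) ⟨0, by simp⟩ ?_ ?_ ?_
  · rintro S T hST ⟨C, hC⟩
    exact ⟨C, fun z r hr ↦ (measure_mono (Set.inter_subset_inter_right _ hST)).trans (hC z r hr)⟩
  · rintro S T ⟨C, hC⟩ ⟨D, hD⟩
    refine ⟨C + D, fun z r hr ↦ ?_⟩
    rw [Set.inter_union_distrib_left, ENNReal.coe_add, add_mul]
    exact (measure_union_le _ _).trans (add_le_add (hC z r hr) (hD z r hr))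
  · intro x₀ hx₀
    obtain ⟨W, ν, ζ, K, hxW, h⟩ := hΩ.exists_chart x₀ hx₀
    exact ⟨frontier Ω ∩ W, inter_mem_nhdsWithin _ (h.isOpen.mem_nhds hxW),
      h.exists_hausdorffMeasure_closedBall_inter_le hΩ.isOpen⟩

lemma exists_isLowerRegularOn (hΩ : IsBoundedLipschitzOpen Ω) (R : ℝ) :
    ∃ c : ℝ≥0, 0 < c ∧ IsLowerRegularOn (surfaceMeasure Ω) (n - 1) c (frontier Ω) R := by
  obtain ⟨c, hc, δ, hδ, h⟩ : ∃ c : ℝ≥0, 0 < c ∧ ∃ δ : ℝ, 0 < δ ∧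
      IsLowerRegularOn (surfaceMeasure Ω) (n - 1) c (frontier Ω) δ := by
    refine hΩ.isCompact_frontier.induction_on (p := fun S ↦ ∃ c : ℝ≥0, 0 < c ∧ ∃ δ : ℝ, 0 < δ ∧
      IsLowerRegularOn (surfaceMeasure Ω) (n - 1) c S δ)
      ⟨1, one_pos, 1, one_pos, fun x hx ↦ hx.elim⟩ ?_ ?_ ?_
    · rintro S T hST ⟨c, hc, δ, hδ, h⟩
      exact ⟨c, hc, δ, hδ, h.mono le_rfl hST le_rfl⟩
    · rintro S T ⟨c, hc, δ, hδ, hS⟩ ⟨c', hc', δ', hδ', hT⟩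
      refine ⟨min c c', lt_min hc hc', min δ δ', lt_min hδ hδ', fun x hx ↦ hx.elim ?_ ?_⟩
      · exact hS.mono (min_le_left _ _) subset_rfl (min_le_left _ _) x
      · exact hT.mono (min_le_right _ _) subset_rfl (min_le_right _ _) x
    · intro x₀ hx₀
      obtain ⟨W, ν, ζ, K, hxW, h⟩ := hΩ.exists_chart x₀ hx₀
      obtain ⟨ε, hε, hεW⟩ := Metric.isOpen_iff.1 h.isOpen x₀ hxW
      obtain ⟨c, hc, hreg⟩ := h.exists_isLowerRegularOn hΩ.isOpen hεW
      exact ⟨frontier Ω ∩ Metric.ball x₀ (ε / 2),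
        inter_mem_nhdsWithin _ (Metric.ball_mem_nhds _ (by positivity)), c, hc, ε / 3,
        by positivity, hreg⟩
  exact h.exists_of_le hc hδ R

lemma exists_hasCones (hΩ : IsBoundedLipschitzOpen Ω) {x₀ : Euc n} (hx₀ : x₀ ∈ frontier Ω) :
    ∃ (ν : Euc n) (c T δ : ℝ), ‖ν‖ = 1 ∧ 0 < c ∧ c ≤ 1 ∧ 0 < T ∧ 0 < δ ∧
      HasCones Ω (closure Ω ∩ Metric.ball x₀ δ) ν c T := by
  obtain ⟨W, ν, ζ, K, hxW, h⟩ := hΩ.exists_chart x₀ hx₀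
  obtain ⟨ε, hε, hεW⟩ := Metric.isOpen_iff.1 h.isOpen x₀ hxW
  obtain ⟨c, hc, hc1, hcones⟩ := h.exists_hasCones hεW
  exact ⟨ν, c, ε / 4, ε / 2, h.norm_eq_one, hc, hc1, by positivity, by positivity, hcones⟩

lemma isFiniteMeasure_surfaceMeasure (hΩ : IsBoundedLipschitzOpen Ω) :
    IsFiniteMeasure (surfaceMeasure Ω) := by
  obtain ⟨C, hC⟩ := hΩ.exists_isUpperRegular
  obtain ⟨R, hR⟩ := hΩ.isCompact_frontier.isBounded.subset_closedBall 0
  have huniv : surfaceMeasure Ω Set.univ = surfaceMeasure Ω (Metric.closedBall 0 (max R 0)) := by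
    rw [surfaceMeasure, Measure.restrict_apply MeasurableSet.univ,
      Measure.restrict_apply Metric.isClosed_closedBall.measurableSet, Set.univ_inter,
      Set.inter_eq_right.2 (hR.trans (Metric.closedBall_subset_closedBall (le_max_left _ _)))]
  refine ⟨?_⟩
  rw [huniv]
  exact (hC 0 _ (le_max_right _ _)).trans_lt
    (ENNReal.mul_lt_top ENNReal.coe_lt_top (ENNReal.pow_lt_top ENNReal.ofReal_lt_top))

end IsBoundedLipschitzOpen

end Geometry

section Integrals

lemma ofReal_rpow_mul_ofReal_rpow {t : ℝ} (ht : 0 < t) (a b : ℝ) :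
    ENNReal.ofReal (t ^ a) * ENNReal.ofReal (t ^ b) = ENNReal.ofReal (t ^ (a + b)) := by
  rw [← ENNReal.ofReal_mul (Real.rpow_nonneg ht.le _), ← Real.rpow_add ht]

lemma enorm_sub_sq_le {E : Type*} [SeminormedAddCommGroup E] (a b d : E) :
    ‖a - b‖ₑ ^ 2 ≤ 2 * (‖a - d‖ₑ ^ 2 + ‖b - d‖ₑ ^ 2) := by
  have h : ‖a - b‖₊ ^ 2 ≤ 2 * (‖a - d‖₊ ^ 2 + ‖b - d‖₊ ^ 2) := by
    rw [← sub_sub_sub_cancel_right a b d]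
    exact (pow_le_pow_left' (nnnorm_sub_le _ _) 2).trans add_sq_le
  simp only [enorm_eq_nnnorm]
  exact_mod_cast h

lemma sq_lintegral_mul_le {α : Type*} [MeasurableSpace α] {μ : Measure α} {f k : α → ENNReal}
    (hf : AEMeasurable f μ) (hk : AEMeasurable k μ) :
    (∫⁻ a, f a * k a ∂μ) ^ 2 ≤ (∫⁻ a, k a ∂μ) * ∫⁻ a, f a ^ 2 * k a ∂μ := by
  have hsqrt (x : ENNReal) : (x ^ (1 / 2 : ℝ)) ^ 2 = x := by
    rw [← ENNReal.rpow_natCast, ← ENNReal.rpow_mul]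
    norm_num
  have holder := ENNReal.lintegral_mul_le_Lp_mul_Lq μ Real.HolderConjugate.two_two
    (hf.mul (hk.pow_const (1 / 2 : ℝ))) (hk.pow_const (1 / 2 : ℝ))
  have hrpow_two (x : ENNReal) : x ^ (2 : ℝ) = x ^ 2 := ENNReal.rpow_natCast x 2
  simp only [Pi.mul_apply, mul_assoc, hrpow_two, mul_pow, ← sq, hsqrt] at holder
  calc (∫⁻ a, f a * k a ∂μ) ^ 2 ≤ _ := pow_le_pow_left' holder 2
    _ = _ := by rw [mul_pow, hsqrt, hsqrt, mul_comm]

lemma lintegral_Ioo_rpow_neg_half {s : ℝ} (hs : 0 < s) :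
    ∫⁻ t in Set.Ioo 0 s, ENNReal.ofReal (t ^ (-(1 / 2) : ℝ)) =
      ENNReal.ofReal (2 * s ^ (1 / 2 : ℝ)) := by
  have hInt : IntegrableOn (fun t : ℝ ↦ t ^ (-(1 / 2) : ℝ)) (Set.Ioo 0 s) :=
    (intervalIntegral.integrableOn_Ioo_rpow_iff hs).2 (by norm_num)
  rw [← ofReal_integral_eq_lintegral_ofReal hInt]
  · rw [← integral_Ioc_eq_integral_Ioo, ← intervalIntegral.integral_of_le hs.le,
      integral_rpow (Or.inl (by norm_num))]
    congr 1
    ring_nf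
  · filter_upwards [ae_restrict_mem measurableSet_Ioo] with t ht
    exact Real.rpow_nonneg ht.1.le _

lemma lintegral_Ioi_rpow_neg_three_half {t : ℝ} (ht : 0 < t) :
    ∫⁻ s in Set.Ioi t, ENNReal.ofReal (s ^ (-(3 / 2) : ℝ)) =
      ENNReal.ofReal (2 * t ^ (-(1 / 2) : ℝ)) := by
  have hInt : IntegrableOn (fun t : ℝ ↦ t ^ (-(3 / 2) : ℝ)) (Set.Ioi t) :=
    integrableOn_Ioi_rpow_of_lt (by norm_num) ht
  rw [← ofReal_integral_eq_lintegral_ofReal hInt]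
  · rw [integral_Ioi_rpow_of_lt (by norm_num) ht]
    congr 1
    ring_nf
  · filter_upwards [ae_restrict_mem measurableSet_Ioi] with s hs
    exact Real.rpow_nonneg (ht.trans hs).le _

lemma lintegral_mul_lintegral_Ioo_le {k F : ℝ → ENNReal} (hk : Measurable k) (hF : Measurable F)
    (a T : ℝ) :
    ∫⁻ s in Set.Ioo a T, k s * ∫⁻ t in Set.Ioo a s, F t ≤
      ∫⁻ t in Set.Ioo a T, (∫⁻ s in Set.Ioi t, k s) * F t := by
  have hind : Measurable fun p : ℝ × ℝ ↦ (Set.Ioi p.2).indicator k p.1 :=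
    (hk.comp measurable_fst).indicator (measurableSet_lt measurable_snd measurable_fst)
  calc ∫⁻ s in Set.Ioo a T, k s * ∫⁻ t in Set.Ioo a s, F t
      ≤ ∫⁻ s in Set.Ioo a T, ∫⁻ t in Set.Ioo a T, (Set.Ioi t).indicator k s * F t := by
        refine setLIntegral_mono' measurableSet_Ioo fun s hs ↦ ?_
        rw [← lintegral_const_mul _ hF]
        refine le_trans (setLIntegral_mono' measurableSet_Ioo fun t ht ↦ ?_)
          (lintegral_mono_set (Set.Ioo_subset_Ioo_right hs.2.le))
        rw [Set.indicator_of_mem (Set.mem_Ioi.2 ht.2)]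
    _ = ∫⁻ t in Set.Ioo a T, ∫⁻ s in Set.Ioo a T, (Set.Ioi t).indicator k s * F t :=
        lintegral_lintegral_swap (hind.mul (hF.comp measurable_snd)).aemeasurable
    _ ≤ ∫⁻ t in Set.Ioo a T, (∫⁻ s in Set.Ioi t, k s) * F t := by
        refine lintegral_mono fun t ↦ ?_
        rw [lintegral_mul_const _ (hk.indicator measurableSet_Ioi),
          ← lintegral_indicator measurableSet_Ioi]
        gcongr
        exact Measure.restrict_le_self

-- Cauchy–Schwarz with the weight `t ^ (-1/2)`.
lemma enorm_sub_sq_le_mul_lintegral {φ φ' : ℝ → ℝ} (hφ : ∀ t, HasDerivAt φ (φ' t) t)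
    (hφ' : Continuous φ') {s : ℝ} (hs : 0 < s) :
    ‖φ 0 - φ s‖ₑ ^ 2 ≤ ENNReal.ofReal (2 * s ^ (1 / 2 : ℝ)) *
      ∫⁻ t in Set.Ioo 0 s, ENNReal.ofReal (t ^ (1 / 2 : ℝ)) * ‖φ' t‖ₑ ^ 2 := by
  have := hφ'.measurable
  have hftc : ‖φ 0 - φ s‖ₑ ≤ ∫⁻ t in Set.Ioo 0 s, ‖φ' t‖ₑ := by
    have : φ s - φ 0 = ∫ t in Set.Ioo 0 s, φ' t := by
      rw [← integral_Ioc_eq_integral_Ioo, ← intervalIntegral.integral_of_le hs.le]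
      exact (intervalIntegral.integral_eq_sub_of_hasDerivAt (fun t _ ↦ hφ t)
        (hφ'.intervalIntegrable _ _)).symm
    rw [← enorm_neg, neg_sub, this]
    exact enorm_integral_le_lintegral_enorm _
  calc ‖φ 0 - φ s‖ₑ ^ 2
      ≤ (∫⁻ t in Set.Ioo 0 s, ‖φ' t‖ₑ) ^ 2 := pow_le_pow_left' hftc 2
    _ = (∫⁻ t in Set.Ioo 0 s, (ENNReal.ofReal (t ^ (1 / 2 : ℝ)) * ‖φ' t‖ₑ) *
          ENNReal.ofReal (t ^ (-(1 / 2) : ℝ))) ^ 2 := by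
        congr 1
        refine setLIntegral_congr_fun measurableSet_Ioo fun t ht ↦ ?_
        rw [mul_right_comm, ofReal_rpow_mul_ofReal_rpow ht.1]
        simp
    _ ≤ _ := sq_lintegral_mul_le (by fun_prop) (by fun_prop)
    _ = _ := by
        rw [lintegral_Ioo_rpow_neg_half hs]
        congr 1
        refine setLIntegral_congr_fun measurableSet_Ioo fun t ht ↦ ?_
        rw [mul_pow, sq (ENNReal.ofReal _), mul_right_comm, mul_assoc (ENNReal.ofReal _),
          ofReal_rpow_mul_ofReal_rpow ht.1]
        simp

lemma lintegral_hardy {φ φ' : ℝ → ℝ} (hφ : ∀ t, HasDerivAt φ (φ' t) t) (hφ' : Continuous φ')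
    (T : ℝ) :
    ∫⁻ s in Set.Ioo 0 T, (ENNReal.ofReal s ^ 2)⁻¹ * ‖φ 0 - φ s‖ₑ ^ 2 ≤
      4 * ∫⁻ s in Set.Ioo 0 T, ‖φ' s‖ₑ ^ 2 := by
  have hm := hφ'.measurable
  have hweight {s : ℝ} (hs : 0 < s) : (ENNReal.ofReal s ^ 2)⁻¹ *
      ENNReal.ofReal (2 * s ^ (1 / 2 : ℝ)) = 2 * ENNReal.ofReal (s ^ (-(3 / 2) : ℝ)) := by
    rw [← ENNReal.ofReal_pow hs.le, ← ENNReal.ofReal_inv_of_pos (by positivity),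
      ← Real.rpow_natCast, ← Real.rpow_neg hs.le, ENNReal.ofReal_mul two_pos.le, mul_left_comm,
      ofReal_rpow_mul_ofReal_rpow hs, ENNReal.ofReal_ofNat]
    norm_num
  calc ∫⁻ s in Set.Ioo 0 T, (ENNReal.ofReal s ^ 2)⁻¹ * ‖φ 0 - φ s‖ₑ ^ 2
      ≤ ∫⁻ s in Set.Ioo 0 T, 2 * ENNReal.ofReal (s ^ (-(3 / 2) : ℝ)) *
          ∫⁻ t in Set.Ioo 0 s, ENNReal.ofReal (t ^ (1 / 2 : ℝ)) * ‖φ' t‖ₑ ^ 2 := by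
        refine setLIntegral_mono' measurableSet_Ioo fun s hs ↦ ?_
        rw [← hweight hs.1, mul_assoc]
        gcongr
        exact enorm_sub_sq_le_mul_lintegral hφ hφ' hs.1
    _ ≤ ∫⁻ t in Set.Ioo 0 T, (∫⁻ s in Set.Ioi t, 2 * ENNReal.ofReal (s ^ (-(3 / 2) : ℝ))) *
          (ENNReal.ofReal (t ^ (1 / 2 : ℝ)) * ‖φ' t‖ₑ ^ 2) :=
        lintegral_mul_lintegral_Ioo_le (by fun_prop) (by fun_prop) 0 T
    _ = ∫⁻ t in Set.Ioo 0 T, 4 * ‖φ' t‖ₑ ^ 2 := by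
        refine setLIntegral_congr_fun measurableSet_Ioo fun t ht ↦ ?_
        rw [lintegral_const_mul _ (by fun_prop), lintegral_Ioi_rpow_neg_three_half ht.1,
          ENNReal.ofReal_mul two_pos.le, ENNReal.ofReal_ofNat, ← mul_assoc, ← mul_assoc,
          mul_assoc (2 * 2), ofReal_rpow_mul_ofReal_rpow ht.1]
        norm_num
    _ = _ := lintegral_const_mul _ (by fun_prop)

lemma lintegral_hardy_ray {E : Type*} [NormedAddCommGroup E] [NormedSpace ℝ E] {ψ : E → ℝ}
    (hψ : ContDiff ℝ 1 ψ) (x v : E) (T : ℝ) :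
    ∫⁻ s in Set.Ioo 0 T, (ENNReal.ofReal s ^ 2)⁻¹ * ‖ψ x - ψ (x + s • v)‖ₑ ^ 2 ≤
      4 * (‖v‖ₑ ^ 2 * ∫⁻ s in Set.Ioo 0 T, ‖fderiv ℝ ψ (x + s • v)‖ₑ ^ 2) := by
  have : Continuous (fderiv ℝ ψ) := hψ.continuous_fderiv one_ne_zero
  have hderiv (t : ℝ) :
      HasDerivAt (fun t ↦ ψ (x + t • v)) (fderiv ℝ ψ (x + t • v) v) t := by
    have hline : HasDerivAt (fun t : ℝ ↦ x + t • v) v t := by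
      simpa using ((hasDerivAt_id t).smul_const v).const_add x
    exact ((hψ.differentiable one_ne_zero) _).hasFDerivAt.comp_hasDerivAt t hline
  calc ∫⁻ s in Set.Ioo 0 T, (ENNReal.ofReal s ^ 2)⁻¹ * ‖ψ x - ψ (x + s • v)‖ₑ ^ 2
      ≤ 4 * ∫⁻ s in Set.Ioo 0 T, ‖fderiv ℝ ψ (x + s • v) v‖ₑ ^ 2 := by
        simpa only [zero_smul, add_zero] using lintegral_hardy hderiv (by fun_prop) T
    _ ≤ 4 * ∫⁻ s in Set.Ioo 0 T, ‖v‖ₑ ^ 2 * ‖fderiv ℝ ψ (x + s • v)‖ₑ ^ 2 := by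
        gcongr with s
        rw [← mul_pow, mul_comm]
        exact pow_le_pow_left' (ContinuousLinearMap.le_opENorm _ _) 2
    _ = _ := by rw [lintegral_const_mul' _ _ (by simp)]

section Haar

variable {E : Type*} [NormedAddCommGroup E] [MeasurableSpace E] [BorelSpace E]
  {μ : Measure E}

lemma lintegral_comp_add_smul [NormedSpace ℝ E] [FiniteDimensional ℝ E] [μ.IsAddHaarMeasure]
    {G : E → ENNReal} (hG : Measurable G) (a : E) {s : ℝ} (hs : 0 < s) :
    ∫⁻ w, G (a + s • w) ∂μ = (ENNReal.ofReal s ^ Module.finrank ℝ E)⁻¹ * ∫⁻ z, G z ∂μ := by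
  have hmap : ∫⁻ w, G (a + s • w) ∂μ = ∫⁻ z, G (a + z) ∂(μ.map (s • · : E → E)) :=
    (lintegral_map (hG.comp (measurable_const_add a)) (measurable_const_smul s)).symm
  rw [hmap, Measure.map_addHaar_smul _ hs.ne', lintegral_smul_measure, lintegral_add_left_eq_self,
    abs_of_pos (by positivity), ENNReal.ofReal_inv_of_pos (by positivity),
    ENNReal.ofReal_pow hs.le, smul_eq_mul]

lemma setLIntegral_ball_comp_add_le [μ.IsAddLeftInvariant] (F : E → ENNReal) {v : E} {r R : ℝ}
    (hv : ‖v‖ + r ≤ R) :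
    ∫⁻ w in Metric.ball 0 r, F (v + w) ∂μ ≤ ∫⁻ w in Metric.ball 0 R, F w ∂μ := by
  rw [← lintegral_indicator Metric.isOpen_ball.measurableSet,
    ← lintegral_indicator Metric.isOpen_ball.measurableSet,
    ← lintegral_add_left_eq_self ((Metric.ball 0 R).indicator F) v]
  refine lintegral_mono fun w ↦ ?_
  by_cases hw : w ∈ Metric.ball 0 r
  · have hvw : v + w ∈ Metric.ball 0 R := by
      rw [mem_ball_zero_iff] at hw ⊢
      linarith [norm_add_le v w]
    rw [Set.indicator_of_mem hw, Set.indicator_of_mem hvw]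
  · rw [Set.indicator_of_notMem hw]
    exact zero_le

end Haar

end Integrals

section Cones

variable {Ω P : Set (Euc n)} {ν x x' z : Euc n} {c s s' T : ℝ} {σ : Measure (Euc n)} {C : ℝ≥0}

/-- A measurable patch `P` outside `Ω`, for instance of the boundary, whose points are the vertices
of cones contained in `Ω` with a common axis, aperture and height. -/
structure IsConePatch (Ω P : Set (Euc n)) (ν : Euc n) (c T : ℝ) : Prop where
  norm_eq_one : ‖ν‖ = 1
  pos : 0 < c
  le_one : c ≤ 1
  measurableSet : MeasurableSet P
  disjoint : Disjoint P Ω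
  hasCones : HasCones Ω P ν c T

lemma HasCones.ball_subset (h : HasCones Ω P ν c T) (hx : x ∈ P) (hs : 0 < s) (hsT : s < T)
    (hz : ‖z - x - s • ν‖ < c * s) : Metric.ball z (c * s) ⊆ Ω := by
  refine (Metric.ball_subset_ball' ?_).trans (h x hx s hs hsT)
  rw [dist_eq_norm, ← sub_sub]
  linarith

lemma HasCones.mem (h : HasCones Ω P ν c T) (hx : x ∈ P) (hs : 0 < s) (hsT : s < T)
    (hz : ‖z - x - s • ν‖ < c * s) : z ∈ Ω :=
  h.ball_subset hx hs hsT hz (Metric.mem_ball_self ((norm_nonneg _).trans_lt hz))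

lemma HasCones.le_dist (h : HasCones Ω P ν c T) (hx : x ∈ P) (hx' : x' ∉ Ω) (hs : 0 < s)
    (hsT : s < T) (hz : ‖z - x - s • ν‖ < c * s) : c * s ≤ dist x' z :=
  not_lt.1 fun hlt ↦ hx' (h.ball_subset hx hs hsT hz hlt)

lemma dist_le_of_norm_sub_smul_lt (hν : ‖ν‖ = 1) (hc1 : c ≤ 1) (hs : 0 < s)
    (hz : ‖z - x - s • ν‖ < c * s) : dist x z ≤ 2 * s := by
  have hcs : c * s ≤ s := mul_le_of_le_one_left hs.le hc1
  calc dist x z = ‖(z - x - s • ν) + s • ν‖ := by rw [sub_add_cancel, dist_comm, dist_eq_norm]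
    _ ≤ ‖z - x - s • ν‖ + ‖s • ν‖ := norm_add_le _ _
    _ ≤ 2 * s := by
        rw [norm_smul, hν, Real.norm_of_nonneg hs.le]
        linarith

/-- The kernel that turns averages over the section at height `s` of the cone with vertex `x` into
integrals over the ambient space. -/
def coneKernel (ν : Euc n) (c : ℝ) (x : Euc n) (s : ℝ) (z : Euc n) : ENNReal :=
  {z : Euc n | ‖z - x - s • ν‖ < c * s}.indicator (fun _ ↦ (ENNReal.ofReal s ^ n)⁻¹) z

lemma coneKernel_of_not_lt (h : ¬ ‖z - x - s • ν‖ < c * s) : coneKernel ν c x s z = 0 :=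
  Set.indicator_of_notMem (s := {z | ‖z - x - s • ν‖ < c * s}) h _

lemma measurable_coneKernel (ν : Euc n) (c : ℝ) :
    Measurable fun p : Euc n × ℝ × Euc n ↦ coneKernel ν c p.1 p.2.1 p.2.2 := by
  have hset : MeasurableSet {p : Euc n × ℝ × Euc n | ‖p.2.2 - p.1 - p.2.1 • ν‖ < c * p.2.1} :=
    (isOpen_lt (by fun_prop) (by fun_prop)).measurableSet
  exact (show Measurable fun p : Euc n × ℝ × Euc n ↦ (ENNReal.ofReal p.2.1 ^ n)⁻¹ by
    fun_prop).indicator hset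

lemma lintegral_ball_eq_coneKernel {F : Euc n → ENNReal} (hF : Measurable F) (x : Euc n)
    (hs : 0 < s) :
    ∫⁻ w in Metric.ball 0 c, F (x + s • (ν + w)) = ∫⁻ z, coneKernel ν c x s z * F z := by
  set S : Set (Euc n) := {z | ‖z - x - s • ν‖ < c * s}
  have hS : MeasurableSet S := (isOpen_lt (by fun_prop) (by fun_prop)).measurableSet
  have hmem (w : Euc n) : x + s • ν + s • w ∈ S ↔ w ∈ Metric.ball 0 c := by
    rw [Set.mem_ofPred_eq, add_sub_right_comm, add_sub_cancel_left, add_sub_cancel_left, norm_smul,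
      Real.norm_of_nonneg hs.le, mul_comm c s, mul_lt_mul_iff_right₀ hs, mem_ball_zero_iff]
  calc ∫⁻ w in Metric.ball 0 c, F (x + s • (ν + w))
      = ∫⁻ w, S.indicator F (x + s • ν + s • w) := by
        rw [← lintegral_indicator Metric.isOpen_ball.measurableSet]
        classical simp only [Set.indicator_apply, hmem, smul_add, ← add_assoc]
    _ = ∫⁻ z, (ENNReal.ofReal s ^ n)⁻¹ * S.indicator F z := by
        rw [lintegral_comp_add_smul (hF.indicator hS) _ hs, finrank_euclideanSpace_fin,
          lintegral_const_mul _ (hF.indicator hS)]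
    _ = ∫⁻ z, coneKernel ν c x s z * F z := by
        refine lintegral_congr fun z ↦ ?_
        simp only [coneKernel, S, Set.indicator_apply]
        split_ifs <;> simp

-- Two cones meeting at `z` have comparable heights and vertices close to `z`.
lemma IsConePatch.coneKernel_le (h : IsConePatch Ω P ν c T) (hx' : x' ∈ P)
    (hs' : s' ∈ Set.Ioo 0 T) (hz' : ‖z - x' - s' • ν‖ < c * s') (hx : x ∈ P)
    (hs : s ∈ Set.Ioo 0 T) :
    coneKernel ν c x s z ≤
      (Metric.closedBall z (2 * (2 / c * s'))).indicator (fun _ ↦ 1) x *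
        (Set.Ioc 0 (2 / c * s')).indicator (fun _ ↦ (ENNReal.ofReal (s' / (2 / c)) ^ n)⁻¹) s := by
  by_cases hz : ‖z - x - s • ν‖ < c * s
  · have hss' := (h.hasCones.le_dist hx (h.disjoint.notMem_of_mem_left hx') hs.1 hs.2 hz).trans
      (dist_le_of_norm_sub_smul_lt h.norm_eq_one h.le_one hs'.1 hz')
    have hs's := (h.hasCones.le_dist hx' (h.disjoint.notMem_of_mem_left hx) hs'.1 hs'.2 hz').trans
      (dist_le_of_norm_sub_smul_lt h.norm_eq_one h.le_one hs.1 hz)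
    have hs_le : s ≤ 2 / c * s' := by
      rw [div_mul_eq_mul_div, le_div_iff₀ h.pos]
      linarith
    have hle_s : s' / (2 / c) ≤ s := by
      rw [div_div_eq_mul_div, div_le_iff₀ two_pos]
      linarith
    have hxz : x ∈ Metric.closedBall z (2 * (2 / c * s')) :=
      (dist_le_of_norm_sub_smul_lt h.norm_eq_one h.le_one hs.1 hz).trans (by linarith)
    have hs_mem : s ∈ Set.Ioc 0 (2 / c * s') := ⟨hs.1, hs_le⟩
    rw [coneKernel, Set.indicator_of_mem (s := {z | ‖z - x - s • ν‖ < c * s}) hz,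
      Set.indicator_of_mem hxz, Set.indicator_of_mem hs_mem, one_mul]
    gcongr
  · rw [coneKernel_of_not_lt hz]
    exact zero_le

lemma measure_closedBall_mul_le (hσ : IsUpperRegular σ (n - 1) C) (hn : 1 ≤ n) {κ : ℝ} (hκ : 0 < κ)
    (hs : 0 < s) (z : Euc n) :
    σ (Metric.closedBall z (2 * (κ * s))) *
        ((ENNReal.ofReal (s / κ) ^ n)⁻¹ * ENNReal.ofReal (κ * s)) ≤
      C * ENNReal.ofReal (2 ^ (n - 1) * κ ^ (2 * n)) := by
  refine (mul_le_mul_left (hσ _ _ (by positivity)) _).trans_eq ?_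
  rw [mul_assoc, ← ENNReal.ofReal_pow (by positivity), ← ENNReal.ofReal_pow (by positivity),
    ← ENNReal.ofReal_inv_of_pos (by positivity), ← ENNReal.ofReal_mul (by positivity),
    ← ENNReal.ofReal_mul (by positivity)]
  congr 2
  obtain ⟨m, rfl⟩ := Nat.exists_eq_add_of_le' hn
  rw [Nat.add_sub_cancel, div_pow, inv_div]
  field_simp
  ring_nf

lemma IsConePatch.lintegral_coneKernel_le [SFinite σ] (h : IsConePatch Ω P ν c T)
    (hσ : IsUpperRegular σ (n - 1) C) (z : Euc n) :
    ∫⁻ x in P, ∫⁻ s in Set.Ioo 0 T, coneKernel ν c x s z ∂volume ∂σ ≤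
      C * ENNReal.ofReal (2 ^ (n - 1) * (2 / c) ^ (2 * n)) := by
  by_cases hex : ∃ x ∈ P, ∃ s ∈ Set.Ioo 0 T, ‖z - x - s • ν‖ < c * s
  · obtain ⟨x', hx', s', hs', hz'⟩ := hex
    have hn := one_le_of_norm_eq_one h.norm_eq_one
    have hmi : Measurable ((Set.Ioc 0 (2 / c * s')).indicator
        (fun _ ↦ (ENNReal.ofReal (s' / (2 / c)) ^ n)⁻¹)) :=
      measurable_const.indicator measurableSet_Ioc
    calc ∫⁻ x in P, ∫⁻ s in Set.Ioo 0 T, coneKernel ν c x s z ∂volume ∂σ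
        ≤ ∫⁻ x in P, ∫⁻ s in Set.Ioo 0 T,
            (Metric.closedBall z (2 * (2 / c * s'))).indicator (fun _ ↦ 1) x *
            (Set.Ioc 0 (2 / c * s')).indicator
              (fun _ ↦ (ENNReal.ofReal (s' / (2 / c)) ^ n)⁻¹) s ∂volume ∂σ :=
          setLIntegral_mono' h.measurableSet fun x hx ↦
            setLIntegral_mono' measurableSet_Ioo fun s hs ↦ h.coneKernel_le hx' hs' hz' hx hs
      _ ≤ ∫⁻ x, ∫⁻ s, (Metric.closedBall z (2 * (2 / c * s'))).indicator (fun _ ↦ 1) x *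
            (Set.Ioc 0 (2 / c * s')).indicator
              (fun _ ↦ (ENNReal.ofReal (s' / (2 / c)) ^ n)⁻¹) s ∂volume ∂σ :=
          (setLIntegral_le_lintegral _ _).trans
            (lintegral_mono fun x ↦ setLIntegral_le_lintegral _ _)
      _ = σ (Metric.closedBall z (2 * (2 / c * s'))) *
            ((ENNReal.ofReal (s' / (2 / c)) ^ n)⁻¹ * ENNReal.ofReal (2 / c * s')) := by
          simp only [lintegral_const_mul _ hmi]
          rw [lintegral_mul_const _
            (measurable_const.indicator Metric.isClosed_closedBall.measurableSet),
            lintegral_indicator_const Metric.isClosed_closedBall.measurableSet, one_mul,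
            lintegral_indicator_const measurableSet_Ioc, Real.volume_Ioc, sub_zero]
      _ ≤ _ := measure_closedBall_mul_le hσ hn (div_pos two_pos h.pos) hs'.1 z
  · push Not at hex
    have hzero : ∫⁻ x in P, ∫⁻ s in Set.Ioo 0 T, coneKernel ν c x s z ∂volume ∂σ =
        ∫⁻ x in P, ∫⁻ _ in Set.Ioo 0 T, 0 ∂volume ∂σ :=
      setLIntegral_congr_fun h.measurableSet fun x hx ↦
        setLIntegral_congr_fun measurableSet_Ioo fun s hs ↦
          coneKernel_of_not_lt (hex x hx s hs).not_gt
    rw [hzero, lintegral_zero, lintegral_zero]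
    exact zero_le

lemma IsConePatch.lintegral_ball_eq_setLIntegral_coneKernel (h : IsConePatch Ω P ν c T)
    (hΩ : MeasurableSet Ω) {F : Euc n → ENNReal} (hF : Measurable F) (hx : x ∈ P)
    (hs : s ∈ Set.Ioo 0 T) :
    ∫⁻ w in Metric.ball 0 c, F (x + s • (ν + w)) = ∫⁻ z in Ω, coneKernel ν c x s z * F z := by
  rw [lintegral_ball_eq_coneKernel hF x hs.1, ← lintegral_indicator hΩ]
  refine lintegral_congr fun z ↦ ?_
  by_cases hz : z ∈ Ω
  · rw [Set.indicator_of_mem hz]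
  · rw [Set.indicator_of_notMem hz,
      coneKernel_of_not_lt fun hz' ↦ hz (h.hasCones.mem hx hs.1 hs.2 hz'), zero_mul]

lemma IsConePatch.exists_lintegral_cones_le [SFinite σ] (h : IsConePatch Ω P ν c T)
    (hσ : IsUpperRegular σ (n - 1) C) (hΩ : MeasurableSet Ω) :
    ∃ A : ℝ≥0, ∀ F : Euc n → ENNReal, Measurable F →
      ∫⁻ x in P, ∫⁻ s in Set.Ioo 0 T, ∫⁻ w in Metric.ball 0 c, F (x + s • (ν + w))
        ∂volume ∂volume ∂σ ≤ A * ∫⁻ z in Ω, F z := by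
  refine ⟨C * (2 ^ (n - 1) * (2 / c) ^ (2 * n)).toNNReal, fun F hF ↦ ?_⟩
  have hk := measurable_coneKernel ν c
  calc ∫⁻ x in P, ∫⁻ s in Set.Ioo 0 T, ∫⁻ w in Metric.ball 0 c, F (x + s • (ν + w))
      ∂volume ∂volume ∂σ
      = ∫⁻ x in P, ∫⁻ s in Set.Ioo 0 T, ∫⁻ z in Ω, coneKernel ν c x s z * F z
        ∂volume ∂volume ∂σ :=
        setLIntegral_congr_fun h.measurableSet fun x hx ↦
          setLIntegral_congr_fun measurableSet_Ioo fun s hs ↦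
            h.lintegral_ball_eq_setLIntegral_coneKernel hΩ hF hx hs
    _ = ∫⁻ x in P, ∫⁻ z in Ω, ∫⁻ s in Set.Ioo 0 T, coneKernel ν c x s z * F z
        ∂volume ∂volume ∂σ := by
        refine lintegral_congr fun x ↦ lintegral_lintegral_swap (Measurable.aemeasurable ?_)
        exact (hk.comp measurable_prodMk_left).mul (hF.comp measurable_snd)
    _ = ∫⁻ z in Ω, ∫⁻ x in P, ∫⁻ s in Set.Ioo 0 T, coneKernel ν c x s z * F z
        ∂volume ∂σ ∂volume := by
        refine lintegral_lintegral_swap (Measurable.aemeasurable ?_)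
        refine Measurable.lintegral_prod_right'
          (f := fun q : (Euc n × Euc n) × ℝ ↦ coneKernel ν c q.1.1 q.2 q.1.2 * F q.1.2) ?_
        refine Measurable.mul ?_ (hF.comp (by fun_prop))
        exact hk.comp (f := fun q : (Euc n × Euc n) × ℝ ↦ (q.1.1, q.2, q.1.2)) (by fun_prop)
    _ ≤ ∫⁻ z in Ω, C * ENNReal.ofReal (2 ^ (n - 1) * (2 / c) ^ (2 * n)) * F z := by
        refine lintegral_mono fun z ↦ ?_
        have hkz (x : Euc n) : Measurable fun s ↦ coneKernel ν c x s z :=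
          hk.comp (f := fun s : ℝ ↦ (x, s, z)) (by fun_prop)
        simp only [lintegral_mul_const _ (hkz _)]
        rw [lintegral_mul_const]
        · gcongr
          exact h.lintegral_coneKernel_le hσ z
        · exact Measurable.lintegral_prod_right' (f := fun q : Euc n × ℝ ↦ coneKernel ν c q.1 q.2 z)
            (hk.comp (f := fun q : Euc n × ℝ ↦ (q.1, q.2, z)) (by fun_prop))
    _ = _ := by rw [lintegral_const_mul _ hF, ENNReal.coe_mul, ENNReal.ofReal]

end Cones

section ConeOscillation

variable {Ω P : Set (Euc n)} {ν : Euc n} {c T : ℝ} {σ : Measure (Euc n)} {C : ℝ≥0} {ψ : Euc n → ℝ}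

/-- The mean square deviation from `ψ x` of `ψ` on the section at height `s` of the cone with
vertex `x`, not divided by the volume of the ball of radius `c`. -/
def coneOsc (ν : Euc n) (c : ℝ) (ψ : Euc n → ℝ) (x : Euc n) (s : ℝ) : ENNReal :=
  ∫⁻ w in Metric.ball 0 c, ‖ψ x - ψ (x + s • (ν + w))‖ₑ ^ 2

lemma measurable_coneOsc (hψ : Continuous ψ) :
    Measurable fun p : Euc n × ℝ ↦ coneOsc ν c ψ p.1 p.2 :=
  Measurable.lintegral_prod_right'
    (f := fun q : (Euc n × ℝ) × Euc n ↦ ‖ψ q.1.1 - ψ (q.1.1 + q.1.2 • (ν + q.2))‖ₑ ^ 2)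
    (Continuous.measurable (by fun_prop))

-- Two nearby vertices are compared through the intersection of their cones.
lemma volume_mul_enorm_sub_sq_le (hψ : Continuous ψ) (hc : 0 ≤ c) {x y : Euc n} {s : ℝ}
    (hs : 0 < s) (hxy : dist x y ≤ c / 2 * s) :
    volume (Metric.ball (0 : Euc n) (c / 2)) * ‖ψ x - ψ y‖ₑ ^ 2 ≤
      2 * (coneOsc ν c ψ x s + coneOsc ν c ψ y s) := by
  set v := s⁻¹ • (x - y) with hv
  have hv_norm : ‖v‖ ≤ c / 2 := by
    rwa [hv, norm_smul, norm_inv, Real.norm_of_nonneg hs.le, ← dist_eq_norm, inv_mul_le_iff₀ hs,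
      mul_comm]
  have hshift (w : Euc n) : y + s • (ν + (v + w)) = x + s • (ν + w) := by
    rw [add_left_comm ν, smul_add s v, hv, smul_inv_smul₀ hs.ne', ← add_assoc, add_sub_cancel]
  have hx : ∫⁻ w in Metric.ball 0 (c / 2), ‖ψ x - ψ (x + s • (ν + w))‖ₑ ^ 2 ≤
      coneOsc ν c ψ x s :=
    lintegral_mono_set (Metric.ball_subset_ball (half_le_self hc))
  have hy : ∫⁻ w in Metric.ball 0 (c / 2), ‖ψ y - ψ (x + s • (ν + w))‖ₑ ^ 2 ≤
      coneOsc ν c ψ y s := by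
    simp only [← hshift]
    exact setLIntegral_ball_comp_add_le (fun w ↦ ‖ψ y - ψ (y + s • (ν + w))‖ₑ ^ 2) (by linarith)
  calc volume (Metric.ball (0 : Euc n) (c / 2)) * ‖ψ x - ψ y‖ₑ ^ 2
      = ∫⁻ _ in Metric.ball (0 : Euc n) (c / 2), ‖ψ x - ψ y‖ₑ ^ 2 := by
        rw [setLIntegral_const, mul_comm]
    _ ≤ ∫⁻ w in Metric.ball (0 : Euc n) (c / 2), 2 * (‖ψ x - ψ (x + s • (ν + w))‖ₑ ^ 2 +
          ‖ψ y - ψ (x + s • (ν + w))‖ₑ ^ 2) := lintegral_mono fun w ↦ enorm_sub_sq_le _ _ _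
    _ ≤ 2 * (coneOsc ν c ψ x s + coneOsc ν c ψ y s) := by
        rw [lintegral_const_mul' _ _ (by norm_num),
          lintegral_add_left (Continuous.measurable (by fun_prop))]
        gcongr

lemma lintegral_coneOsc_le (hν : ‖ν‖ = 1) (hc1 : c ≤ 1) (hψ : ContDiff ℝ 1 ψ) (x : Euc n) :
    ∫⁻ s in Set.Ioo 0 T, (ENNReal.ofReal s ^ 2)⁻¹ * coneOsc ν c ψ x s ≤
      16 * ∫⁻ s in Set.Ioo 0 T, ∫⁻ w in Metric.ball 0 c, ‖fderiv ℝ ψ (x + s • (ν + w))‖ₑ ^ 2 := by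
  have : Continuous (fderiv ℝ ψ) := hψ.continuous_fderiv one_ne_zero
  have hψc := hψ.continuous
  calc ∫⁻ s in Set.Ioo 0 T, (ENNReal.ofReal s ^ 2)⁻¹ * coneOsc ν c ψ x s
      = ∫⁻ s in Set.Ioo 0 T, ∫⁻ w in Metric.ball 0 c,
          (ENNReal.ofReal s ^ 2)⁻¹ * ‖ψ x - ψ (x + s • (ν + w))‖ₑ ^ 2 := by
        refine lintegral_congr fun s ↦ ?_
        rw [coneOsc, lintegral_const_mul _ (Continuous.measurable (by fun_prop))]
    _ = ∫⁻ w in Metric.ball 0 c, ∫⁻ s in Set.Ioo 0 T,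
          (ENNReal.ofReal s ^ 2)⁻¹ * ‖ψ x - ψ (x + s • (ν + w))‖ₑ ^ 2 :=
        lintegral_lintegral_swap (Measurable.mul (by fun_prop)
          (Continuous.measurable (by fun_prop))).aemeasurable
    _ ≤ ∫⁻ w in Metric.ball 0 c, 16 * ∫⁻ s in Set.Ioo 0 T,
          ‖fderiv ℝ ψ (x + s • (ν + w))‖ₑ ^ 2 := by
        refine setLIntegral_mono' Metric.isOpen_ball.measurableSet fun w hw ↦ ?_
        have hνw : ‖ν + w‖ₑ ≤ 2 := by
          rw [mem_ball_zero_iff] at hw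
          rw [← ofReal_norm]
          refine ENNReal.ofReal_le_of_le_toReal ((norm_add_le _ _).trans ?_)
          rw [ENNReal.toReal_ofNat]
          linarith
        calc _ ≤ _ := lintegral_hardy_ray hψ x (ν + w) T
          _ ≤ 4 * (2 ^ 2 * ∫⁻ s in Set.Ioo 0 T, ‖fderiv ℝ ψ (x + s • (ν + w))‖ₑ ^ 2) := by gcongr
          _ = _ := by
              rw [← mul_assoc]
              norm_num
    _ = 16 * ∫⁻ w in Metric.ball 0 c, ∫⁻ s in Set.Ioo 0 T,
          ‖fderiv ℝ ψ (x + s • (ν + w))‖ₑ ^ 2 := lintegral_const_mul' _ _ (by norm_num)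
    _ = _ := by
        congr 1
        exact lintegral_lintegral_swap
          (f := fun w s ↦ ‖fderiv ℝ ψ (x + s • (ν + w))‖ₑ ^ 2)
          (Continuous.measurable (by fun_prop)).aemeasurable

lemma IsConePatch.exists_lintegral_coneOsc_le [SFinite σ] (h : IsConePatch Ω P ν c T)
    (hσ : IsUpperRegular σ (n - 1) C) (hΩ : MeasurableSet Ω) :
    ∃ A : ℝ≥0, ∀ ψ : Euc n → ℝ, ContDiff ℝ 1 ψ →
      ∫⁻ x in P, ∫⁻ s in Set.Ioo 0 T, (ENNReal.ofReal s ^ 2)⁻¹ * coneOsc ν c ψ x s ∂volume ∂σ ≤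
        A * ∫⁻ z in Ω, ‖fderiv ℝ ψ z‖ₑ ^ 2 := by
  obtain ⟨A, hA⟩ := h.exists_lintegral_cones_le hσ hΩ
  refine ⟨16 * A, fun ψ hψ ↦ ?_⟩
  have : Continuous (fderiv ℝ ψ) := hψ.continuous_fderiv one_ne_zero
  refine (lintegral_mono fun x ↦ lintegral_coneOsc_le h.norm_eq_one h.le_one hψ x).trans ?_
  rw [lintegral_const_mul' _ _ (by norm_num), ENNReal.coe_mul, ENNReal.coe_ofNat, mul_assoc]
  gcongr
  exact hA (fun z ↦ ‖fderiv ℝ ψ z‖ₑ ^ 2) (Continuous.measurable (by fun_prop))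

end ConeOscillation

section ConePatch

variable {Ω P : Set (Euc n)} {ν : Euc n} {c T : ℝ} {σ : Measure (Euc n)} {C : ℝ≥0} {ψ : Euc n → ℝ}

/-- The weight `s ^ (-(n + 1))` on the heights `s` at which the cones with vertices `x` and `y`
overlap substantially. -/
def levelKernel (c : ℝ) (x y : Euc n) (s : ℝ) : ENNReal :=
  {s : ℝ | dist x y ≤ c / 2 * s}.indicator (fun s ↦ (ENNReal.ofReal s ^ (n + 1))⁻¹) s

lemma levelKernel_of_le {x y : Euc n} {s : ℝ} (h : dist x y ≤ c / 2 * s) :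
    levelKernel c x y s = (ENNReal.ofReal s ^ (n + 1))⁻¹ :=
  Set.indicator_of_mem (s := {s | dist x y ≤ c / 2 * s}) h _

lemma levelKernel_of_not_le {x y : Euc n} {s : ℝ} (h : ¬ dist x y ≤ c / 2 * s) :
    levelKernel c x y s = 0 :=
  Set.indicator_of_notMem (s := {s | dist x y ≤ c / 2 * s}) h _

lemma levelKernel_comm (c : ℝ) (x y : Euc n) (s : ℝ) :
    levelKernel c x y s = levelKernel c y x s := by
  rw [levelKernel, levelKernel, dist_comm]

lemma measurable_levelKernel (c : ℝ) :
    Measurable fun p : Euc n × Euc n × ℝ ↦ levelKernel c p.1 p.2.1 p.2.2 := by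
  have hset : MeasurableSet {p : Euc n × Euc n × ℝ | dist p.1 p.2.1 ≤ c / 2 * p.2.2} :=
    (isClosed_le (by fun_prop) (by fun_prop)).measurableSet
  exact (show Measurable fun p : Euc n × Euc n × ℝ ↦ (ENNReal.ofReal p.2.2 ^ (n + 1))⁻¹ by
    fun_prop).indicator hset

lemma levelKernel_le_indicator (hc1 : c ≤ 1) (x y : Euc n) {s : ℝ} (hs : 0 < s) :
    levelKernel c x y s ≤
      (Metric.closedBall x s).indicator (fun _ ↦ (ENNReal.ofReal s ^ (n + 1))⁻¹) y := by
  by_cases hxy : dist x y ≤ c / 2 * s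
  · have hy : y ∈ Metric.closedBall x s := by
      rw [Metric.mem_closedBall, dist_comm]
      exact hxy.trans (mul_le_of_le_one_left hs.le (by linarith))
    rw [levelKernel_of_le hxy, Set.indicator_of_mem hy]
  · rw [levelKernel_of_not_le hxy]
    exact zero_le

lemma lintegral_levelKernel_le (hn : 1 ≤ n) (hσ : IsUpperRegular σ (n - 1) C) (hc1 : c ≤ 1)
    (x : Euc n) {s : ℝ} (hs : 0 < s) :
    ∫⁻ y, levelKernel c x y s ∂σ ≤ C * (ENNReal.ofReal s ^ 2)⁻¹ := by
  have hpow : (ENNReal.ofReal s ^ (n + 1))⁻¹ * ENNReal.ofReal s ^ (n - 1) =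
      (ENNReal.ofReal s ^ 2)⁻¹ := by
    have hs0 : ENNReal.ofReal s ^ (n - 1) ≠ 0 := pow_ne_zero _ (ENNReal.ofReal_pos.2 hs).ne'
    rw [show n + 1 = 2 + (n - 1) by omega, pow_add,
      ENNReal.mul_inv (Or.inr (by finiteness)) (Or.inr hs0), mul_assoc,
      ENNReal.inv_mul_cancel hs0 (by finiteness), mul_one]
  calc ∫⁻ y, levelKernel c x y s ∂σ
      ≤ ∫⁻ y, (Metric.closedBall x s).indicator (fun _ ↦ (ENNReal.ofReal s ^ (n + 1))⁻¹) y ∂σ :=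
        lintegral_mono fun y ↦ levelKernel_le_indicator hc1 x y hs
    _ = (ENNReal.ofReal s ^ (n + 1))⁻¹ * σ (Metric.closedBall x s) :=
        lintegral_indicator_const Metric.isClosed_closedBall.measurableSet _
    _ ≤ (ENNReal.ofReal s ^ (n + 1))⁻¹ * (C * ENNReal.ofReal s ^ (n - 1)) := by
        gcongr
        exact hσ x s hs.le
    _ = C * (ENNReal.ofReal s ^ 2)⁻¹ := by rw [mul_left_comm, hpow]

lemma inv_edist_pow_le_lintegral_levelKernel (hc : 0 < c) {x y : Euc n} (hne : x ≠ y)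
    (hxy : dist x y < c * T / 4) :
    (edist x y ^ n)⁻¹ ≤ ENNReal.ofReal (2 ^ (n + 1) * (2 / c) ^ n) *
      ∫⁻ s in Set.Ioo 0 T, levelKernel c x y s := by
  have hpos : 0 < dist x y := dist_pos.2 hne
  set a := 2 / c * dist x y with ha
  have ha0 : 0 < a := by positivity
  have hc_a : c / 2 * a = dist x y := by
    rw [ha]
    field_simp
  have haT : 2 * a ≤ T := le_of_mul_le_mul_left (by linarith) hc
  have hconst : (edist x y ^ n)⁻¹ = ENNReal.ofReal (2 ^ (n + 1) * (2 / c) ^ n) *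
      ((ENNReal.ofReal (2 * a) ^ (n + 1))⁻¹ * ENNReal.ofReal a) := by
    rw [edist_dist, ← ENNReal.ofReal_pow dist_nonneg, ← ENNReal.ofReal_pow (by positivity),
      ← ENNReal.ofReal_inv_of_pos (by positivity), ← ENNReal.ofReal_inv_of_pos (by positivity),
      ← ENNReal.ofReal_mul (by positivity), ← ENNReal.ofReal_mul (by positivity), ha]
    have h2c : 2 / c ≠ 0 := by positivity
    generalize 2 / c = M at h2c
    congr 1
    field_simp
    ring
  calc (edist x y ^ n)⁻¹
      = ENNReal.ofReal (2 ^ (n + 1) * (2 / c) ^ n) *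
          ∫⁻ _ in Set.Ioo a (2 * a), (ENNReal.ofReal (2 * a) ^ (n + 1))⁻¹ := by
        rw [hconst, setLIntegral_const, Real.volume_Ioo, two_mul, add_sub_cancel_right]
    _ ≤ ENNReal.ofReal (2 ^ (n + 1) * (2 / c) ^ n) *
          ∫⁻ s in Set.Ioo a (2 * a), levelKernel c x y s := by
        refine mul_le_mul_right (setLIntegral_mono' measurableSet_Ioo fun s hs ↦ ?_) _
        have hs_le : dist x y ≤ c / 2 * s := hc_a.symm.trans_le (by gcongr; exact hs.1.le)
        rw [levelKernel_of_le hs_le]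
        gcongr
        exact hs.2.le
    _ ≤ _ := by gcongr

/-- The oscillation of `ψ` on the cone with vertex `x`, weighted over the heights relevant for the
comparison of `ψ x` and `ψ y`. -/
def levelOsc (ν : Euc n) (c T : ℝ) (ψ : Euc n → ℝ) (x y : Euc n) : ENNReal :=
  ∫⁻ s in Set.Ioo 0 T, levelKernel c x y s * coneOsc ν c ψ x s

lemma measurable_levelKernel_mul_coneOsc (hψ : Continuous ψ) :
    Measurable fun p : (Euc n × Euc n) × ℝ ↦
      levelKernel c p.1.1 p.1.2 p.2 * coneOsc ν c ψ p.1.1 p.2 :=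
  ((measurable_levelKernel c).comp
    (f := fun p : (Euc n × Euc n) × ℝ ↦ (p.1.1, p.1.2, p.2)) (by fun_prop)).mul
  ((measurable_coneOsc hψ).comp
    (f := fun p : (Euc n × Euc n) × ℝ ↦ (p.1.1, p.2)) (by fun_prop))

lemma measurable_levelOsc (hψ : Continuous ψ) :
    Measurable fun p : Euc n × Euc n ↦ levelOsc ν c T ψ p.1 p.2 :=
  (measurable_levelKernel_mul_coneOsc hψ).lintegral_prod_right'

lemma volume_mul_enorm_sub_sq_div_le (hc : 0 < c) (hψ : Continuous ψ) {x y : Euc n}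
    (hxy : dist x y < c * T / 4) :
    volume (Metric.ball (0 : Euc n) (c / 2)) * (‖ψ x - ψ y‖ₑ ^ 2 / edist x y ^ n) ≤
      ENNReal.ofReal (2 ^ (n + 1) * (2 / c) ^ n) *
        (2 * (levelOsc ν c T ψ x y + levelOsc ν c T ψ y x)) := by
  rcases eq_or_ne x y with rfl | hne
  · simp
  set V := volume (Metric.ball (0 : Euc n) (c / 2))
  have hV : V ≠ ⊤ := measure_ball_lt_top.ne
  have hcompare (s : ℝ) (hs : s ∈ Set.Ioo 0 T) : levelKernel c x y s * (V * ‖ψ x - ψ y‖ₑ ^ 2) ≤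
      2 * (levelKernel c x y s * coneOsc ν c ψ x s +
        levelKernel c y x s * coneOsc ν c ψ y s) := by
    rw [levelKernel_comm c y x, ← mul_add, mul_left_comm 2]
    by_cases hs' : dist x y ≤ c / 2 * s
    · exact mul_le_mul_right (volume_mul_enorm_sub_sq_le hψ hc.le hs.1 hs') _
    · simp only [levelKernel_of_not_le hs', zero_mul, le_refl]
  have hm : Measurable fun s ↦ levelKernel c x y s * coneOsc ν c ψ x s :=
    (measurable_levelKernel_mul_coneOsc hψ).comp (f := fun s : ℝ ↦ ((x, y), s)) (by fun_prop)
  calc V * (‖ψ x - ψ y‖ₑ ^ 2 / edist x y ^ n)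
      = (edist x y ^ n)⁻¹ * (V * ‖ψ x - ψ y‖ₑ ^ 2) := by
        rw [div_eq_mul_inv]
        ring
    _ ≤ (ENNReal.ofReal (2 ^ (n + 1) * (2 / c) ^ n) * ∫⁻ s in Set.Ioo 0 T, levelKernel c x y s) *
          (V * ‖ψ x - ψ y‖ₑ ^ 2) := by
        gcongr
        exact inv_edist_pow_le_lintegral_levelKernel hc hne hxy
    _ = ENNReal.ofReal (2 ^ (n + 1) * (2 / c) ^ n) *
          ∫⁻ s in Set.Ioo 0 T, levelKernel c x y s * (V * ‖ψ x - ψ y‖ₑ ^ 2) := by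
        rw [lintegral_mul_const' _ _ (by finiteness), mul_assoc]
    _ ≤ ENNReal.ofReal (2 ^ (n + 1) * (2 / c) ^ n) *
          ∫⁻ s in Set.Ioo 0 T, 2 * (levelKernel c x y s * coneOsc ν c ψ x s +
            levelKernel c y x s * coneOsc ν c ψ y s) :=
        mul_le_mul_right (setLIntegral_mono' measurableSet_Ioo hcompare) _
    _ = _ := by
        rw [lintegral_const_mul' _ _ (by norm_num), lintegral_add_left hm, levelOsc, levelOsc]

lemma exists_enorm_sub_sq_div_le_levelOsc (hc : 0 < c) (ν : Euc n) (T : ℝ) :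
    ∃ B : ℝ≥0, ∀ ψ : Euc n → ℝ, Continuous ψ → ∀ x y : Euc n, dist x y < c * T / 4 →
      ‖ψ x - ψ y‖ₑ ^ 2 / edist x y ^ n ≤
        B * (levelOsc ν c T ψ x y + levelOsc ν c T ψ y x) := by
  have hV0 : volume (Metric.ball (0 : Euc n) (c / 2)) ≠ 0 :=
    (Metric.measure_ball_pos _ _ (half_pos hc)).ne'
  refine ⟨(volume (Metric.ball (0 : Euc n) (c / 2)))⁻¹.toNNReal *
    ((2 ^ (n + 1) * (2 / c) ^ n).toNNReal * 2), fun ψ hψ x y hxy ↦ ?_⟩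
  rw [ENNReal.coe_mul, ENNReal.coe_toNNReal (ENNReal.inv_ne_top.2 hV0), mul_assoc,
    ← ENNReal.mul_le_iff_le_inv hV0 measure_ball_lt_top.ne, ENNReal.coe_mul, mul_assoc]
  exact volume_mul_enorm_sub_sq_div_le hc hψ hxy

lemma lintegral_levelOsc_le [SFinite σ] (hn : 1 ≤ n) (hσ : IsUpperRegular σ (n - 1) C)
    (hc1 : c ≤ 1) (hψ : Continuous ψ) :
    ∫⁻ x in P, ∫⁻ y in P, levelOsc ν c T ψ x y ∂σ ∂σ ≤
      C * ∫⁻ x in P, ∫⁻ s in Set.Ioo 0 T, (ENNReal.ofReal s ^ 2)⁻¹ * coneOsc ν c ψ x s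
        ∂volume ∂σ := by
  rw [← lintegral_const_mul' _ _ ENNReal.coe_ne_top]
  refine lintegral_mono fun x ↦ ?_
  have hx : Measurable fun q : Euc n × ℝ ↦ levelKernel c x q.1 q.2 * coneOsc ν c ψ x q.2 :=
    (measurable_levelKernel_mul_coneOsc hψ).comp (f := fun q : Euc n × ℝ ↦ ((x, q.1), q.2))
      (by fun_prop)
  have hkx (s : ℝ) : Measurable fun y ↦ levelKernel c x y s :=
    (measurable_levelKernel c).comp (f := fun y : Euc n ↦ (x, y, s)) (by fun_prop)
  calc ∫⁻ y in P, levelOsc ν c T ψ x y ∂σ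
      = ∫⁻ s in Set.Ioo 0 T, (∫⁻ y in P, levelKernel c x y s ∂σ) * coneOsc ν c ψ x s := by
        simp only [levelOsc]
        rw [lintegral_lintegral_swap hx.aemeasurable]
        simp only [lintegral_mul_const _ (hkx _)]
    _ ≤ ∫⁻ s in Set.Ioo 0 T, C * ((ENNReal.ofReal s ^ 2)⁻¹ * coneOsc ν c ψ x s) := by
        refine setLIntegral_mono' measurableSet_Ioo fun s hs ↦ ?_
        rw [← mul_assoc]
        gcongr
        exact (setLIntegral_le_lintegral _ _).trans (lintegral_levelKernel_le hn hσ hc1 x hs.1)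
    _ = _ := lintegral_const_mul' _ _ ENNReal.coe_ne_top

lemma IsConePatch.exists_lintegral_enorm_sub_sq_div_le [SFinite σ] (h : IsConePatch Ω P ν c T)
    (hσ : IsUpperRegular σ (n - 1) C) (hΩ : MeasurableSet Ω) :
    ∃ A : ℝ≥0, ∀ ψ : Euc n → ℝ, ContDiff ℝ 1 ψ →
      ∫⁻ x in P, ∫⁻ y in P ∩ Metric.ball x (c * T / 4), ‖ψ x - ψ y‖ₑ ^ 2 / edist x y ^ n ∂σ ∂σ ≤
        A * ∫⁻ z in Ω, ‖fderiv ℝ ψ z‖ₑ ^ 2 := by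
  obtain ⟨A, hA⟩ := h.exists_lintegral_coneOsc_le hσ hΩ
  obtain ⟨B, hB⟩ := exists_enorm_sub_sq_div_le_levelOsc h.pos ν T
  refine ⟨B * (2 * (C * A)), fun ψ hψ ↦ ?_⟩
  have hI := measurable_levelOsc (ν := ν) (c := c) (T := T) hψ.continuous
  have hIx (x : Euc n) : Measurable (levelOsc ν c T ψ x) :=
    Measurable.of_uncurry_left hI
  have hswap : ∫⁻ x in P, ∫⁻ y in P, levelOsc ν c T ψ y x ∂σ ∂σ =
      ∫⁻ x in P, ∫⁻ y in P, levelOsc ν c T ψ x y ∂σ ∂σ :=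
    lintegral_lintegral_swap (hI.comp measurable_swap).aemeasurable
  have hbound : ∫⁻ x in P, ∫⁻ y in P, levelOsc ν c T ψ x y ∂σ ∂σ ≤
      C * (A * ∫⁻ z in Ω, ‖fderiv ℝ ψ z‖ₑ ^ 2) :=
    (lintegral_levelOsc_le (one_le_of_norm_eq_one h.norm_eq_one) hσ h.le_one hψ.continuous).trans
      (by gcongr; exact hA ψ hψ)
  calc ∫⁻ x in P, ∫⁻ y in P ∩ Metric.ball x (c * T / 4), ‖ψ x - ψ y‖ₑ ^ 2 / edist x y ^ n ∂σ ∂σ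
      ≤ ∫⁻ x in P, ∫⁻ y in P, B * (levelOsc ν c T ψ x y + levelOsc ν c T ψ y x) ∂σ ∂σ := by
        refine lintegral_mono fun x ↦ (setLIntegral_mono'
          (h.measurableSet.inter Metric.isOpen_ball.measurableSet) fun y hy ↦ ?_).trans
          (lintegral_mono_set Set.inter_subset_left)
        exact hB ψ hψ.continuous x y (Metric.mem_ball'.1 hy.2)
    _ = B * (∫⁻ x in P, ∫⁻ y in P, levelOsc ν c T ψ x y ∂σ ∂σ +
          ∫⁻ x in P, ∫⁻ y in P, levelOsc ν c T ψ x y ∂σ ∂σ) := by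
        simp only [lintegral_const_mul' _ _ ENNReal.coe_ne_top, lintegral_add_left (hIx _)]
        rw [lintegral_add_left (Measurable.lintegral_prod_right' hI), hswap]
    _ ≤ B * (C * (A * ∫⁻ z in Ω, ‖fderiv ℝ ψ z‖ₑ ^ 2) +
          C * (A * ∫⁻ z in Ω, ‖fderiv ℝ ψ z‖ₑ ^ 2)) := by gcongr
    _ = _ := by
        push_cast
        ring

lemma volume_mul_enorm_sq_le (hψ : Continuous ψ) (x : Euc n) {s : ℝ} (hs : s ∈ Set.Ioo 0 T) :
    volume (Metric.ball (0 : Euc n) c) * ‖ψ x‖ₑ ^ 2 ≤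
      2 * (ENNReal.ofReal T ^ 2 * ((ENNReal.ofReal s ^ 2)⁻¹ * coneOsc ν c ψ x s) +
        ∫⁻ w in Metric.ball 0 c, ‖ψ (x + s • (ν + w))‖ₑ ^ 2) := by
  have hsT : (1 : ENNReal) ≤ ENNReal.ofReal T ^ 2 * (ENNReal.ofReal s ^ 2)⁻¹ := by
    rw [← div_eq_mul_inv, ENNReal.le_div_iff_mul_le
      (Or.inl (pow_ne_zero _ (ENNReal.ofReal_pos.2 hs.1).ne')) (Or.inl (by finiteness)), one_mul]
    gcongr
    exact hs.2.le
  calc volume (Metric.ball (0 : Euc n) c) * ‖ψ x‖ₑ ^ 2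
      = ∫⁻ w in Metric.ball (0 : Euc n) c, ‖ψ x‖ₑ ^ 2 := by rw [setLIntegral_const, mul_comm]
    _ ≤ ∫⁻ w in Metric.ball (0 : Euc n) c, 2 * (‖ψ x - ψ (x + s • (ν + w))‖ₑ ^ 2 +
          ‖ψ (x + s • (ν + w))‖ₑ ^ 2) := by
        refine lintegral_mono fun w ↦ ?_
        simpa only [sub_zero, zero_sub, enorm_neg] using
          enorm_sub_sq_le (ψ x) 0 (ψ (x + s • (ν + w)))
    _ = 2 * (coneOsc ν c ψ x s + ∫⁻ w in Metric.ball 0 c, ‖ψ (x + s • (ν + w))‖ₑ ^ 2) := by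
        rw [lintegral_const_mul' _ _ (by norm_num),
          lintegral_add_left (Continuous.measurable (by fun_prop)), coneOsc]
    _ ≤ _ := by
        gcongr
        rw [← mul_assoc]
        exact le_mul_of_one_le_left' hsT

lemma volume_mul_ofReal_mul_enorm_sq_le (hψ : Continuous ψ) (x : Euc n) :
    volume (Metric.ball (0 : Euc n) c) * ENNReal.ofReal T * ‖ψ x‖ₑ ^ 2 ≤
      2 * (ENNReal.ofReal T ^ 2 *
          (∫⁻ s in Set.Ioo 0 T, (ENNReal.ofReal s ^ 2)⁻¹ * coneOsc ν c ψ x s) +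
        ∫⁻ s in Set.Ioo 0 T, ∫⁻ w in Metric.ball 0 c, ‖ψ (x + s • (ν + w))‖ₑ ^ 2) := by
  have hm : Measurable fun s : ℝ ↦ (ENNReal.ofReal s ^ 2)⁻¹ * coneOsc ν c ψ x s :=
    Measurable.mul (by fun_prop) ((measurable_coneOsc hψ).comp measurable_prodMk_left)
  calc volume (Metric.ball (0 : Euc n) c) * ENNReal.ofReal T * ‖ψ x‖ₑ ^ 2
      = ∫⁻ _ in Set.Ioo 0 T, volume (Metric.ball (0 : Euc n) c) * ‖ψ x‖ₑ ^ 2 := by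
        rw [setLIntegral_const, Real.volume_Ioo, sub_zero, mul_right_comm]
    _ ≤ _ := setLIntegral_mono' measurableSet_Ioo fun s hs ↦
        volume_mul_enorm_sq_le (ν := ν) hψ x hs
    _ = _ := by
        rw [lintegral_const_mul' _ _ (by norm_num), lintegral_add_left (hm.const_mul _),
          lintegral_const_mul _ hm]

lemma IsConePatch.exists_lintegral_enorm_sq_le [SFinite σ] (h : IsConePatch Ω P ν c T)
    (hT : 0 < T) (hσ : IsUpperRegular σ (n - 1) C) (hΩ : MeasurableSet Ω) :
    ∃ A : ℝ≥0, ∀ ψ : Euc n → ℝ, ContDiff ℝ 1 ψ →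
      ∫⁻ x in P, ‖ψ x‖ₑ ^ 2 ∂σ ≤
        A * ((∫⁻ z in Ω, ‖ψ z‖ₑ ^ 2) + ∫⁻ z in Ω, ‖fderiv ℝ ψ z‖ₑ ^ 2) := by
  obtain ⟨A, hA⟩ := h.exists_lintegral_coneOsc_le hσ hΩ
  obtain ⟨B, hB⟩ := h.exists_lintegral_cones_le hσ hΩ
  set κ := volume (Metric.ball (0 : Euc n) c) * ENNReal.ofReal T
  have hκ0 : κ ≠ 0 :=
    mul_ne_zero (Metric.measure_ball_pos _ _ h.pos).ne' (ENNReal.ofReal_pos.2 hT).ne'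
  have hκt : κ ≠ ⊤ := ENNReal.mul_ne_top measure_ball_lt_top.ne ENNReal.ofReal_ne_top
  refine ⟨κ⁻¹.toNNReal * (2 * (T.toNNReal ^ 2 * A + B)), fun ψ hψ ↦ ?_⟩
  have hψc := hψ.continuous
  have hmψ : Measurable fun z ↦ ‖ψ z‖ₑ ^ 2 := Continuous.measurable (by fun_prop)
  have hm : Measurable fun x ↦ ∫⁻ s in Set.Ioo 0 T, (ENNReal.ofReal s ^ 2)⁻¹ * coneOsc ν c ψ x s :=
    Measurable.lintegral_prod_right'
      (f := fun q : Euc n × ℝ ↦ (ENNReal.ofReal q.2 ^ 2)⁻¹ * coneOsc ν c ψ q.1 q.2)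
      (Measurable.mul (by fun_prop) (measurable_coneOsc hψc))
  rw [ENNReal.coe_mul, ENNReal.coe_toNNReal (ENNReal.inv_ne_top.2 hκ0), mul_assoc,
    ← ENNReal.mul_le_iff_le_inv hκ0 hκt]
  calc κ * ∫⁻ x in P, ‖ψ x‖ₑ ^ 2 ∂σ
      ≤ ∫⁻ x in P, 2 * (ENNReal.ofReal T ^ 2 *
            (∫⁻ s in Set.Ioo 0 T, (ENNReal.ofReal s ^ 2)⁻¹ * coneOsc ν c ψ x s) +
          ∫⁻ s in Set.Ioo 0 T, ∫⁻ w in Metric.ball 0 c, ‖ψ (x + s • (ν + w))‖ₑ ^ 2) ∂σ := by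
        rw [← lintegral_const_mul _ hmψ]
        exact lintegral_mono fun x ↦ volume_mul_ofReal_mul_enorm_sq_le hψc x
    _ ≤ 2 * (ENNReal.ofReal T ^ 2 * (A * ∫⁻ z in Ω, ‖fderiv ℝ ψ z‖ₑ ^ 2) +
          B * ∫⁻ z in Ω, ‖ψ z‖ₑ ^ 2) := by
        rw [lintegral_const_mul' _ _ (by norm_num), lintegral_add_left (hm.const_mul _),
          lintegral_const_mul _ hm]
        gcongr
        · exact hA ψ hψ
        · exact hB _ hmψ
    _ ≤ 2 * (ENNReal.ofReal T ^ 2 * A + B) *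
          ((∫⁻ z in Ω, ‖ψ z‖ₑ ^ 2) + ∫⁻ z in Ω, ‖fderiv ℝ ψ z‖ₑ ^ 2) := by
        rw [mul_assoc, add_mul, ← mul_assoc (_ ^ 2)]
        gcongr
        · exact le_add_self
        · exact le_self_add
    _ = _ := by
        push_cast
        rfl

end ConePatch

section TraceInequality

variable {Ω : Set (Euc n)}

/-- The square of the Gagliardo seminorm of smoothness `1/2` on an `(n - 1)`-dimensional set with
surface measure `σ`. -/
def gagliardoEnergy (σ : Measure (Euc n)) (f : Euc n → ℝ) : ENNReal :=
  ∫⁻ x, ∫⁻ y, ‖f x - f y‖ₑ ^ 2 / edist x y ^ n ∂σ ∂σ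

/-- The square of the norm in `H¹(Ω)` of a smooth function. -/
def sobolevEnergy (Ω : Set (Euc n)) (ψ : Euc n → ℝ) : ENNReal :=
  (∫⁻ x in Ω, ‖ψ x‖ₑ ^ 2) + ∫⁻ x in Ω, ‖fderiv ℝ ψ x‖ₑ ^ 2

lemma measurable_enorm_sub_sq_div_edist_pow {f : Euc n → ℝ} (hf : Continuous f) :
    Measurable fun p : Euc n × Euc n ↦ ‖f p.1 - f p.2‖ₑ ^ 2 / edist p.1 p.2 ^ n :=
  Measurable.div (Continuous.measurable (by fun_prop)) (Continuous.measurable (by fun_prop))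

lemma lintegral_compl_ball_enorm_sub_sq_div_le {X : Type*} [PseudoMetricSpace X]
    [MeasurableSpace X] [OpensMeasurableSpace X] (σ : Measure X) {f : X → ℝ} (hf : Measurable f)
    (r : ℝ) (d : ℕ) :
    ∫⁻ x, ∫⁻ y in (Metric.ball x r)ᶜ, ‖f x - f y‖ₑ ^ 2 / edist x y ^ d ∂σ ∂σ ≤
      (ENNReal.ofReal r ^ d)⁻¹ * (4 * (σ Set.univ * ∫⁻ x, ‖f x‖ₑ ^ 2 ∂σ)) := by
  have hm : Measurable fun x ↦ ‖f x‖ₑ ^ 2 := by fun_prop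
  have hpointwise (x y : X) (hy : y ∈ (Metric.ball x r)ᶜ) : ‖f x - f y‖ₑ ^ 2 / edist x y ^ d ≤
      (ENNReal.ofReal r ^ d)⁻¹ * (2 * (‖f x‖ₑ ^ 2 + ‖f y‖ₑ ^ 2)) := by
    rw [div_eq_mul_inv, mul_comm]
    gcongr
    · rw [edist_comm, edist_dist]
      exact ENNReal.ofReal_le_ofReal (not_lt.1 hy)
    · simpa only [sub_zero] using enorm_sub_sq_le (f x) (f y) 0
  calc ∫⁻ x, ∫⁻ y in (Metric.ball x r)ᶜ, ‖f x - f y‖ₑ ^ 2 / edist x y ^ d ∂σ ∂σ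
      ≤ ∫⁻ x, ∫⁻ y, (ENNReal.ofReal r ^ d)⁻¹ * (2 * (‖f x‖ₑ ^ 2 + ‖f y‖ₑ ^ 2)) ∂σ ∂σ :=
        lintegral_mono fun x ↦ (setLIntegral_mono' Metric.isOpen_ball.measurableSet.compl
          (hpointwise x)).trans (setLIntegral_le_lintegral _ _)
    _ = (ENNReal.ofReal r ^ d)⁻¹ * (2 * (σ Set.univ * (∫⁻ x, ‖f x‖ₑ ^ 2 ∂σ) +
          σ Set.univ * ∫⁻ x, ‖f x‖ₑ ^ 2 ∂σ)) := by
        have hinner (x : X) :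
            ∫⁻ y, (ENNReal.ofReal r ^ d)⁻¹ * (2 * (‖f x‖ₑ ^ 2 + ‖f y‖ₑ ^ 2)) ∂σ =
              (ENNReal.ofReal r ^ d)⁻¹ *
                (2 * (σ Set.univ * ‖f x‖ₑ ^ 2 + ∫⁻ y, ‖f y‖ₑ ^ 2 ∂σ)) := by
          rw [lintegral_const_mul _ (by fun_prop), lintegral_const_mul _ (by fun_prop),
            lintegral_add_left measurable_const, lintegral_const, mul_comm (σ _)]
        simp only [hinner]
        rw [lintegral_const_mul _ (by fun_prop), lintegral_const_mul _ (by fun_prop),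
          lintegral_add_right _ measurable_const, lintegral_const, lintegral_const_mul _ hm,
          mul_comm (lintegral _ _) (σ _)]
    _ = _ := by ring

lemma surfaceMeasure_restrict_frontier_inter (S : Set (Euc n)) :
    (surfaceMeasure Ω).restrict (frontier Ω ∩ S) = (surfaceMeasure Ω).restrict S :=
  Measure.restrict_congr_set <| (ae_mem_frontier Ω).mono fun _ hx ↦
    propext (and_iff_right hx)

namespace IsBoundedLipschitzOpen

lemma exists_isConePatch (hΩ : IsBoundedLipschitzOpen Ω) {x₀ : Euc n} (hx₀ : x₀ ∈ frontier Ω) :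
    ∃ (ν : Euc n) (c T δ : ℝ), 0 < T ∧ 0 < δ ∧
      IsConePatch Ω (frontier Ω ∩ Metric.ball x₀ δ) ν c T := by
  obtain ⟨ν, c, T, δ, hν, hc, hc1, hT, hδ, hcones⟩ := hΩ.exists_hasCones hx₀
  refine ⟨ν, c, T, δ, hT, hδ, hν, hc, hc1,
    isClosed_frontier.measurableSet.inter Metric.isOpen_ball.measurableSet, ?_,
    hcones.mono (Set.inter_subset_inter_left _ frontier_subset_closure)⟩
  rw [hΩ.isOpen.frontier_eq]
  exact Set.disjoint_left.2 fun x hx ↦ hx.1.2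

lemma exists_lintegral_enorm_sq_le (hΩ : IsBoundedLipschitzOpen Ω) :
    ∃ A : ℝ≥0, ∀ ψ : Euc n → ℝ, ContDiff ℝ 1 ψ →
      ∫⁻ x, ‖ψ x‖ₑ ^ 2 ∂surfaceMeasure Ω ≤ A * sobolevEnergy Ω ψ := by
  obtain ⟨C, hσ⟩ := hΩ.exists_isUpperRegular
  have hfin := hΩ.isFiniteMeasure_surfaceMeasure
  obtain ⟨A, hA⟩ : ∃ A : ℝ≥0, ∀ ψ : Euc n → ℝ, ContDiff ℝ 1 ψ →
      ∫⁻ x in frontier Ω, ‖ψ x‖ₑ ^ 2 ∂surfaceMeasure Ω ≤ A * sobolevEnergy Ω ψ := by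
    refine hΩ.isCompact_frontier.induction_on (p := fun S ↦ ∃ A : ℝ≥0, ∀ ψ : Euc n → ℝ,
      ContDiff ℝ 1 ψ → ∫⁻ x in S, ‖ψ x‖ₑ ^ 2 ∂surfaceMeasure Ω ≤ A * sobolevEnergy Ω ψ)
      ⟨0, by simp⟩ ?_ ?_ fun x₀ hx₀ ↦ ?_
    · rintro S S' hS ⟨A, hA⟩
      exact ⟨A, fun ψ hψ ↦ (lintegral_mono_set hS).trans (hA ψ hψ)⟩
    · rintro S S' ⟨A, hA⟩ ⟨B, hB⟩
      refine ⟨A + B, fun ψ hψ ↦ (lintegral_union_le _ _ _).trans ?_⟩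
      rw [ENNReal.coe_add, add_mul]
      exact add_le_add (hA ψ hψ) (hB ψ hψ)
    · obtain ⟨ν, c, T, δ, hT, hδ, h⟩ := hΩ.exists_isConePatch hx₀
      obtain ⟨A, hA⟩ := h.exists_lintegral_enorm_sq_le hT hσ hΩ.isOpen.measurableSet
      rw [surfaceMeasure_restrict_frontier_inter] at hA
      exact ⟨_, mem_nhdsWithin_of_mem_nhds (Metric.ball_mem_nhds x₀ hδ), A, hA⟩
  rw [Measure.restrict_eq_self_of_ae_mem (ae_mem_frontier Ω)] at hA
  exact ⟨A, hA⟩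

lemma exists_lintegral_ball_near_le (hΩ : IsBoundedLipschitzOpen Ω) {x₀ : Euc n}
    (hx₀ : x₀ ∈ frontier Ω) :
    ∃ (A : ℝ≥0) (r δ : ℝ), 0 < r ∧ 0 < δ ∧ ∀ ψ : Euc n → ℝ, ContDiff ℝ 1 ψ →
      ∫⁻ x in Metric.ball x₀ δ, ∫⁻ y in Metric.ball x r, ‖ψ x - ψ y‖ₑ ^ 2 / edist x y ^ n
        ∂surfaceMeasure Ω ∂surfaceMeasure Ω ≤ A * sobolevEnergy Ω ψ := by
  obtain ⟨C, hσ⟩ := hΩ.exists_isUpperRegular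
  have hfin := hΩ.isFiniteMeasure_surfaceMeasure
  obtain ⟨ν, c, T, δ, hT, hδ, h⟩ := hΩ.exists_isConePatch hx₀
  obtain ⟨A, hA⟩ := h.exists_lintegral_enorm_sub_sq_div_le hσ hΩ.isOpen.measurableSet
  have hr : 0 < min (δ / 2) (c * T / 4) :=
    lt_min (half_pos hδ) (div_pos (mul_pos h.pos hT) four_pos)
  refine ⟨A, _, δ / 2, hr, half_pos hδ, fun ψ hψ ↦ ?_⟩
  simp only [Set.inter_assoc, surfaceMeasure_restrict_frontier_inter] at hA
  calc ∫⁻ x in Metric.ball x₀ (δ / 2), ∫⁻ y in Metric.ball x (min (δ / 2) (c * T / 4)),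
        ‖ψ x - ψ y‖ₑ ^ 2 / edist x y ^ n ∂surfaceMeasure Ω ∂surfaceMeasure Ω
      ≤ ∫⁻ x in Metric.ball x₀ (δ / 2), ∫⁻ y in Metric.ball x₀ δ ∩ Metric.ball x (c * T / 4),
          ‖ψ x - ψ y‖ₑ ^ 2 / edist x y ^ n ∂surfaceMeasure Ω ∂surfaceMeasure Ω := by
        refine setLIntegral_mono' Metric.isOpen_ball.measurableSet fun x hx ↦
          lintegral_mono_set (Set.subset_inter ?_ (Metric.ball_subset_ball (min_le_right _ _)))
        exact (Metric.ball_subset_ball (min_le_left _ _)).trans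
          (Metric.ball_subset (by linarith [Metric.mem_ball.1 hx]))
    _ ≤ ∫⁻ x in Metric.ball x₀ δ, ∫⁻ y in Metric.ball x₀ δ ∩ Metric.ball x (c * T / 4),
          ‖ψ x - ψ y‖ₑ ^ 2 / edist x y ^ n ∂surfaceMeasure Ω ∂surfaceMeasure Ω :=
        lintegral_mono_set (Metric.ball_subset_ball (half_le_self hδ.le))
    _ ≤ A * ∫⁻ x in Ω, ‖fderiv ℝ ψ x‖ₑ ^ 2 := hA ψ hψ
    _ ≤ A * sobolevEnergy Ω ψ := by
        gcongr
        exact le_add_self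

lemma exists_lintegral_near_le (hΩ : IsBoundedLipschitzOpen Ω) :
    ∃ (A : ℝ≥0) (r : ℝ), 0 < r ∧ ∀ ψ : Euc n → ℝ, ContDiff ℝ 1 ψ →
      ∫⁻ x, ∫⁻ y in Metric.ball x r, ‖ψ x - ψ y‖ₑ ^ 2 / edist x y ^ n ∂surfaceMeasure Ω
        ∂surfaceMeasure Ω ≤ A * sobolevEnergy Ω ψ := by
  obtain ⟨A, r, hr, hA⟩ : ∃ (A : ℝ≥0) (r : ℝ), 0 < r ∧ ∀ ψ : Euc n → ℝ, ContDiff ℝ 1 ψ →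
      ∫⁻ x in frontier Ω, ∫⁻ y in Metric.ball x r, ‖ψ x - ψ y‖ₑ ^ 2 / edist x y ^ n
        ∂surfaceMeasure Ω ∂surfaceMeasure Ω ≤ A * sobolevEnergy Ω ψ := by
    refine hΩ.isCompact_frontier.induction_on (p := fun S ↦ ∃ (A : ℝ≥0) (r : ℝ), 0 < r ∧
      ∀ ψ : Euc n → ℝ, ContDiff ℝ 1 ψ → ∫⁻ x in S, ∫⁻ y in Metric.ball x r,
        ‖ψ x - ψ y‖ₑ ^ 2 / edist x y ^ n ∂surfaceMeasure Ω ∂surfaceMeasure Ω ≤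
          A * sobolevEnergy Ω ψ) ⟨0, 1, one_pos, by simp⟩ ?_ ?_ fun x₀ hx₀ ↦ ?_
    · rintro S S' hS ⟨A, r, hr, hA⟩
      exact ⟨A, r, hr, fun ψ hψ ↦ (lintegral_mono_set hS).trans (hA ψ hψ)⟩
    · rintro S S' ⟨A, r, hr, hA⟩ ⟨B, r', hr', hB⟩
      refine ⟨A + B, min r r', lt_min hr hr', fun ψ hψ ↦ (lintegral_union_le _ _ _).trans ?_⟩
      rw [ENNReal.coe_add, add_mul]
      exact add_le_add
        ((lintegral_mono fun x ↦ lintegral_mono_set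
          (Metric.ball_subset_ball (min_le_left _ _))).trans (hA ψ hψ))
        ((lintegral_mono fun x ↦ lintegral_mono_set
          (Metric.ball_subset_ball (min_le_right _ _))).trans (hB ψ hψ))
    · obtain ⟨A, r, δ, hr, hδ, hA⟩ := hΩ.exists_lintegral_ball_near_le hx₀
      exact ⟨_, mem_nhdsWithin_of_mem_nhds (Metric.ball_mem_nhds x₀ hδ), A, r, hr, hA⟩
  rw [Measure.restrict_eq_self_of_ae_mem (ae_mem_frontier Ω)] at hA
  exact ⟨A, r, hr, hA⟩

lemma exists_gagliardoEnergy_le (hΩ : IsBoundedLipschitzOpen Ω) :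
    ∃ A : ℝ≥0, ∀ ψ : Euc n → ℝ, ContDiff ℝ 1 ψ →
      gagliardoEnergy (surfaceMeasure Ω) ψ ≤ A * sobolevEnergy Ω ψ := by
  obtain ⟨A, r, hr, hA⟩ := hΩ.exists_lintegral_near_le
  obtain ⟨B, hB⟩ := hΩ.exists_lintegral_enorm_sq_le
  have hfin := hΩ.isFiniteMeasure_surfaceMeasure
  set σ := surfaceMeasure Ω
  have hrn : (ENNReal.ofReal r ^ n)⁻¹ ≠ ⊤ :=
    ENNReal.inv_ne_top.2 (pow_ne_zero _ (ENNReal.ofReal_pos.2 hr).ne')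
  refine ⟨A + (ENNReal.ofReal r ^ n)⁻¹.toNNReal * (4 * ((σ Set.univ).toNNReal * B)),
    fun ψ hψ ↦ ?_⟩
  have hmeas : Measurable fun x ↦ ∫⁻ y in (Metric.ball x r)ᶜ,
      ‖ψ x - ψ y‖ₑ ^ 2 / edist x y ^ n ∂σ := by
    have hset : MeasurableSet {p : Euc n × Euc n | p.2 ∈ (Metric.ball p.1 r)ᶜ} :=
      (isOpen_lt (by fun_prop) (by fun_prop)).measurableSet.compl
    simp only [← lintegral_indicator Metric.isOpen_ball.measurableSet.compl]
    exact Measurable.lintegral_prod_right'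
      ((measurable_enorm_sub_sq_div_edist_pow hψ.continuous).indicator hset)
  calc gagliardoEnergy σ ψ
      = ∫⁻ x, (∫⁻ y in Metric.ball x r, ‖ψ x - ψ y‖ₑ ^ 2 / edist x y ^ n ∂σ) +
          ∫⁻ y in (Metric.ball x r)ᶜ, ‖ψ x - ψ y‖ₑ ^ 2 / edist x y ^ n ∂σ ∂σ := by
        simp only [gagliardoEnergy, lintegral_add_compl _ Metric.isOpen_ball.measurableSet]
    _ ≤ A * sobolevEnergy Ω ψ + (ENNReal.ofReal r ^ n)⁻¹ *
          (4 * (σ Set.univ * (B * sobolevEnergy Ω ψ))) := by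
        rw [lintegral_add_right _ hmeas]
        gcongr
        · exact hA ψ hψ
        · exact (lintegral_compl_ball_enorm_sub_sq_div_le σ hψ.continuous.measurable r n).trans
            (by gcongr; exact hB ψ hψ)
    _ = _ := by
        push_cast
        rw [ENNReal.coe_toNNReal hrn, ENNReal.coe_toNNReal (measure_ne_top σ _)]
        ring

end IsBoundedLipschitzOpen

lemma eLpNorm_two_sq {α : Type*} [MeasurableSpace α] {μ : Measure α} (f : α → ℝ) :
    eLpNorm f 2 μ ^ 2 = ∫⁻ x, ‖f x‖ₑ ^ 2 ∂μ := by
  simpa using eLpNorm_nnreal_pow_eq_lintegral (μ := μ) (f := f) (p := 2) two_ne_zero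

lemma norm_fderiv_sq_le (ψ : Euc n → ℝ) (x : Euc n) :
    ‖fderiv ℝ ψ x‖ ^ 2 ≤ ∑ i, partialDeriv i ψ x ^ 2 := by
  have hfderiv : fderiv ℝ ψ x = innerSL ℝ (WithLp.toLp 2 fun i ↦ partialDeriv i ψ x) := by
    refine ContinuousLinearMap.coe_injective
      ((EuclideanSpace.basisFun (Fin n) ℝ).toBasis.ext fun i ↦ ?_)
    simp [partialDeriv, EuclideanSpace.inner_single_right]
  rw [hfderiv, innerSL_apply_norm, EuclideanSpace.norm_sq_eq]
  simp

lemma enorm_fderiv_sq_le (ψ : Euc n → ℝ) (x : Euc n) :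
    ‖fderiv ℝ ψ x‖ₑ ^ 2 ≤ ∑ i, ‖partialDeriv i ψ x‖ₑ ^ 2 := by
  simp only [← ofReal_norm, ← ENNReal.ofReal_pow (norm_nonneg _)]
  rw [← ENNReal.ofReal_sum_of_nonneg fun i _ ↦ by positivity]
  exact ENNReal.ofReal_le_ofReal (by simpa using norm_fderiv_sq_le ψ x)

lemma sobolevEnergy_le {ψ : Euc n → ℝ} (hψ : ContDiff ℝ ∞ ψ) :
    sobolevEnergy Ω ψ ≤ eLpNorm ψ 2 (volume.restrict Ω) ^ 2 +
      ∑ i, eLpNorm (partialDeriv i ψ) 2 (volume.restrict Ω) ^ 2 := by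
  have hc (i : Fin n) : Continuous (partialDeriv i ψ) := (contDiff_partialDeriv hψ i).continuous
  simp only [eLpNorm_two_sq]
  rw [sobolevEnergy, ← lintegral_finsetSum _ fun i _ ↦ by have := hc i; fun_prop]
  gcongr
  exact enorm_fderiv_sq_le ψ _

lemma ofReal_h1Norm_sq (u : L2 Ω) :
    ENNReal.ofReal (h1Norm Ω u ^ 2) = ‖u‖ₑ ^ 2 + ∑ i, ‖weakPartial Ω i u‖ₑ ^ 2 := by
  rw [h1Norm, Real.sq_sqrt (by positivity), ENNReal.ofReal_add (by positivity) (by positivity),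
    ENNReal.ofReal_sum_of_nonneg fun i _ ↦ by positivity]
  simp only [ENNReal.ofReal_pow (norm_nonneg _), ofReal_norm]

lemma eLpNorm_le_add_enorm {α : Type*} [MeasurableSpace α] {μ : Measure α} {a : α → ℝ}
    (ha : AEStronglyMeasurable a μ) (v : Lp ℝ 2 μ) :
    eLpNorm a 2 μ ≤ eLpNorm (fun x ↦ a x - v x) 2 μ + ‖v‖ₑ := by
  rw [Lp.enorm_def]
  have hadd := eLpNorm_add_le (ha.sub (Lp.aestronglyMeasurable v)) (Lp.aestronglyMeasurable v)
    one_le_two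
  rwa [sub_add_cancel] at hadd

lemma TendstoInH1.liminf_le {ψ : ℕ → Euc n → ℝ} {u : L2 Ω} (h : TendstoInH1 Ω ψ u)
    (hψ : ∀ k, ContDiff ℝ ∞ (ψ k)) {A : ℝ≥0} {F : ℕ → ENNReal}
    (hF : ∀ k, F k ≤ A * sobolevEnergy Ω (ψ k)) :
    liminf F atTop ≤ A * ENNReal.ofReal (h1Norm Ω u ^ 2) := by
  have hbound (k : ℕ) : F k ≤ A *
      ((eLpNorm (fun x ↦ ψ k x - u x) 2 (volume.restrict Ω) + ‖u‖ₑ) ^ 2 +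
        ∑ i, (eLpNorm (fun x ↦ partialDeriv i (ψ k) x - weakPartial Ω i u x) 2
          (volume.restrict Ω) + ‖weakPartial Ω i u‖ₑ) ^ 2) := by
    refine ((hF k).trans (mul_le_mul_right (sobolevEnergy_le (hψ k)) _)).trans ?_
    gcongr with i
    · exact eLpNorm_le_add_enorm (hψ k).continuous.aestronglyMeasurable u
    · exact eLpNorm_le_add_enorm (contDiff_partialDeriv (hψ k) i).continuous.aestronglyMeasurable _
  have hsq {e : ℕ → ENNReal} (he : Tendsto e atTop (𝓝 0)) (b : ENNReal) :
      Tendsto (fun k ↦ (e k + b) ^ 2) atTop (𝓝 (b ^ 2)) := by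
    simpa only [zero_add] using ENNReal.Tendsto.pow (n := 2) (he.add_const b)
  have hlim := ENNReal.Tendsto.const_mul (a := (A : ENNReal))
    ((hsq h.1 ‖u‖ₑ).add (tendsto_finsetSum Finset.univ fun i _ ↦
      hsq (h.2 i) ‖weakPartial Ω i u‖ₑ)) (Or.inr ENNReal.coe_ne_top)
  rw [ofReal_h1Norm_sq, ← hlim.liminf_eq]
  exact liminf_le_liminf (Eventually.of_forall hbound)

lemma gagliardoEnergy_le_liminf {σ : Measure (Euc n)} [SFinite σ] {ψ : ℕ → Euc n → ℝ}
    {g : Euc n → ℝ} (hψ : ∀ k, Continuous (ψ k))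
    (hae : ∀ᵐ x ∂σ, Tendsto (fun k ↦ ψ k x) atTop (𝓝 (g x))) :
    gagliardoEnergy σ g ≤ liminf (fun k ↦ gagliardoEnergy σ (ψ k)) atTop := by
  have hm (k : ℕ) := measurable_enorm_sub_sq_div_edist_pow (hψ k)
  have hlim : ∀ᵐ x ∂σ, ∀ᵐ y ∂σ, ‖g x - g y‖ₑ ^ 2 / edist x y ^ n ≤
      liminf (fun k ↦ ‖ψ k x - ψ k y‖ₑ ^ 2 / edist x y ^ n) atTop := by
    filter_upwards [hae] with x hx
    filter_upwards [hae] with y hy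
    rcases eq_or_ne x y with rfl | hne
    · simp
    · refine (Tendsto.liminf_eq ?_).ge
      exact ENNReal.Tendsto.div_const (ENNReal.Tendsto.pow (hx.sub hy).enorm)
        (Or.inr (pow_ne_zero _ (edist_pos.2 hne).ne'))
  calc gagliardoEnergy σ g
      ≤ ∫⁻ x, liminf (fun k ↦ ∫⁻ y, ‖ψ k x - ψ k y‖ₑ ^ 2 / edist x y ^ n ∂σ) atTop ∂σ :=
        lintegral_mono_ae <| hlim.mono fun x hx ↦ (lintegral_mono_ae hx).trans <|
          lintegral_liminf_le fun k ↦ by have := (hψ k).measurable; fun_prop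
    _ ≤ liminf (fun k ↦ gagliardoEnergy σ (ψ k)) atTop :=
        lintegral_liminf_le fun k ↦ Measurable.lintegral_prod_right' (hm k)

lemma lintegral_enorm_sq_le_liminf {α : Type*} [MeasurableSpace α] {σ : Measure α}
    {ψ : ℕ → α → ℝ} {g : α → ℝ} (hψ : ∀ k, Measurable (ψ k))
    (hae : ∀ᵐ x ∂σ, Tendsto (fun k ↦ ψ k x) atTop (𝓝 (g x))) :
    ∫⁻ x, ‖g x‖ₑ ^ 2 ∂σ ≤ liminf (fun k ↦ ∫⁻ x, ‖ψ k x‖ₑ ^ 2 ∂σ) atTop :=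
  (lintegral_mono_ae (hae.mono fun _ hx ↦ (ENNReal.Tendsto.pow hx.enorm).liminf_eq.ge)).trans
    (lintegral_liminf_le fun k ↦ by have := hψ k; fun_prop)

lemma IsTrace.exists_seq_tendsto_ae {u : L2 Ω} {g : L2Boundary Ω} (hg : IsTrace Ω u g) :
    ∃ ψ : ℕ → Euc n → ℝ, (∀ k, ContDiff ℝ ∞ (ψ k)) ∧ TendstoInH1 Ω ψ u ∧
      ∀ᵐ x ∂surfaceMeasure Ω, Tendsto (fun k ↦ ψ k x) atTop (𝓝 (g x)) := by
  obtain ⟨-, ψ, hψ, ⟨hL2, hpartial⟩, hboundary⟩ := hg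
  have hmeasure : TendstoInMeasure (surfaceMeasure Ω) ψ atTop g :=
    tendstoInMeasure_of_tendsto_eLpNorm (p := 2) two_ne_zero
      (fun k ↦ (hψ k).continuous.aestronglyMeasurable) (Lp.aestronglyMeasurable g) hboundary
  obtain ⟨ns, hns, hae⟩ := hmeasure.exists_seq_tendsto_ae
  exact ⟨fun j ↦ ψ (ns j), fun j ↦ hψ _, ⟨hL2.comp hns.tendsto_atTop,
    fun i ↦ (hpartial i).comp hns.tendsto_atTop⟩, hae⟩

namespace IsBoundedLipschitzOpen

lemma exists_enorm_sq_le_of_isTrace (hΩ : IsBoundedLipschitzOpen Ω) :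
    ∃ A : ℝ≥0, ∀ (u : L2 Ω) (g : L2Boundary Ω), IsTrace Ω u g →
      ‖g‖ₑ ^ 2 ≤ A * ENNReal.ofReal (h1Norm Ω u ^ 2) := by
  obtain ⟨A, hA⟩ := hΩ.exists_lintegral_enorm_sq_le
  refine ⟨A, fun u g hg ↦ ?_⟩
  obtain ⟨ψ, hψ, hψu, hae⟩ := hg.exists_seq_tendsto_ae
  rw [Lp.enorm_def, eLpNorm_two_sq]
  exact (lintegral_enorm_sq_le_liminf (fun k ↦ (hψ k).continuous.measurable) hae).trans
    (hψu.liminf_le hψ fun k ↦ hA _ ((hψ k).of_le (by simp)))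

lemma exists_gagliardoEnergy_le_of_isTrace (hΩ : IsBoundedLipschitzOpen Ω) :
    ∃ A : ℝ≥0, ∀ (u : L2 Ω) (g : L2Boundary Ω), IsTrace Ω u g →
      gagliardoEnergy (surfaceMeasure Ω) g ≤ A * ENNReal.ofReal (h1Norm Ω u ^ 2) := by
  obtain ⟨A, hA⟩ := hΩ.exists_gagliardoEnergy_le
  have hfin := hΩ.isFiniteMeasure_surfaceMeasure
  refine ⟨A, fun u g hg ↦ ?_⟩
  obtain ⟨ψ, hψ, hψu, hae⟩ := hg.exists_seq_tendsto_ae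
  exact (gagliardoEnergy_le_liminf (fun k ↦ (hψ k).continuous) hae).trans
    (hψu.liminf_le hψ fun k ↦ hA _ ((hψ k).of_le (by simp)))

end IsBoundedLipschitzOpen

lemma h1Norm_sub_self (hΩ : IsOpen Ω) {u : L2 Ω} (hu : u ∈ H1 Ω) : h1Norm Ω (u - u) = 0 := by
  simp only [h1Norm, weakPartial_sub hΩ hu hu]
  simp

lemma IsTrace.unique (hΩ : IsBoundedLipschitzOpen Ω) {u : L2 Ω} {g g' : L2Boundary Ω}
    (hg : IsTrace Ω u g) (hg' : IsTrace Ω u g') : g = g' := by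
  obtain ⟨A, hA⟩ := hΩ.exists_enorm_sq_le_of_isTrace
  have hsub := hA _ _ (hg.sub hΩ.isOpen hg')
  rw [h1Norm_sub_self hΩ.isOpen hg.1] at hsub
  simpa [sub_eq_zero] using hsub

lemma IsTrace.mem_HHalf (hΩ : IsBoundedLipschitzOpen Ω) {u : L2 Ω} {g : L2Boundary Ω}
    (hg : IsTrace Ω u g) : g ∈ HHalf Ω := by
  obtain ⟨A, hA⟩ := hΩ.exists_gagliardoEnergy_le_of_isTrace
  exact (hA u g hg).trans_lt (by finiteness)

end TraceInequality

section Kernel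

variable {ε a : ℝ} {z : Euc n}

/-- The kernel `(|z|² + ε²)⁻ⁿ`, whose normalized averages over `∂Ω` extend boundary functions to
`Ω`. The extension itself is given by `ε = 0`; for `ε > 0` it is smooth up to the boundary. -/
def avgKernel (ε : ℝ) (z : Euc n) : ℝ := ((‖z‖ ^ 2 + ε ^ 2) ^ n)⁻¹

/-- The logarithmic derivative of `avgKernel ε` in the direction of the `i`-th coordinate. -/
def avgKernelLogDeriv (ε : ℝ) (i : Fin n) (z : Euc n) : ℝ := -(2 * n * z i) / (‖z‖ ^ 2 + ε ^ 2)

lemma avgKernel_nonneg (ε : ℝ) (z : Euc n) : 0 ≤ avgKernel ε z := by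
  rw [avgKernel]
  positivity

lemma avgKernel_le (ha : 0 < a) (h : a ^ 2 ≤ ‖z‖ ^ 2 + ε ^ 2) :
    avgKernel ε z ≤ ((a ^ 2) ^ n)⁻¹ := by
  rw [avgKernel]
  gcongr

lemma avgKernelLogDeriv_sq_le (h : 0 < ‖z‖ ^ 2 + ε ^ 2) (i : Fin n) :
    avgKernelLogDeriv ε i z ^ 2 ≤ 4 * n ^ 2 * (‖z‖ ^ 2 + ε ^ 2)⁻¹ := by
  have hz : z i ^ 2 ≤ ‖z‖ ^ 2 + ε ^ 2 := by
    rw [← sq_abs, ← Real.norm_eq_abs]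
    exact le_add_of_le_of_nonneg (by gcongr; exact PiLp.norm_apply_le z i) (sq_nonneg ε)
  calc avgKernelLogDeriv ε i z ^ 2 = 4 * n ^ 2 * z i ^ 2 / (‖z‖ ^ 2 + ε ^ 2) ^ 2 := by
        rw [avgKernelLogDeriv, div_pow]
        congr 1
        ring
    _ ≤ 4 * n ^ 2 * (‖z‖ ^ 2 + ε ^ 2) / (‖z‖ ^ 2 + ε ^ 2) ^ 2 := by gcongr
    _ = 4 * n ^ 2 * (‖z‖ ^ 2 + ε ^ 2)⁻¹ := by field_simp

lemma abs_avgKernelLogDeriv_mul_avgKernel_le (ha : 0 < a) (h : a ^ 2 ≤ ‖z‖ ^ 2 + ε ^ 2)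
    (i : Fin n) : |avgKernelLogDeriv ε i z * avgKernel ε z| ≤ 2 * n / a * ((a ^ 2) ^ n)⁻¹ := by
  have hlog : avgKernelLogDeriv ε i z ^ 2 ≤ (2 * n / a) ^ 2 := calc
    avgKernelLogDeriv ε i z ^ 2 ≤ 4 * n ^ 2 * (‖z‖ ^ 2 + ε ^ 2)⁻¹ :=
      avgKernelLogDeriv_sq_le (h.trans_lt' (by positivity)) i
    _ ≤ 4 * n ^ 2 * (a ^ 2)⁻¹ := by gcongr
    _ = (2 * n / a) ^ 2 := by ring
  rw [abs_mul, abs_of_nonneg (avgKernel_nonneg ε z)]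
  exact mul_le_mul (abs_le_of_sq_le_sq hlog (by positivity)) (avgKernel_le ha h)
    (avgKernel_nonneg ε z) (by positivity)

lemma hasDerivAt_avgKernel (hε : ε ≠ 0) (i : Fin n) (z : Euc n) (t : ℝ) :
    HasDerivAt (fun t : ℝ ↦ avgKernel ε (z + t • EuclideanSpace.single i (1 : ℝ)))
      (avgKernelLogDeriv ε i (z + t • EuclideanSpace.single i (1 : ℝ)) *
        avgKernel ε (z + t • EuclideanSpace.single i (1 : ℝ))) t := by
  have hline : HasDerivAt (fun t : ℝ ↦ z + t • EuclideanSpace.single i (1 : ℝ))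
      (EuclideanSpace.single i (1 : ℝ)) t := by
    simpa using ((hasDerivAt_id t).smul_const (EuclideanSpace.single i (1 : ℝ))).const_add z
  set v := z + t • EuclideanSpace.single i (1 : ℝ) with hv
  have : 0 < ‖v‖ ^ 2 + ε ^ 2 := by positivity
  refine (((hline.norm_sq.add_const (ε ^ 2)).fun_pow n).fun_inv (by positivity)).congr_deriv ?_
  simp only [EuclideanSpace.inner_single_right, avgKernelLogDeriv, avgKernel, ← hv,
    conj_trivial, one_mul]
  rw [← pow_sub_one_mul i.pos.ne' (‖v‖ ^ 2 + ε ^ 2)]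
  field_simp

lemma contDiff_avgKernel (hε : ε ≠ 0) : ContDiff ℝ ∞ (avgKernel (n := n) ε) :=
  (((contDiff_norm_sq ℝ).add contDiff_const).pow n).inv fun z ↦ by positivity

@[fun_prop]
lemma measurable_avgKernel (ε : ℝ) : Measurable (avgKernel (n := n) ε) := by
  unfold avgKernel
  fun_prop

@[fun_prop]
lemma measurable_avgKernelLogDeriv (ε : ℝ) (i : Fin n) : Measurable (avgKernelLogDeriv ε i) := by
  have : Measurable fun z : Euc n ↦ z i := by fun_prop
  unfold avgKernelLogDeriv
  fun_prop

lemma tendsto_avgKernel {ι : Type*} {l : Filter ι} {e : ι → ℝ} (he : Tendsto e l (𝓝 0))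
    (hz : z ≠ 0) : Tendsto (fun j ↦ avgKernel (e j) z) l (𝓝 (avgKernel 0 z)) :=
  (((he.pow 2).const_add (‖z‖ ^ 2)).pow n).inv₀ (by have := norm_pos_iff.2 hz; positivity)

lemma tendsto_avgKernelLogDeriv {ι : Type*} {l : Filter ι} {e : ι → ℝ} (he : Tendsto e l (𝓝 0))
    (i : Fin n) (hz : z ≠ 0) :
    Tendsto (fun j ↦ avgKernelLogDeriv (e j) i z) l (𝓝 (avgKernelLogDeriv 0 i z)) :=
  tendsto_const_nhds.div ((he.pow 2).const_add (‖z‖ ^ 2))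
    (by have := norm_pos_iff.2 hz; positivity)

end Kernel

section KernelAverage

variable {σ : Measure (Euc n)} {g : Euc n → ℝ} {ε a : ℝ} {x : Euc n}

/-- The total weight given to the measure `σ` by the averaging kernel centred at `x`. -/
def kernelMass (σ : Measure (Euc n)) (ε : ℝ) (x : Euc n) : ℝ := ∫ y, avgKernel ε (x - y) ∂σ

/-- The density with respect to `σ` of the probability measure used to average at `x`. -/
def kernelDensity (σ : Measure (Euc n)) (ε : ℝ) (x y : Euc n) : ℝ :=
  avgKernel ε (x - y) / kernelMass σ ε x

/-- The weighted average at `x` of a function `g` on the support of `σ`. -/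
def kernelAverage (σ : Measure (Euc n)) (g : Euc n → ℝ) (ε : ℝ) (x : Euc n) : ℝ :=
  (∫ y, g y * avgKernel ε (x - y) ∂σ) / kernelMass σ ε x

/-- The `i`-th partial derivative of `kernelAverage σ g ε`. -/
def kernelAverageDeriv (σ : Measure (Euc n)) (g : Euc n → ℝ) (ε : ℝ) (i : Fin n) (x : Euc n) : ℝ :=
  ((∫ y, g y * (avgKernelLogDeriv ε i (x - y) * avgKernel ε (x - y)) ∂σ) -
    kernelAverage σ g ε x * ∫ y, avgKernelLogDeriv ε i (x - y) * avgKernel ε (x - y) ∂σ) /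
      kernelMass σ ε x

lemma ae_sq_le_norm_sub_sq_add_sq (σ : Measure (Euc n)) (ε : ℝ) (x : Euc n) :
    ∀ᵐ y ∂σ, ε ^ 2 ≤ ‖x - y‖ ^ 2 + ε ^ 2 :=
  .of_forall fun _ ↦ le_add_of_nonneg_left (sq_nonneg _)

lemma integrable_mul_avgKernel (hg : Integrable g σ) (ha : 0 < a)
    (hx : ∀ᵐ y ∂σ, a ^ 2 ≤ ‖x - y‖ ^ 2 + ε ^ 2) :
    Integrable (fun y ↦ g y * avgKernel ε (x - y)) σ :=
  hg.mul_bdd (Measurable.aestronglyMeasurable (by fun_prop)) <| hx.mono fun y hy ↦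
    (Real.norm_of_nonneg (avgKernel_nonneg _ _)).trans_le (avgKernel_le ha hy)

lemma integrable_mul_avgKernelLogDeriv_mul_avgKernel (hg : Integrable g σ) (i : Fin n)
    (ha : 0 < a) (hx : ∀ᵐ y ∂σ, a ^ 2 ≤ ‖x - y‖ ^ 2 + ε ^ 2) :
    Integrable (fun y ↦ g y * (avgKernelLogDeriv ε i (x - y) * avgKernel ε (x - y))) σ :=
  hg.mul_bdd (Measurable.aestronglyMeasurable (by fun_prop)) <|
    hx.mono fun _ hy ↦ abs_avgKernelLogDeriv_mul_avgKernel_le ha hy i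

lemma enorm_integral_mul_sq_le {α : Type*} [MeasurableSpace α] {μ : Measure α} {f w : α → ℝ}
    (hf : AEStronglyMeasurable f μ) (hw : ∀ y, 0 ≤ w y) (hw1 : ∫ y, w y ∂μ = 1) :
    ‖∫ y, f y * w y ∂μ‖ₑ ^ 2 ≤ ∫⁻ y, ‖f y‖ₑ ^ 2 * ENNReal.ofReal (w y) ∂μ := by
  have hwi : Integrable w μ := integrable_of_integral_eq_one hw1
  have hwm := hwi.aestronglyMeasurable.aemeasurable
  calc ‖∫ y, f y * w y ∂μ‖ₑ ^ 2
      ≤ (∫⁻ y, ‖f y‖ₑ * ENNReal.ofReal (w y) ∂μ) ^ 2 := by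
        gcongr
        refine (enorm_integral_le_lintegral_enorm _).trans_eq (lintegral_congr fun y ↦ ?_)
        rw [enorm_mul, Real.enorm_of_nonneg (hw y)]
    _ ≤ (∫⁻ y, ENNReal.ofReal (w y) ∂μ) * ∫⁻ y, ‖f y‖ₑ ^ 2 * ENNReal.ofReal (w y) ∂μ :=
        sq_lintegral_mul_le hf.enorm (by fun_prop)
    _ = ∫⁻ y, ‖f y‖ₑ ^ 2 * ENNReal.ofReal (w y) ∂μ := by
        rw [← ofReal_integral_eq_lintegral_ofReal hwi (.of_forall hw), hw1, ENNReal.ofReal_one,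
          one_mul]

lemma hasDerivAt_integral_mul_avgKernel (hg : Integrable g σ) (hε : 0 < ε) (i : Fin n)
    (x : Euc n) :
    HasDerivAt
      (fun t : ℝ ↦ ∫ y, g y * avgKernel ε (x + t • EuclideanSpace.single i (1 : ℝ) - y) ∂σ)
      (∫ y, g y * (avgKernelLogDeriv ε i (x - y) * avgKernel ε (x - y)) ∂σ) 0 := by
  have hbound (z : Euc n) := abs_avgKernelLogDeriv_mul_avgKernel_le (z := z) hε
    (le_add_of_nonneg_left (sq_nonneg _)) i
  have hderiv (y : Euc n) (t : ℝ) := by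
    simpa only [sub_add_eq_add_sub] using
      (hasDerivAt_avgKernel hε.ne' i (x - y) t).const_mul (g y)
  simpa using (hasDerivAt_integral_of_dominated_loc_of_deriv_le (μ := σ) (x₀ := (0 : ℝ))
    (F := fun t y ↦ g y * avgKernel ε (x + t • EuclideanSpace.single i (1 : ℝ) - y))
    (bound := fun y ↦ ‖g y‖ * (2 * n / ε * ((ε ^ 2) ^ n)⁻¹)) Filter.univ_mem
    (.of_forall fun t ↦ hg.aestronglyMeasurable.mul (Measurable.aestronglyMeasurable (by fun_prop)))
    (by simpa using integrable_mul_avgKernel hg hε (ae_sq_le_norm_sub_sq_add_sq σ ε x))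
    (hg.aestronglyMeasurable.mul (Measurable.aestronglyMeasurable (by fun_prop)))
    (.of_forall fun y t _ ↦ (norm_mul_le _ _).trans <|
      mul_le_mul_of_nonneg_left (hbound _) (norm_nonneg _))
    (hg.norm.mul_const _) (.of_forall fun y t _ ↦ hderiv y t)).2

lemma contDiff_integral_mul_avgKernel (hg : Integrable g σ) {R : ℝ} (hR : ∀ᵐ y ∂σ, ‖y‖ ≤ R)
    (hε : 0 < ε) : ContDiff ℝ ∞ fun x ↦ ∫ y, g y * avgKernel ε (x - y) ∂σ := by
  refine contDiff_iff_contDiffAt.2 fun x ↦ ?_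
  have hr : 0 < ‖x‖ + |R| + 1 := by positivity
  -- Near `x` the kernel may be cut off, which turns the integral into a convolution with a
  -- compactly supported smooth function.
  let χ : ContDiffBump (0 : Euc n) := ⟨‖x‖ + |R| + 1, ‖x‖ + |R| + 2, hr, by linarith⟩
  have hK : HasCompactSupport fun z ↦ χ z * avgKernel ε z := χ.hasCompactSupport.mul_right
  have hconv := hK.contDiff_convolution_right (ContinuousLinearMap.mul ℝ ℝ)
    hg.locallyIntegrable (χ.contDiff.mul (contDiff_avgKernel hε.ne'))
  refine hconv.contDiffAt.congr_of_eventuallyEq ?_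
  filter_upwards [Metric.ball_mem_nhds x one_pos] with x' hx'
  refine integral_congr_ae (hR.mono fun y hy ↦ ?_)
  have hχ : χ (x' - y) = 1 := χ.one_of_mem_closedBall <| by
    rw [mem_ball_iff_norm] at hx'
    rw [mem_closedBall_zero_iff]
    change ‖x' - y‖ ≤ ‖x‖ + |R| + 1
    linarith [le_abs_self R, norm_sub_le x' y, norm_sub_norm_le x' x]
  simp [hχ]

lemma kernelDensity_nonneg (x y : Euc n) : 0 ≤ kernelDensity σ ε x y :=
  div_nonneg (avgKernel_nonneg _ _) (integral_nonneg fun _ ↦ avgKernel_nonneg _ _)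

variable [IsFiniteMeasure σ]

lemma integrable_avgKernel (ha : 0 < a) (hx : ∀ᵐ y ∂σ, a ^ 2 ≤ ‖x - y‖ ^ 2 + ε ^ 2) :
    Integrable (fun y ↦ avgKernel ε (x - y)) σ := by
  simpa using integrable_mul_avgKernel (integrable_const (1 : ℝ)) ha hx

lemma kernelMass_pos (hσ : σ ≠ 0) (ha : 0 < a) (hx : ∀ᵐ y ∂σ, a ^ 2 ≤ ‖x - y‖ ^ 2 + ε ^ 2) :
    0 < kernelMass σ ε x := by
  rw [kernelMass, integral_pos_iff_support_of_nonneg (fun y ↦ avgKernel_nonneg _ _)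
    (integrable_avgKernel ha hx), pos_iff_ne_zero]
  intro h
  have hfalse : ∀ᵐ _ ∂σ, False := by
    filter_upwards [hx, measure_eq_zero_iff_ae_notMem.1 h] with y hy hzero
    exact hzero (inv_pos.2 (pow_pos (hy.trans_lt' (by positivity)) n)).ne'
  exact hσ (ae_eq_bot.1 (Filter.eventually_false_iff_eq_bot.1 hfalse))

lemma integral_kernelDensity (hσ : σ ≠ 0) (hε : 0 < ε) (x : Euc n) :
    ∫ y, kernelDensity σ ε x y ∂σ = 1 := by
  simp only [kernelDensity, integral_div]
  exact div_self (kernelMass_pos hσ hε (ae_sq_le_norm_sub_sq_add_sq σ ε x)).ne'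

lemma kernelAverage_sub_eq_integral (hσ : σ ≠ 0) (hg : Integrable g σ) (hε : 0 < ε) (x : Euc n)
    (b : ℝ) : kernelAverage σ g ε x - b = ∫ y, (g y - b) * kernelDensity σ ε x y ∂σ := by
  have hx := ae_sq_le_norm_sub_sq_add_sq σ ε x
  have hZ := kernelMass_pos hσ hε hx
  simp only [kernelDensity, ← mul_div_assoc, integral_div, sub_mul]
  rw [integral_sub (integrable_mul_avgKernel hg hε hx) ((integrable_avgKernel hε hx).const_mul b),
    integral_const_mul, ← kernelMass, kernelAverage]
  field_simp

lemma enorm_kernelAverage_sub_sq_le (hσ : σ ≠ 0) (hg : Integrable g σ) (hε : 0 < ε) (x : Euc n)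
    (b : ℝ) :
    ‖kernelAverage σ g ε x - b‖ₑ ^ 2 ≤
      ∫⁻ y, ‖g y - b‖ₑ ^ 2 * ENNReal.ofReal (kernelDensity σ ε x y) ∂σ := by
  rw [kernelAverage_sub_eq_integral hσ hg hε]
  exact enorm_integral_mul_sq_le (hg.aestronglyMeasurable.sub aestronglyMeasurable_const)
    (kernelDensity_nonneg x) (integral_kernelDensity hσ hε x)

lemma kernelAverageDeriv_eq_integral (hg : Integrable g σ) (hε : 0 < ε)
    (i : Fin n) (x : Euc n) :
    kernelAverageDeriv σ g ε i x = ∫ y, (g y - kernelAverage σ g ε x) *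
      avgKernelLogDeriv ε i (x - y) * kernelDensity σ ε x y ∂σ := by
  have hx := ae_sq_le_norm_sub_sq_add_sq σ ε x
  have hone := integrable_mul_avgKernelLogDeriv_mul_avgKernel (integrable_const (1 : ℝ)) i hε hx
  simp only [one_mul] at hone
  simp only [kernelDensity, ← mul_div_assoc, integral_div, sub_mul, mul_assoc]
  rw [integral_sub (integrable_mul_avgKernelLogDeriv_mul_avgKernel hg i hε hx)
    (hone.const_mul _), integral_const_mul, kernelAverageDeriv]

lemma enorm_kernelAverageDeriv_sq_le (hσ : σ ≠ 0) (hg : Integrable g σ) (hε : 0 < ε) (i : Fin n)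
    (x : Euc n) :
    ‖kernelAverageDeriv σ g ε i x‖ₑ ^ 2 ≤ ∫⁻ y, ∫⁻ y', ‖g y - g y'‖ₑ ^ 2 *
      ENNReal.ofReal (avgKernelLogDeriv ε i (x - y) ^ 2 * kernelDensity σ ε x y *
        kernelDensity σ ε x y') ∂σ ∂σ := by
  rw [kernelAverageDeriv_eq_integral hg hε]
  refine (enorm_integral_mul_sq_le ((hg.aestronglyMeasurable.sub
    aestronglyMeasurable_const).mul
    (Measurable.aestronglyMeasurable (by fun_prop))) (kernelDensity_nonneg x)
    (integral_kernelDensity hσ hε x)).trans (lintegral_mono fun y ↦ ?_)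
  have hw : 0 ≤ avgKernelLogDeriv ε i (x - y) ^ 2 * kernelDensity σ ε x y :=
    mul_nonneg (sq_nonneg _) (kernelDensity_nonneg x y)
  calc ‖(g y - kernelAverage σ g ε x) * avgKernelLogDeriv ε i (x - y)‖ₑ ^ 2 *
        ENNReal.ofReal (kernelDensity σ ε x y)
      = ENNReal.ofReal (avgKernelLogDeriv ε i (x - y) ^ 2 * kernelDensity σ ε x y) *
        ‖kernelAverage σ g ε x - g y‖ₑ ^ 2 := by
        rw [enorm_mul, mul_pow, enorm_sub_rev, ENNReal.ofReal_mul (sq_nonneg _), ← sq_abs,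
          ENNReal.ofReal_pow (abs_nonneg _), ← Real.enorm_eq_ofReal_abs]
        ring
    _ ≤ ENNReal.ofReal (avgKernelLogDeriv ε i (x - y) ^ 2 * kernelDensity σ ε x y) *
        ∫⁻ y', ‖g y' - g y‖ₑ ^ 2 * ENNReal.ofReal (kernelDensity σ ε x y') ∂σ := by
        gcongr
        exact enorm_kernelAverage_sub_sq_le hσ hg hε x (g y)
    _ = ∫⁻ y', ‖g y - g y'‖ₑ ^ 2 * ENNReal.ofReal (avgKernelLogDeriv ε i (x - y) ^ 2 *
        kernelDensity σ ε x y * kernelDensity σ ε x y') ∂σ := by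
        rw [← lintegral_const_mul' _ _ ENNReal.ofReal_ne_top]
        refine lintegral_congr fun y' ↦ ?_
        rw [ENNReal.ofReal_mul hw, enorm_sub_rev]
        ring

lemma contDiff_kernelAverage (hσ : σ ≠ 0) (hg : Integrable g σ) {R : ℝ}
    (hR : ∀ᵐ y ∂σ, ‖y‖ ≤ R) (hε : 0 < ε) : ContDiff ℝ ∞ (kernelAverage σ g ε) := by
  have hmass := contDiff_integral_mul_avgKernel (integrable_const (1 : ℝ)) hR hε
  simp only [one_mul] at hmass
  exact (contDiff_integral_mul_avgKernel hg hR hε).div hmass fun x ↦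
    (kernelMass_pos hσ hε (ae_sq_le_norm_sub_sq_add_sq σ ε x)).ne'

lemma hasDerivAt_kernelAverage (hσ : σ ≠ 0) (hg : Integrable g σ) (hε : 0 < ε) (i : Fin n)
    (x : Euc n) :
    HasDerivAt (fun t : ℝ ↦ kernelAverage σ g ε (x + t • EuclideanSpace.single i (1 : ℝ)))
      (kernelAverageDeriv σ g ε i x) 0 := by
  have hZ := (kernelMass_pos hσ hε (ae_sq_le_norm_sub_sq_add_sq σ ε x)).ne'
  have hmass := hasDerivAt_integral_mul_avgKernel (integrable_const (1 : ℝ)) hε i x (σ := σ)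
  simp only [one_mul] at hmass
  refine ((hasDerivAt_integral_mul_avgKernel hg hε i x).fun_div hmass
    (by simpa [kernelMass] using hZ)).congr_deriv ?_
  simp only [zero_smul, add_zero, kernelAverageDeriv, kernelAverage, kernelMass] at hZ ⊢
  field_simp

lemma partialDeriv_kernelAverage (hσ : σ ≠ 0) (hg : Integrable g σ) {R : ℝ}
    (hR : ∀ᵐ y ∂σ, ‖y‖ ≤ R) (hε : 0 < ε) (i : Fin n) (x : Euc n) :
    partialDeriv i (kernelAverage σ g ε) x = kernelAverageDeriv σ g ε i x := by
  have hdiff : DifferentiableAt ℝ (kernelAverage σ g ε) x :=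
    (contDiff_kernelAverage hσ hg hR hε).differentiable (by simp) x
  rw [partialDeriv, ← hdiff.lineDeriv_eq_fderiv]
  exact HasLineDerivAt.lineDeriv (hasDerivAt_kernelAverage hσ hg hε i x)

end KernelAverage

section KernelBounds

variable {σ : Measure (Euc n)} [IsFiniteMeasure σ] {c : ℝ≥0} {F : Set (Euc n)} {r ε ρ : ℝ}
  {x y y' : Euc n}

lemma le_kernelMass_mul_pow (hn : 1 ≤ n) (hF : IsLowerRegularOn σ (n - 1) c F r) (hε : 0 < ε)
    (hy : y ∈ F) (hρ : 0 < ρ) (hxy : ‖x - y‖ ^ 2 + ε ^ 2 ≤ ρ ^ 2) (hρr : ρ ≤ r) :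
    c / 4 ^ n ≤ kernelMass σ ε x * ρ ^ (n + 1) := by
  have hint := integrable_avgKernel hε (ae_sq_le_norm_sub_sq_add_sq σ ε x)
  have hball : c * ρ ^ (n - 1) ≤ σ.real (Metric.closedBall y ρ) := by
    have h := hF y hy ρ hρ hρr
    rw [← ENNReal.ofReal_pow hρ.le, ← ENNReal.ofReal_coe_nnreal,
      ← ENNReal.ofReal_mul c.coe_nonneg] at h
    exact (ENNReal.ofReal_le_iff_le_toReal (measure_ne_top _ _)).1 h
  have hkernel (z : Euc n) (hz : z ∈ Metric.closedBall y ρ) :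
      ((4 * ρ ^ 2) ^ n)⁻¹ ≤ avgKernel ε (x - z) := by
    have hyz : ‖y - z‖ ≤ ρ := mem_closedBall_iff_norm'.1 hz
    have htri : ‖x - z‖ ≤ ‖x - y‖ + ‖y - z‖ := norm_sub_le_norm_sub_add_norm_sub x y z
    rw [avgKernel]
    gcongr
    nlinarith [norm_nonneg (x - z), norm_nonneg (y - z), sq_nonneg (‖x - y‖ - ‖y - z‖)]
  have hmass : σ.real (Metric.closedBall y ρ) * ((4 * ρ ^ 2) ^ n)⁻¹ ≤ kernelMass σ ε x := calc
    _ = ∫ z in Metric.closedBall y ρ, ((4 * ρ ^ 2) ^ n)⁻¹ ∂σ := by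
        rw [setIntegral_const, smul_eq_mul]
    _ ≤ ∫ z in Metric.closedBall y ρ, avgKernel ε (x - z) ∂σ :=
        setIntegral_mono_on (integrable_const _).integrableOn hint.integrableOn
          Metric.isClosed_closedBall.measurableSet hkernel
    _ ≤ kernelMass σ ε x :=
        setIntegral_le_integral hint (.of_forall fun z ↦ avgKernel_nonneg _ _)
  calc c / 4 ^ n = c * ρ ^ (n - 1) * ((4 * ρ ^ 2) ^ n)⁻¹ * ρ ^ (n + 1) := by
        obtain ⟨m, rfl⟩ := Nat.exists_eq_add_of_le' hn
        rw [Nat.add_sub_cancel, mul_pow]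
        field_simp
        ring
    _ ≤ kernelMass σ ε x * ρ ^ (n + 1) := by
        gcongr
        exact hmass.trans' (by gcongr)

lemma edist_le_ofReal_sqrt_norm_sub_sq_add_sq (ε : ℝ) (x y : Euc n) :
    edist x y ≤ ENNReal.ofReal √(‖x - y‖ ^ 2 + ε ^ 2) := by
  rw [edist_dist, dist_eq_norm]
  exact ENNReal.ofReal_le_ofReal
    (Real.le_sqrt_of_sq_le (le_add_of_nonneg_right (sq_nonneg ε)))

lemma kernelDensity_eq (σ : Measure (Euc n)) (ε : ℝ) (x y : Euc n) : kernelDensity σ ε x y =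
    ((√(‖x - y‖ ^ 2 + ε ^ 2) ^ 2) ^ n)⁻¹ / kernelMass σ ε x := by
  rw [kernelDensity, avgKernel, Real.sq_sqrt (by positivity)]

lemma kernelDensity_le (hn : 1 ≤ n) (hc : 0 < c) (hF : IsLowerRegularOn σ (n - 1) c F r)
    (hσ : σ ≠ 0) (hε : 0 < ε) (hy : y ∈ F) (hr : √(‖x - y‖ ^ 2 + ε ^ 2) ≤ r) :
    ENNReal.ofReal (kernelDensity σ ε x y) ≤
      ENNReal.ofReal ((c : ℝ) / 4 ^ n)⁻¹ * (edist x y ^ (n - 1))⁻¹ := by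
  have hZ := kernelMass_pos hσ hε (ae_sq_le_norm_sub_sq_add_sq σ ε x)
  have hedist := edist_le_ofReal_sqrt_norm_sub_sq_add_sq ε x y
  rw [kernelDensity_eq]
  set Z := kernelMass σ ε x with hZdef
  set ρ := √(‖x - y‖ ^ 2 + ε ^ 2) with hρdef
  have hρ : 0 < ρ := Real.sqrt_pos.2 (by positivity)
  have hmass : c / 4 ^ n ≤ Z * ρ ^ (n + 1) :=
    le_kernelMass_mul_pow hn hF hε hy hρ (Real.sq_sqrt (by positivity)).ge hr
  have hk : (0 : ℝ) < c / 4 ^ n := by positivity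
  set k : ℝ := c / 4 ^ n
  have hle : ((ρ ^ 2) ^ n)⁻¹ / Z ≤ k⁻¹ * (ρ ^ (n - 1))⁻¹ := calc
    _ = k⁻¹ * ((ρ ^ 2) ^ n)⁻¹ / Z * k := by field_simp
    _ ≤ k⁻¹ * ((ρ ^ 2) ^ n)⁻¹ / Z * (Z * ρ ^ (n + 1)) := by gcongr
    _ = k⁻¹ * (ρ ^ (n - 1))⁻¹ := by
        obtain ⟨m, rfl⟩ := Nat.exists_eq_add_of_le' hn
        rw [Nat.add_sub_cancel]
        field_simp
        ring
  refine (ENNReal.ofReal_le_ofReal hle).trans ?_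
  rw [ENNReal.ofReal_mul (by positivity), ENNReal.ofReal_inv_of_pos (x := ρ ^ (n - 1))
    (by positivity), ENNReal.ofReal_pow hρ.le]
  gcongr

lemma kernelDensity_le_of_mem (hn : 1 ≤ n) (hc : 0 < c) (hF : IsLowerRegularOn σ (n - 1) c F r)
    (hσ : σ ≠ 0) (hε : 0 < ε) (hεr : ε ≤ r) (hx : x ∈ F) (y : Euc n) :
    ENNReal.ofReal (kernelDensity σ ε x y) ≤
      ENNReal.ofReal (((c : ℝ) / 4 ^ n)⁻¹ * ε) * (edist x y ^ n)⁻¹ := by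
  have hZ := kernelMass_pos hσ hε (ae_sq_le_norm_sub_sq_add_sq σ ε x)
  have hmass : c / 4 ^ n ≤ kernelMass σ ε x * ε ^ (n + 1) :=
    le_kernelMass_mul_pow hn hF hε hx hε (by simp) hεr
  have hedist := edist_le_ofReal_sqrt_norm_sub_sq_add_sq ε x y
  have hερ : ε ≤ √(‖x - y‖ ^ 2 + ε ^ 2) :=
    Real.le_sqrt_of_sq_le (le_add_of_nonneg_left (sq_nonneg _))
  rw [kernelDensity_eq]
  set Z := kernelMass σ ε x
  set ρ := √(‖x - y‖ ^ 2 + ε ^ 2)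
  have hρ : 0 < ρ := hε.trans_le hερ
  have hk : (0 : ℝ) < c / 4 ^ n := by positivity
  set k : ℝ := c / 4 ^ n
  have hle : ((ρ ^ 2) ^ n)⁻¹ / Z ≤ k⁻¹ * ε * (ρ ^ n)⁻¹ := calc
    _ = k⁻¹ * ((ρ ^ 2) ^ n)⁻¹ / Z * k := by field_simp
    _ ≤ k⁻¹ * ((ρ ^ 2) ^ n)⁻¹ / Z * (Z * (ε ^ n * ε)) := by
        rw [pow_succ] at hmass
        gcongr
    _ ≤ k⁻¹ * ((ρ ^ 2) ^ n)⁻¹ / Z * (Z * (ρ ^ n * ε)) := by gcongr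
    _ = k⁻¹ * ε * (ρ ^ n)⁻¹ := by
        field_simp
        ring
  refine (ENNReal.ofReal_le_ofReal hle).trans ?_
  rw [ENNReal.ofReal_mul (by positivity), ENNReal.ofReal_inv_of_pos (by positivity),
    ENNReal.ofReal_pow hρ.le]
  gcongr

lemma inv_mul_inv_pow_mul_inv_pow_le {A A' Z k : ℝ} (hA : 0 < A) (hA' : 0 < A') (hZ : 0 < Z)
    (hk : 0 < k) (h : k ^ 2 ≤ Z ^ 2 * A ^ (n + 1)) (h' : k ^ 2 ≤ Z ^ 2 * A' ^ (n + 1)) :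
    A⁻¹ * ((A ^ n)⁻¹ / Z) * ((A' ^ n)⁻¹ / Z) ≤ 2 ^ n / k ^ 2 * ((A + A') ^ n)⁻¹ := by
  suffices k ^ 2 * ((A + A') / 2) ^ n ≤ Z ^ 2 * A ^ (n + 1) * A' ^ n by
    calc A⁻¹ * ((A ^ n)⁻¹ / Z) * ((A' ^ n)⁻¹ / Z) = (Z ^ 2 * A ^ (n + 1) * A' ^ n)⁻¹ := by
          field_simp
          ring
      _ ≤ (k ^ 2 * ((A + A') / 2) ^ n)⁻¹ := inv_anti₀ (by positivity) this
      _ = 2 ^ n / k ^ 2 * ((A + A') ^ n)⁻¹ := by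
          rw [div_pow]
          field_simp
  rcases le_total A A' with hle | hle
  · gcongr
    linarith
  · calc k ^ 2 * ((A + A') / 2) ^ n ≤ (Z ^ 2 * A' ^ (n + 1)) * A ^ n := by
          gcongr
          linarith
      _ = Z ^ 2 * A' ^ n * A ^ n * A' := by ring
      _ ≤ Z ^ 2 * A' ^ n * A ^ n * A := by gcongr
      _ = Z ^ 2 * A ^ (n + 1) * A' ^ n := by ring

lemma avgKernelLogDeriv_sq_mul_kernelDensity_mul_kernelDensity_le (hn : 1 ≤ n) (hc : 0 < c)
    (hF : IsLowerRegularOn σ (n - 1) c F r) (hσ : σ ≠ 0) (hε : 0 < ε) (i : Fin n) (hy : y ∈ F)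
    (hy' : y' ∈ F) (hr : √(‖x - y‖ ^ 2 + ε ^ 2) ≤ r) (hr' : √(‖x - y'‖ ^ 2 + ε ^ 2) ≤ r) :
    ENNReal.ofReal (avgKernelLogDeriv ε i (x - y) ^ 2 * kernelDensity σ ε x y *
        kernelDensity σ ε x y') ≤
      ENNReal.ofReal (4 * n ^ 2 * (2 ^ n / ((c : ℝ) / 4 ^ n) ^ 2)) *
        (ENNReal.ofReal (‖x - y‖ ^ 2 + ‖x - y'‖ ^ 2) ^ n)⁻¹ := by
  have hZ := kernelMass_pos hσ hε (ae_sq_le_norm_sub_sq_add_sq σ ε x)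
  have hmass (w : Euc n) (hw : w ∈ F) (hwr : √(‖x - w‖ ^ 2 + ε ^ 2) ≤ r) :
      (c / 4 ^ n : ℝ) ^ 2 ≤ kernelMass σ ε x ^ 2 * (‖x - w‖ ^ 2 + ε ^ 2) ^ (n + 1) := by
    have hA : 0 ≤ ‖x - w‖ ^ 2 + ε ^ 2 := by positivity
    have h := le_kernelMass_mul_pow hn hF hε hw (Real.sqrt_pos.2 (by positivity))
      (Real.sq_sqrt hA).ge hwr
    calc (c / 4 ^ n : ℝ) ^ 2
        ≤ (kernelMass σ ε x * √(‖x - w‖ ^ 2 + ε ^ 2) ^ (n + 1)) ^ 2 := by gcongr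
      _ = kernelMass σ ε x ^ 2 * (√(‖x - w‖ ^ 2 + ε ^ 2) ^ 2) ^ (n + 1) := by ring
      _ = _ := by rw [Real.sq_sqrt hA]
  have hle : avgKernelLogDeriv ε i (x - y) ^ 2 * kernelDensity σ ε x y * kernelDensity σ ε x y' ≤
      4 * n ^ 2 * (2 ^ n / (c / 4 ^ n) ^ 2) *
        ((‖x - y‖ ^ 2 + ε ^ 2 + (‖x - y'‖ ^ 2 + ε ^ 2)) ^ n)⁻¹ := calc
    _ ≤ 4 * n ^ 2 * (‖x - y‖ ^ 2 + ε ^ 2)⁻¹ * kernelDensity σ ε x y * kernelDensity σ ε x y' := by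
        have := kernelDensity_nonneg (σ := σ) (ε := ε) x y
        have := kernelDensity_nonneg (σ := σ) (ε := ε) x y'
        gcongr
        exact avgKernelLogDeriv_sq_le (by positivity) i
    _ = 4 * n ^ 2 *
        ((‖x - y‖ ^ 2 + ε ^ 2)⁻¹ * kernelDensity σ ε x y * kernelDensity σ ε x y') := by ring
    _ ≤ 4 * n ^ 2 * (2 ^ n / (c / 4 ^ n) ^ 2 *
        ((‖x - y‖ ^ 2 + ε ^ 2 + (‖x - y'‖ ^ 2 + ε ^ 2)) ^ n)⁻¹) := by
        exact mul_le_mul_of_nonneg_left (inv_mul_inv_pow_mul_inv_pow_le (by positivity)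
          (by positivity) hZ (by positivity) (hmass y hy hr) (hmass y' hy' hr')) (by positivity)
    _ = _ := by ring
  refine (ENNReal.ofReal_le_ofReal hle).trans ?_
  rw [ENNReal.ofReal_mul (by positivity), ENNReal.ofReal_inv_of_pos (by positivity),
    ENNReal.ofReal_pow (by positivity)]
  gcongr <;> exact le_add_of_nonneg_right (sq_nonneg ε)

end KernelBounds

section Potentials

lemma norm_midpoint_add_smul_sub_sq_add_sq {E : Type*} [NormedAddCommGroup E]
    [InnerProductSpace ℝ E] (y y' z : E) :
    ‖midpoint ℝ y y' + (‖y - y'‖ / 2) • z - y‖ ^ 2 +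
      ‖midpoint ℝ y y' + (‖y - y'‖ / 2) • z - y'‖ ^ 2 =
        ‖y - y'‖ ^ 2 / 2 * (1 + ‖z‖ ^ 2) := by
  have hlaw := parallelogram_law_with_norm ℝ ((‖y - y'‖ / 2) • z) ((2 : ℝ)⁻¹ • (y - y'))
  have hy : midpoint ℝ y y' + (‖y - y'‖ / 2) • z - y =
      (‖y - y'‖ / 2) • z - (2 : ℝ)⁻¹ • (y - y') := by
    rw [midpoint_eq_smul_add, invOf_eq_inv]
    module
  have hy' : midpoint ℝ y y' + (‖y - y'‖ / 2) • z - y' =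
      (‖y - y'‖ / 2) • z + (2 : ℝ)⁻¹ • (y - y') := by
    rw [midpoint_eq_smul_add, invOf_eq_inv]
    module
  rw [hy, hy']
  simp only [norm_smul, Real.norm_of_nonneg (show 0 ≤ ‖y - y'‖ / 2 by positivity)] at hlaw
  norm_num at hlaw
  linarith

lemma lintegral_inv_one_add_sq_pow_lt_top (hn : 1 ≤ n) :
    ∫⁻ z : Euc n, (ENNReal.ofReal (1 + ‖z‖ ^ 2) ^ n)⁻¹ < ⊤ := by
  have hint : Integrable (fun z : Euc n ↦ ((1 : ℝ) + ‖z‖ ^ 2) ^ (-(2 * n : ℝ) / 2)) volume :=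
    integrable_rpow_neg_one_add_norm_sq <| by
      rw [finrank_euclideanSpace_fin]
      exact_mod_cast (by lia : n < 2 * n)
  refine (lintegral_congr fun z ↦ ?_).trans_lt hint.lintegral_lt_top
  rw [neg_div, mul_div_cancel_left₀ _ two_ne_zero, Real.rpow_neg (by positivity),
    Real.rpow_natCast, ENNReal.ofReal_inv_of_pos (by positivity),
    ENNReal.ofReal_pow (by positivity)]

lemma lintegral_inv_sq_add_sq_pow {y y' : Euc n} (hy : y ≠ y') :
    ∫⁻ x, (ENNReal.ofReal (‖x - y‖ ^ 2 + ‖x - y'‖ ^ 2) ^ n)⁻¹ =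
      (edist y y' ^ n)⁻¹ * ∫⁻ z : Euc n, (ENNReal.ofReal (1 + ‖z‖ ^ 2) ^ n)⁻¹ := by
  have ht : 0 < ‖y - y'‖ := norm_pos_iff.2 (sub_ne_zero.2 hy)
  have hG : Measurable fun x : Euc n ↦ (ENNReal.ofReal (‖x - y‖ ^ 2 + ‖x - y'‖ ^ 2) ^ n)⁻¹ := by
    fun_prop
  have hscale := lintegral_comp_add_smul (μ := volume) hG (midpoint ℝ y y') (half_pos ht)
  have hs0 : ENNReal.ofReal (‖y - y'‖ / 2) ^ n ≠ 0 :=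
    pow_ne_zero _ (ENNReal.ofReal_pos.2 (half_pos ht)).ne'
  have hs : ENNReal.ofReal (‖y - y'‖ / 2) ^ n ≠ ⊤ := ENNReal.pow_ne_top ENNReal.ofReal_ne_top
  have hfactor (z : Euc n) : (ENNReal.ofReal (‖y - y'‖ ^ 2 / 2 * (1 + ‖z‖ ^ 2)) ^ n)⁻¹ =
      (ENNReal.ofReal (‖y - y'‖ / 2) ^ n)⁻¹ *
        ((edist y y' ^ n)⁻¹ * (ENNReal.ofReal (1 + ‖z‖ ^ 2) ^ n)⁻¹) := by
    rw [show ‖y - y'‖ ^ 2 / 2 * (1 + ‖z‖ ^ 2) = ‖y - y'‖ / 2 * (‖y - y'‖ * (1 + ‖z‖ ^ 2)) by ring,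
      ENNReal.ofReal_mul (by positivity), ENNReal.ofReal_mul ht.le, mul_pow, mul_pow,
      ENNReal.mul_inv (.inl hs0) (.inl hs), ENNReal.mul_inv, edist_dist, dist_eq_norm]
    · exact .inl (pow_ne_zero _ (ENNReal.ofReal_pos.2 ht).ne')
    · exact .inl (ENNReal.pow_ne_top ENNReal.ofReal_ne_top)
  simp only [norm_midpoint_add_smul_sub_sq_add_sq, hfactor, finrank_euclideanSpace_fin] at hscale
  rw [lintegral_const_mul _ (by fun_prop), lintegral_const_mul _ (by fun_prop)] at hscale
  exact ((ENNReal.mul_right_inj (ENNReal.inv_ne_zero.2 hs) (ENNReal.inv_ne_top.2 hs0)).1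
    hscale).symm

variable {σ : Measure (Euc n)} [SFinite σ] {g : Euc n → ℝ}

lemma lintegral_lintegral_lintegral_inv_sq_add_sq_pow (hg : Measurable g) :
    ∫⁻ x, ∫⁻ y, ∫⁻ y', ‖g y - g y'‖ₑ ^ 2 *
        (ENNReal.ofReal (‖x - y‖ ^ 2 + ‖x - y'‖ ^ 2) ^ n)⁻¹ ∂σ ∂σ =
      gagliardoEnergy σ g * ∫⁻ z : Euc n, (ENNReal.ofReal (1 + ‖z‖ ^ 2) ^ n)⁻¹ := by
  have hm : Measurable fun p : (Euc n × Euc n) × Euc n ↦ ‖g p.1.2 - g p.2‖ₑ ^ 2 *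
      (ENNReal.ofReal (‖p.1.1 - p.1.2‖ ^ 2 + ‖p.1.1 - p.2‖ ^ 2) ^ n)⁻¹ := by fun_prop
  have hquot : Measurable fun p : Euc n × Euc n ↦ ‖g p.1 - g p.2‖ₑ ^ 2 / edist p.1 p.2 ^ n := by
    fun_prop
  have hinner (y y' : Euc n) : ∫⁻ x, ‖g y - g y'‖ₑ ^ 2 *
      (ENNReal.ofReal (‖x - y‖ ^ 2 + ‖x - y'‖ ^ 2) ^ n)⁻¹ =
        ‖g y - g y'‖ₑ ^ 2 / edist y y' ^ n *
          ∫⁻ z : Euc n, (ENNReal.ofReal (1 + ‖z‖ ^ 2) ^ n)⁻¹ := by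
    rcases eq_or_ne y y' with rfl | hy
    · simp
    · rw [lintegral_const_mul _ (by fun_prop), lintegral_inv_sq_add_sq_pow hy, div_eq_mul_inv,
        mul_assoc]
  rw [lintegral_lintegral_swap hm.lintegral_prod_right'.aemeasurable, gagliardoEnergy,
    ← lintegral_mul_const _ hquot.lintegral_prod_right']
  refine lintegral_congr fun y ↦ ?_
  rw [lintegral_lintegral_swap (by fun_prop), ← lintegral_mul_const _ (by fun_prop)]
  exact lintegral_congr fun y' ↦ hinner y y'

lemma setLIntegral_inv_enorm_pow_lt_top (hn : 1 ≤ n) (r : ℝ) :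
    ∫⁻ z in Metric.ball (0 : Euc n) r, (‖z‖ₑ ^ (n - 1))⁻¹ < ⊤ := by
  have hfin : Module.finrank ℝ (Euc n) = n := finrank_euclideanSpace_fin
  have : NeZero n := ⟨by lia⟩
  have hint : IntegrableOn (fun z : Euc n ↦ (‖z‖ ^ (n - 1))⁻¹) (Metric.ball 0 r) volume := by
    refine integrableOn_ball_of_norm_le_rpow (C := 1) (α := ((n - 1 : ℕ) : ℝ)) (by rwa [hfin])
      (by rw [hfin]; exact_mod_cast (by lia : n - 1 < n)) (.of_forall fun z ↦ ?_) (by fun_prop)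
    rw [Real.norm_of_nonneg (by positivity), one_mul, Real.rpow_neg (norm_nonneg _),
      Real.rpow_natCast]
  have hne : ∀ᵐ z : Euc n, z ≠ 0 := by simp [ae_iff]
  refine (lintegral_congr_ae (ae_restrict_of_ae (hne.mono fun z hz ↦ ?_))).trans_lt
    hint.lintegral_lt_top
  have hz' : 0 < ‖z‖ := norm_pos_iff.2 hz
  simp only [ENNReal.ofReal_inv_of_pos (pow_pos hz' _), ENNReal.ofReal_pow hz'.le, ofReal_norm]

lemma setLIntegral_inv_edist_pow (y : Euc n) (r : ℝ) :
    ∫⁻ x in Metric.ball y r, (edist x y ^ (n - 1))⁻¹ =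
      ∫⁻ z in Metric.ball (0 : Euc n) r, (‖z‖ₑ ^ (n - 1))⁻¹ := by
  have hball : (fun x : Euc n ↦ x - y) ⁻¹' Metric.ball 0 r = Metric.ball y r := by
    ext x
    simp [dist_eq_norm]
  rw [← hball, ← (measurePreserving_sub_right volume y).setLIntegral_comp_preimage
    Metric.isOpen_ball.measurableSet (by fun_prop)]
  simp only [edist_eq_enorm_sub]

lemma setLIntegral_lintegral_mul_inv_edist_pow_le {Ω : Set (Euc n)} {R : ℝ} (hg : Measurable g)
    (hΩ : ∀ᵐ y ∂σ, Ω ⊆ Metric.ball y R) :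
    ∫⁻ x in Ω, ∫⁻ y, ‖g y‖ₑ ^ 2 * (edist x y ^ (n - 1))⁻¹ ∂σ ≤
      (∫⁻ y, ‖g y‖ₑ ^ 2 ∂σ) * ∫⁻ z in Metric.ball (0 : Euc n) R, (‖z‖ₑ ^ (n - 1))⁻¹ := by
  rw [lintegral_lintegral_swap (by fun_prop), ← lintegral_mul_const _ (by fun_prop)]
  refine lintegral_mono_ae (hΩ.mono fun y hy ↦ ?_)
  rw [lintegral_const_mul _ (by fun_prop), ← setLIntegral_inv_edist_pow y R]
  exact mul_le_mul_right (lintegral_mono_set hy) _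

end Potentials

section KernelLimits

lemma tendsto_integral_mul_of_bounded {α ι : Type*} [MeasurableSpace α] {μ : Measure α}
    {l : Filter ι} [l.IsCountablyGenerated] {f : α → ℝ} (hf : Integrable f μ) {k : ι → α → ℝ}
    {k₀ : α → ℝ} {C : ℝ} (hk : ∀ j, AEStronglyMeasurable (k j) μ)
    (hC : ∀ j, ∀ᵐ y ∂μ, |k j y| ≤ C)
    (hlim : ∀ᵐ y ∂μ, Tendsto (fun j ↦ k j y) l (𝓝 (k₀ y))) :
    Tendsto (fun j ↦ ∫ y, f y * k j y ∂μ) l (𝓝 (∫ y, f y * k₀ y ∂μ)) := by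
  refine tendsto_integral_filter_of_dominated_convergence (fun y ↦ ‖f y‖ * C)
    (.of_forall fun j ↦ hf.aestronglyMeasurable.mul (hk j))
    (.of_forall fun j ↦ (hC j).mono fun y hy ↦ ?_) (hf.norm.mul_const C)
    (hlim.mono fun y hy ↦ hy.const_mul (f y))
  rw [norm_mul]
  exact mul_le_mul_of_nonneg_left hy (norm_nonneg _)

variable {σ : Measure (Euc n)} {g : Euc n → ℝ} {x : Euc n} {d : ℝ} {ι : Type*} {l : Filter ι}
  {e : ι → ℝ}

lemma ae_sq_le_norm_sub_sq_add_sq_of_le (hd : 0 < d) (hx : ∀ᵐ y ∂σ, d ≤ ‖x - y‖) (ε : ℝ) :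
    ∀ᵐ y ∂σ, d ^ 2 ≤ ‖x - y‖ ^ 2 + ε ^ 2 :=
  hx.mono fun _ hy ↦ le_add_of_le_of_nonneg (pow_le_pow_left₀ hd.le hy 2) (sq_nonneg ε)

variable [l.IsCountablyGenerated]

lemma tendsto_integral_mul_avgKernel (hg : Integrable g σ) (hd : 0 < d)
    (hx : ∀ᵐ y ∂σ, d ≤ ‖x - y‖) (he : Tendsto e l (𝓝 0)) :
    Tendsto (fun j ↦ ∫ y, g y * avgKernel (e j) (x - y) ∂σ) l
      (𝓝 (∫ y, g y * avgKernel 0 (x - y) ∂σ)) :=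
  tendsto_integral_mul_of_bounded hg (fun _ ↦ Measurable.aestronglyMeasurable (by fun_prop))
    (fun j ↦ (ae_sq_le_norm_sub_sq_add_sq_of_le hd hx (e j)).mono fun _ hy ↦
      (abs_of_nonneg (avgKernel_nonneg _ _)).trans_le (avgKernel_le hd hy))
    (hx.mono fun _ hy ↦ tendsto_avgKernel he (norm_pos_iff.1 (hd.trans_le hy)))

lemma tendsto_integral_mul_avgKernelLogDeriv_mul_avgKernel (hg : Integrable g σ) (i : Fin n)
    (hd : 0 < d) (hx : ∀ᵐ y ∂σ, d ≤ ‖x - y‖) (he : Tendsto e l (𝓝 0)) :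
    Tendsto
      (fun j ↦ ∫ y, g y * (avgKernelLogDeriv (e j) i (x - y) * avgKernel (e j) (x - y)) ∂σ) l
      (𝓝 (∫ y, g y * (avgKernelLogDeriv 0 i (x - y) * avgKernel 0 (x - y)) ∂σ)) := by
  refine tendsto_integral_mul_of_bounded hg
    (fun _ ↦ Measurable.aestronglyMeasurable (by fun_prop))
    (fun j ↦ (ae_sq_le_norm_sub_sq_add_sq_of_le hd hx (e j)).mono fun _ hy ↦
      abs_avgKernelLogDeriv_mul_avgKernel_le hd hy i) (hx.mono fun y hy ↦ ?_)
  have hz : x - y ≠ 0 := norm_pos_iff.1 (hd.trans_le hy)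
  exact (tendsto_avgKernelLogDeriv he i hz).mul (tendsto_avgKernel he hz)

variable [IsFiniteMeasure σ]

lemma tendsto_kernelMass (hd : 0 < d) (hx : ∀ᵐ y ∂σ, d ≤ ‖x - y‖) (he : Tendsto e l (𝓝 0)) :
    Tendsto (fun j ↦ kernelMass σ (e j) x) l (𝓝 (kernelMass σ 0 x)) := by
  simpa only [one_mul, kernelMass] using
    tendsto_integral_mul_avgKernel (integrable_const (1 : ℝ)) hd hx he

lemma tendsto_kernelAverage (hσ : σ ≠ 0) (hg : Integrable g σ) (hd : 0 < d)
    (hx : ∀ᵐ y ∂σ, d ≤ ‖x - y‖) (he : Tendsto e l (𝓝 0)) :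
    Tendsto (fun j ↦ kernelAverage σ g (e j) x) l (𝓝 (kernelAverage σ g 0 x)) :=
  (tendsto_integral_mul_avgKernel hg hd hx he).div (tendsto_kernelMass hd hx he)
    (kernelMass_pos hσ hd (ae_sq_le_norm_sub_sq_add_sq_of_le hd hx 0)).ne'

lemma tendsto_kernelAverageDeriv (hσ : σ ≠ 0) (hg : Integrable g σ) (i : Fin n) (hd : 0 < d)
    (hx : ∀ᵐ y ∂σ, d ≤ ‖x - y‖) (he : Tendsto e l (𝓝 0)) :
    Tendsto (fun j ↦ kernelAverageDeriv σ g (e j) i x) l (𝓝 (kernelAverageDeriv σ g 0 i x)) := by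
  have hone := tendsto_integral_mul_avgKernelLogDeriv_mul_avgKernel
    (integrable_const (1 : ℝ)) i hd hx he
  simp only [one_mul] at hone
  exact ((tendsto_integral_mul_avgKernelLogDeriv_mul_avgKernel hg i hd hx he).sub
    ((tendsto_kernelAverage hσ hg hd hx he).mul hone)).div (tendsto_kernelMass hd hx he)
      (kernelMass_pos hσ hd (ae_sq_le_norm_sub_sq_add_sq_of_le hd hx 0)).ne'

end KernelLimits

section KernelAverageBounds

variable {σ : Measure (Euc n)} [IsFiniteMeasure σ] {g : Euc n → ℝ} {c : ℝ≥0} {F : Set (Euc n)}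
  {r ε : ℝ} {x : Euc n}

lemma enorm_kernelAverage_sq_le (hn : 1 ≤ n) (hc : 0 < c)
    (hF : IsLowerRegularOn σ (n - 1) c F r) (hσF : ∀ᵐ y ∂σ, y ∈ F) (hσ : σ ≠ 0)
    (hg : Integrable g σ) (hε : 0 < ε) (hr : ∀ᵐ y ∂σ, √(‖x - y‖ ^ 2 + ε ^ 2) ≤ r) :
    ‖kernelAverage σ g ε x‖ₑ ^ 2 ≤ ENNReal.ofReal ((c : ℝ) / 4 ^ n)⁻¹ *
      ∫⁻ y, ‖g y‖ₑ ^ 2 * (edist x y ^ (n - 1))⁻¹ ∂σ := by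
  have h := enorm_kernelAverage_sub_sq_le hσ hg hε x 0
  simp only [sub_zero] at h
  refine h.trans ?_
  rw [← lintegral_const_mul' _ _ ENNReal.ofReal_ne_top]
  refine lintegral_mono_ae ((hσF.and hr).mono fun y hy ↦ ?_)
  rw [mul_left_comm]
  gcongr
  exact kernelDensity_le hn hc hF hσ hε hy.1 hy.2

lemma enorm_kernelAverageDeriv_sq_le_potential (hn : 1 ≤ n) (hc : 0 < c)
    (hF : IsLowerRegularOn σ (n - 1) c F r) (hσF : ∀ᵐ y ∂σ, y ∈ F) (hσ : σ ≠ 0)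
    (hg : Integrable g σ) (hε : 0 < ε) (i : Fin n)
    (hr : ∀ᵐ y ∂σ, √(‖x - y‖ ^ 2 + ε ^ 2) ≤ r) :
    ‖kernelAverageDeriv σ g ε i x‖ₑ ^ 2 ≤
      ENNReal.ofReal (4 * n ^ 2 * (2 ^ n / ((c : ℝ) / 4 ^ n) ^ 2)) *
        ∫⁻ y, ∫⁻ y', ‖g y - g y'‖ₑ ^ 2 *
          (ENNReal.ofReal (‖x - y‖ ^ 2 + ‖x - y'‖ ^ 2) ^ n)⁻¹ ∂σ ∂σ := by
  refine (enorm_kernelAverageDeriv_sq_le hσ hg hε i x).trans ?_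
  rw [← lintegral_const_mul' _ _ ENNReal.ofReal_ne_top]
  refine lintegral_mono_ae ((hσF.and hr).mono fun y hy ↦ ?_)
  rw [← lintegral_const_mul' _ _ ENNReal.ofReal_ne_top]
  refine lintegral_mono_ae ((hσF.and hr).mono fun y' hy' ↦ ?_)
  rw [mul_left_comm]
  gcongr
  exact avgKernelLogDeriv_sq_mul_kernelDensity_mul_kernelDensity_le hn hc hF hσ hε i hy.1 hy'.1
    hy.2 hy'.2

lemma eLpNorm_kernelAverage_sub_sq_le (hn : 1 ≤ n) (hc : 0 < c)
    (hF : IsLowerRegularOn σ (n - 1) c F r) (hσF : ∀ᵐ y ∂σ, y ∈ F) (hσ : σ ≠ 0)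
    (hg : Integrable g σ) (hε : 0 < ε) (hεr : ε ≤ r) :
    eLpNorm (fun x ↦ kernelAverage σ g ε x - g x) 2 σ ^ 2 ≤
      ENNReal.ofReal (((c : ℝ) / 4 ^ n)⁻¹ * ε) * gagliardoEnergy σ g := by
  rw [eLpNorm_two_sq, gagliardoEnergy, ← lintegral_const_mul' _ _ ENNReal.ofReal_ne_top]
  refine lintegral_mono_ae (hσF.mono fun x hx ↦ ?_)
  refine (enorm_kernelAverage_sub_sq_le hσ hg hε x (g x)).trans ?_
  rw [← lintegral_const_mul' _ _ ENNReal.ofReal_ne_top]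
  refine lintegral_mono fun y ↦ ?_
  rw [div_eq_mul_inv (‖g x - g y‖ₑ ^ 2), mul_left_comm, enorm_sub_rev]
  gcongr
  exact kernelDensity_le_of_mem hn hc hF hσ hε hεr hx y

lemma tendsto_zero_of_tendsto_sq_zero {ι : Type*} {l : Filter ι} {f : ι → ENNReal}
    (h : Tendsto (fun j ↦ f j ^ 2) l (𝓝 0)) : Tendsto f l (𝓝 0) := by
  have hsqrt := (ENNReal.continuous_rpow_const (y := (2 : ℝ)⁻¹)).tendsto 0 |>.comp h
  rw [ENNReal.zero_rpow_of_pos (by positivity)] at hsqrt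
  refine hsqrt.congr fun j ↦ ?_
  exact_mod_cast ENNReal.pow_rpow_inv_natCast two_ne_zero (f j)

lemma tendsto_eLpNorm_kernelAverage_sub (hn : 1 ≤ n) (hc : 0 < c)
    (hF : IsLowerRegularOn σ (n - 1) c F r) (hσF : ∀ᵐ y ∂σ, y ∈ F) (hσ : σ ≠ 0)
    (hg : Integrable g σ) (henergy : gagliardoEnergy σ g ≠ ⊤) {ι : Type*} {l : Filter ι}
    {e : ι → ℝ} (he : ∀ j, 0 < e j) (her : ∀ j, e j ≤ r) (he0 : Tendsto e l (𝓝 0)) :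
    Tendsto (fun j ↦ eLpNorm (fun x ↦ kernelAverage σ g (e j) x - g x) 2 σ) l (𝓝 0) := by
  refine tendsto_zero_of_tendsto_sq_zero (tendsto_of_tendsto_of_tendsto_of_le_of_le
    tendsto_const_nhds ?_ (fun _ ↦ zero_le) fun j ↦
      eLpNorm_kernelAverage_sub_sq_le hn hc hF hσF hσ hg (he j) (her j))
  have hcoef : Tendsto (fun j ↦ ENNReal.ofReal (((c : ℝ) / 4 ^ n)⁻¹ * e j)) l (𝓝 0) := by
    simpa using ENNReal.tendsto_ofReal (he0.const_mul ((c : ℝ) / 4 ^ n)⁻¹)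
  simpa using ENNReal.Tendsto.mul_const hcoef (.inr henergy)

end KernelAverageBounds

section DominatedConvergence

variable {α : Type*} [MeasurableSpace α] {μ : Measure α} {G : α → ENNReal}

lemma memLp_two_of_enorm_sq_le {f : α → ℝ} (hf : AEStronglyMeasurable f μ)
    (hG : ∫⁻ x, G x ∂μ ≠ ⊤) (hfG : ∀ᵐ x ∂μ, ‖f x‖ₑ ^ 2 ≤ G x) : MemLp f 2 μ := by
  have hsq : eLpNorm f 2 μ ^ 2 < ⊤ := by
    rw [eLpNorm_two_sq]
    exact (lintegral_mono_ae hfG).trans_lt hG.lt_top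
  exact ⟨hf, (ENNReal.pow_lt_top_iff.1 hsq).resolve_right two_ne_zero⟩

lemma tendsto_eLpNorm_two_of_dominated {f : ℕ → α → ℝ} {F : α → ℝ}
    (hf : ∀ j, AEStronglyMeasurable (f j) μ) (hF : AEStronglyMeasurable F μ)
    (hG : ∫⁻ x, G x ∂μ ≠ ⊤) (hfG : ∀ j, ∀ᵐ x ∂μ, ‖f j x‖ₑ ^ 2 ≤ G x)
    (hFG : ∀ᵐ x ∂μ, ‖F x‖ₑ ^ 2 ≤ G x)
    (hlim : ∀ᵐ x ∂μ, Tendsto (fun j ↦ f j x) atTop (𝓝 (F x))) :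
    Tendsto (fun j ↦ eLpNorm (fun x ↦ f j x - F x) 2 μ) atTop (𝓝 0) := by
  refine tendsto_zero_of_tendsto_sq_zero ?_
  simp only [eLpNorm_two_sq]
  have hbound (j : ℕ) : ∀ᵐ x ∂μ, ‖f j x - F x‖ₑ ^ 2 ≤ 4 * G x := by
    filter_upwards [hfG j, hFG] with x hfx hFx
    calc ‖f j x - F x‖ₑ ^ 2 ≤ 2 * (‖f j x - 0‖ₑ ^ 2 + ‖F x - 0‖ₑ ^ 2) := enorm_sub_sq_le _ _ _
      _ ≤ 2 * (G x + G x) := by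
        rw [sub_zero, sub_zero]
        gcongr
      _ = 4 * G x := by ring
  have hpointwise : ∀ᵐ x ∂μ, Tendsto (fun j ↦ ‖f j x - F x‖ₑ ^ 2) atTop (𝓝 0) := by
    filter_upwards [hlim] with x hx
    have hsub := (ENNReal.continuous_pow 2).tendsto _ |>.comp (hx.sub_const (F x)).enorm
    simpa [Function.comp_def] using hsub
  simpa using tendsto_lintegral_of_dominated_convergence' (fun x ↦ 4 * G x)
    (fun j ↦ ((hf j).sub hF).enorm.pow_const 2) hbound
    (by rw [lintegral_const_mul' _ _ (by simp)]; exact ENNReal.mul_ne_top (by simp) hG) hpointwise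

lemma exists_tendsto_eLpNorm_of_dominated {f : ℕ → α → ℝ}
    (hf : ∀ j, AEStronglyMeasurable (f j) μ) (hG : ∫⁻ x, G x ∂μ ≠ ⊤)
    (hfG : ∀ j, ∀ᵐ x ∂μ, ‖f j x‖ₑ ^ 2 ≤ G x)
    (hlim : ∀ᵐ x ∂μ, ∃ a, Tendsto (fun j ↦ f j x) atTop (𝓝 a)) :
    ∃ u : Lp ℝ 2 μ, Tendsto (fun j ↦ eLpNorm (fun x ↦ f j x - u x) 2 μ) atTop (𝓝 0) := by
  obtain ⟨F, hFm, hF⟩ := exists_stronglyMeasurable_limit_of_tendsto_ae hf hlim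
  have hFG : ∀ᵐ x ∂μ, ‖F x‖ₑ ^ 2 ≤ G x := by
    filter_upwards [hF, ae_all_iff.2 hfG] with x hx hfx
    exact le_of_tendsto' ((ENNReal.continuous_pow 2).tendsto _ |>.comp hx.enorm) hfx
  have hFmem := memLp_two_of_enorm_sq_le hFm.aestronglyMeasurable hG hFG
  refine ⟨hFmem.toLp F, (tendsto_eLpNorm_two_of_dominated hf hFm.aestronglyMeasurable hG hfG hFG
    hF).congr fun j ↦ eLpNorm_congr_ae ?_⟩
  filter_upwards [hFmem.coeFn_toLp] with x hx
  rw [hx]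

end DominatedConvergence

section Extension

variable {Ω : Set (Euc n)}

lemma exists_le_norm_sub_of_mem (hΩ : IsOpen Ω) {x : Euc n} (hx : x ∈ Ω) :
    ∃ d : ℝ, 0 < d ∧ ∀ᵐ y ∂surfaceMeasure Ω, d ≤ ‖x - y‖ := by
  obtain ⟨d, hd, hball⟩ := Metric.isOpen_iff.1 hΩ x hx
  refine ⟨d, hd, (ae_mem_frontier Ω).mono fun y hy ↦ ?_⟩
  rw [hΩ.frontier_eq] at hy
  rw [← dist_eq_norm, dist_comm]
  exact not_lt.1 fun h ↦ hy.2 (hball h)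

lemma tendsto_toLp_of_tendsto_eLpNorm {α : Type*} [MeasurableSpace α] {μ : Measure α} {ι : Type*}
    {l : Filter ι} {f : ι → α → ℝ} (hf : ∀ j, MemLp (f j) 2 μ) {u : Lp ℝ 2 μ}
    (hu : Tendsto (fun j ↦ eLpNorm (fun x ↦ f j x - u x) 2 μ) l (𝓝 0)) :
    Tendsto (fun j ↦ (hf j).toLp (f j)) l (𝓝 u) := by
  rw [Lp.tendsto_Lp_iff_tendsto_eLpNorm']
  refine hu.congr fun j ↦ eLpNorm_congr_ae ?_
  filter_upwards [(hf j).coeFn_toLp] with x hx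
  rw [Pi.sub_apply, hx]

lemma exists_isTrace_of_dominated (hΩ : IsOpen Ω) {ψ : ℕ → Euc n → ℝ}
    (hψ : ∀ j, ContDiff ℝ ∞ (ψ j)) {G G' : Euc n → ENNReal} (hG : ∫⁻ x in Ω, G x ≠ ⊤)
    (hψG : ∀ j, ∀ x ∈ Ω, ‖ψ j x‖ₑ ^ 2 ≤ G x)
    (hlim : ∀ x ∈ Ω, ∃ a, Tendsto (fun j ↦ ψ j x) atTop (𝓝 a))
    (hG' : ∫⁻ x in Ω, G' x ≠ ⊤) (hψG' : ∀ i j, ∀ x ∈ Ω, ‖partialDeriv i (ψ j) x‖ₑ ^ 2 ≤ G' x)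
    (hlim' : ∀ i, ∀ x ∈ Ω, ∃ a, Tendsto (fun j ↦ partialDeriv i (ψ j) x) atTop (𝓝 a))
    {g : L2Boundary Ω}
    (hg : Tendsto (fun j ↦ eLpNorm (fun x ↦ ψ j x - g x) 2 (surfaceMeasure Ω)) atTop (𝓝 0)) :
    ∃ u : L2 Ω, IsTrace Ω u g := by
  have hae {p : Euc n → Prop} (hp : ∀ x ∈ Ω, p x) : ∀ᵐ x ∂volume.restrict Ω, p x :=
    (ae_restrict_iff' hΩ.measurableSet).2 (.of_forall hp)
  have hmeas (j : ℕ) : AEStronglyMeasurable (ψ j) (volume.restrict Ω) :=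
    (hψ j).continuous.aestronglyMeasurable
  have hmeas' (i : Fin n) (j : ℕ) :
      AEStronglyMeasurable (partialDeriv i (ψ j)) (volume.restrict Ω) :=
    (contDiff_partialDeriv (hψ j) i).continuous.aestronglyMeasurable
  have hmem (j : ℕ) := memLp_two_of_enorm_sq_le (hmeas j) hG (hae (hψG j))
  have hmem' (i : Fin n) (j : ℕ) := memLp_two_of_enorm_sq_le (hmeas' i j) hG' (hae (hψG' i j))
  obtain ⟨u, hu⟩ := exists_tendsto_eLpNorm_of_dominated hmeas hG (fun j ↦ hae (hψG j)) (hae hlim)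
  choose v hv using fun i ↦ exists_tendsto_eLpNorm_of_dominated (hmeas' i) hG'
    (fun j ↦ hae (hψG' i j)) (hae (hlim' i))
  have hweak (i : Fin n) : HasWeakPartial Ω i u (v i) :=
    .of_tendsto (fun j ↦ .of_contDiff (hψ j) (hmem j).coeFn_toLp (hmem' i j).coeFn_toLp)
      (tendsto_toLp_of_tendsto_eLpNorm hmem hu) (tendsto_toLp_of_tendsto_eLpNorm (hmem' i) (hv i))
  refine ⟨u, fun i ↦ ⟨v i, hweak i⟩, ψ, hψ, ⟨hu, fun i ↦ ?_⟩, hg⟩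
  rw [(hweak i).weakPartial_eq hΩ]
  exact hv i

lemma lintegral_const_mul_ne_top {α : Type*} [MeasurableSpace α] {μ : Measure α} {C : ENNReal}
    {f : α → ENNReal} (hC : C ≠ ⊤) (hf : ∫⁻ x, f x ∂μ ≠ ⊤) : ∫⁻ x, C * f x ∂μ ≠ ⊤ := by
  rw [lintegral_const_mul' _ _ hC]
  exact ENNReal.mul_ne_top hC hf

lemma setLIntegral_lintegral_mul_inv_edist_pow_ne_top (hn : 1 ≤ n) {σ : Measure (Euc n)}
    [SFinite σ] {R : ℝ} (g : Lp ℝ 2 σ) (hΩ : ∀ᵐ y ∂σ, Ω ⊆ Metric.ball y R) :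
    ∫⁻ x in Ω, ∫⁻ y, ‖g y‖ₑ ^ 2 * (edist x y ^ (n - 1))⁻¹ ∂σ ≠ ⊤ := by
  refine ((setLIntegral_lintegral_mul_inv_edist_pow_le
    (Lp.stronglyMeasurable g).measurable hΩ).trans_lt (ENNReal.mul_lt_top ?_
      (setLIntegral_inv_enorm_pow_lt_top hn R))).ne
  rw [← eLpNorm_two_sq]
  exact ENNReal.pow_lt_top (Lp.eLpNorm_lt_top g)

lemma setLIntegral_lintegral_lintegral_inv_sq_add_sq_pow_ne_top (hn : 1 ≤ n)
    {σ : Measure (Euc n)} [SFinite σ] {g : Euc n → ℝ} (hg : Measurable g)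
    (henergy : gagliardoEnergy σ g ≠ ⊤) :
    ∫⁻ x in Ω, ∫⁻ y, ∫⁻ y', ‖g y - g y'‖ₑ ^ 2 *
      (ENNReal.ofReal (‖x - y‖ ^ 2 + ‖x - y'‖ ^ 2) ^ n)⁻¹ ∂σ ∂σ ≠ ⊤ := by
  refine ne_top_of_le_ne_top ?_ (setLIntegral_le_lintegral _ _)
  rw [lintegral_lintegral_lintegral_inv_sq_add_sq_pow hg]
  exact ENNReal.mul_ne_top henergy (lintegral_inv_one_add_sq_pow_lt_top hn).ne

lemma sqrt_norm_sub_sq_add_sq_le {E : Type*} [NormedAddCommGroup E] {x y : E} {R ε : ℝ}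
    (hx : ‖x‖ ≤ R) (hy : ‖y‖ ≤ R) (hε : 0 ≤ ε) (hε1 : ε ≤ 1) :
    √(‖x - y‖ ^ 2 + ε ^ 2) ≤ 2 * R + 1 := by
  have hR : 0 ≤ R := (norm_nonneg x).trans hx
  have hxy : ‖x - y‖ ≤ 2 * R := (norm_sub_le x y).trans (by linarith)
  refine Real.sqrt_le_iff.2 ⟨by positivity, ?_⟩
  nlinarith [norm_nonneg (x - y)]

lemma exists_seq_pos_le_one_tendsto_zero :
    ∃ e : ℕ → ℝ, (∀ j, 0 < e j) ∧ (∀ j, e j ≤ 1) ∧ Tendsto e atTop (𝓝 0) :=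
  ⟨fun j ↦ 1 / ((j : ℝ) + 1), fun j ↦ Nat.one_div_pos_of_nat,
    fun j ↦ div_le_one_of_le₀ (by simp) (by positivity), tendsto_one_div_add_atTop_nhds_zero_nat⟩

lemma exists_isTrace_of_isLowerRegularOn (hn : 1 ≤ n) (hΩ : IsOpen Ω) {R : ℝ}
    (hR : ∀ x ∈ closure Ω, ‖x‖ ≤ R) (hne : (frontier Ω).Nonempty)
    [IsFiniteMeasure (surfaceMeasure Ω)] (hσ : surfaceMeasure Ω ≠ 0) {c : ℝ≥0} (hc : 0 < c)
    (hreg : IsLowerRegularOn (surfaceMeasure Ω) (n - 1) c (frontier Ω) (2 * R + 1))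
    {g : L2Boundary Ω} (hg : g ∈ HHalf Ω) : ∃ u : L2 Ω, IsTrace Ω u g := by
  have hσF := ae_mem_frontier Ω
  have hΩR (x) (hx : x ∈ Ω) : ‖x‖ ≤ R := hR x (subset_closure hx)
  have hFR : ∀ᵐ y ∂surfaceMeasure Ω, ‖y‖ ≤ R := hσF.mono fun y hy ↦ hR y hy.1
  have hball : ∀ᵐ y ∂surfaceMeasure Ω, Ω ⊆ Metric.ball y (2 * R + 1) :=
    hFR.mono fun y hy x hx ↦ mem_ball_iff_norm.2 (by linarith [norm_sub_le x y, hΩR x hx])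
  have hgi : Integrable g (surfaceMeasure Ω) := (Lp.memLp g).integrable (by norm_num)
  have henergy : gagliardoEnergy (surfaceMeasure Ω) g ≠ ⊤ := ne_of_lt hg
  obtain ⟨e, he, he1, he0⟩ := exists_seq_pos_le_one_tendsto_zero
  have hsqrt (j : ℕ) (x) (hx : x ∈ Ω) :
      ∀ᵐ y ∂surfaceMeasure Ω, √(‖x - y‖ ^ 2 + e j ^ 2) ≤ 2 * R + 1 :=
    hFR.mono fun y hy ↦ sqrt_norm_sub_sq_add_sq_le (hΩR x hx) hy (he j).le (he1 j)
  have heR (j : ℕ) : e j ≤ 2 * R + 1 := by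
    linarith [he1 j, (norm_nonneg _).trans (hR _ hne.some_mem.1)]
  refine exists_isTrace_of_dominated hΩ (fun j ↦ contDiff_kernelAverage hσ hgi hFR (he j))
    (lintegral_const_mul_ne_top ENNReal.ofReal_ne_top <|
      setLIntegral_lintegral_mul_inv_edist_pow_ne_top hn g hball)
    (fun j x hx ↦ enorm_kernelAverage_sq_le hn hc hreg hσF hσ hgi (he j) (hsqrt j x hx))
    (fun x hx ↦ ?_)
    (lintegral_const_mul_ne_top ENNReal.ofReal_ne_top <|
      setLIntegral_lintegral_lintegral_inv_sq_add_sq_pow_ne_top hn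
        (Lp.stronglyMeasurable g).measurable henergy)
    (fun i j x hx ↦ (partialDeriv_kernelAverage hσ hgi hFR (he j) i x).symm ▸
      enorm_kernelAverageDeriv_sq_le_potential hn hc hreg hσF hσ hgi (he j) i (hsqrt j x hx))
    (fun i x hx ↦ ?_)
    (tendsto_eLpNorm_kernelAverage_sub hn hc hreg hσF hσ hgi henergy he heR he0)
  · obtain ⟨d, hd, hdist⟩ := exists_le_norm_sub_of_mem hΩ hx
    exact ⟨_, tendsto_kernelAverage hσ hgi hd hdist he0⟩
  · obtain ⟨d, hd, hdist⟩ := exists_le_norm_sub_of_mem hΩ hx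
    simp only [partialDeriv_kernelAverage hσ hgi hFR (he _)]
    exact ⟨_, tendsto_kernelAverageDeriv hσ hgi i hd hdist he0⟩

namespace IsBoundedLipschitzOpen

lemma surfaceMeasure_ne_zero (hΩ : IsBoundedLipschitzOpen Ω) (h : (frontier Ω).Nonempty) :
    surfaceMeasure Ω ≠ 0 := by
  obtain ⟨x, hx⟩ := h
  obtain ⟨c, hc, hreg⟩ := hΩ.exists_isLowerRegularOn 1
  intro hzero
  have hball := hreg x hx 1 one_pos le_rfl
  simp [hzero, hc.ne'] at hball

lemma exists_isTrace (hΩ : IsBoundedLipschitzOpen Ω) {g : L2Boundary Ω} (hg : g ∈ HHalf Ω) :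
    ∃ u : L2 Ω, IsTrace Ω u g := by
  rcases (frontier Ω).eq_empty_or_nonempty with hempty | hne
  · have hσ : surfaceMeasure Ω = 0 := by rw [surfaceMeasure, hempty, Measure.restrict_empty]
    have hae : ae (surfaceMeasure Ω) = ⊥ := ae_eq_bot.2 hσ
    have hg0 : g = 0 := Lp.ext (by rw [EventuallyEq, hae]; exact eventually_bot)
    exact ⟨0, hg0 ▸ isTrace_zero_of_mem_testSubmodule hΩ.isOpen (zero_mem _)⟩
  · have hn : 1 ≤ n :=
      let ⟨_, _, _, _, _, h⟩ := hΩ.exists_chart _ hne.some_mem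
      one_le_of_norm_eq_one h.norm_eq_one
    have hfin := hΩ.isFiniteMeasure_surfaceMeasure
    obtain ⟨R, hR⟩ := hΩ.isBounded.closure.exists_norm_le
    obtain ⟨c, hc, hreg⟩ := hΩ.exists_isLowerRegularOn (2 * R + 1)
    exact exists_isTrace_of_isLowerRegularOn hn hΩ.isOpen hR hne
      (hΩ.surfaceMeasure_ne_zero hne) hc hreg hg

end IsBoundedLipschitzOpen

end Extension

section TraceMap

variable {Ω : Set (Euc n)} {u : L2 Ω}

lemma IsTrace.trace_eq (hΩ : IsBoundedLipschitzOpen Ω) {g : L2Boundary Ω} (hg : IsTrace Ω u g) :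
    trace Ω u = g := by
  have hex : ∃ g : L2Boundary Ω, IsTrace Ω u g := ⟨g, hg⟩
  rw [trace, dif_pos hex]
  exact hex.choose_spec.unique hΩ hg

lemma zero_mem_HHalf : (0 : L2Boundary Ω) ∈ HHalf Ω := by
  have hzero : ⇑(0 : L2Boundary Ω) =ᵐ[surfaceMeasure Ω] 0 := Lp.coeFn_zero _ _ _
  change ∫⁻ x, ∫⁻ y, ‖(0 : L2Boundary Ω) x - (0 : L2Boundary Ω) y‖ₑ ^ 2 / edist x y ^ n
    ∂surfaceMeasure Ω ∂surfaceMeasure Ω < ⊤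
  refine lt_of_eq_of_lt (lintegral_eq_zero_of_ae_eq_zero ?_) ENNReal.zero_lt_top
  filter_upwards [hzero] with x hx
  refine lintegral_eq_zero_of_ae_eq_zero ?_
  filter_upwards [hzero] with y hy
  rw [hx, hy]
  simp

lemma trace_mem_HHalf (hΩ : IsBoundedLipschitzOpen Ω) (u : L2 Ω) : trace Ω u ∈ HHalf Ω := by
  by_cases h : ∃ g : L2Boundary Ω, IsTrace Ω u g
  · rw [trace, dif_pos h]
    exact h.choose_spec.mem_HHalf hΩ
  · rw [trace, dif_neg h]
    exact zero_mem_HHalf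

end TraceMap

section Constrained

variable {Ω : Set (Euc n)}

lemma span_subset_H1 {s : Set (L2 Ω)} (hs : s ⊆ H1 Ω) :
    (Submodule.span ℝ s : Set (L2 Ω)) ⊆ H1 Ω := by
  intro v hv i
  induction hv using Submodule.span_induction with
  | mem v hv => exact hs hv i
  | zero => exact ⟨0, hasWeakPartial_iff_inner.2 fun ψ hψ ↦ by simp⟩
  | add v w _ _ hv hw =>
    obtain ⟨g, hg⟩ := hv
    obtain ⟨h, hh⟩ := hw
    exact ⟨g + h, hg.add hh⟩
  | smul c v _ hv =>
    obtain ⟨g, hg⟩ := hv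
    exact ⟨c • g, hg.const_smul c⟩

end Constrained

end ConstrainedSobolev

end

open ConstrainedSobolev in
theorem mainTheorem4_general {n : ℕ} {Ω : Set (Euc n)} (hΩ : IsBoundedLipschitzOpen Ω)
    (Lc : Submodule ℝ (L2 Ω)) (hLc : IsClosed (Lc : Set (L2 Ω))) [FiniteDimensional ℝ Lcᗮ]
    (hH1 : ∀ v ∈ Lcᗮ, v ∈ H1 Ω) :
    trace Ω '' (H1 Ω ∩ (Lc : Set (L2 Ω))) = HHalf Ω ∧
    closure (H10 Ω ∩ (Lc : Set (L2 Ω))) = (Lc : Set (L2 Ω)) ∧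
    ∃ C : ℝ, 0 < C ∧ ∀ v ∈ Lcᗮ, v ∈ H1 Ω ∧ h1Norm Ω v ≤ C * ‖v‖ := by
  have hdense := dense_testSubmodule hΩ.isOpen
  refine ⟨Set.Subset.antisymm ?_ fun g hg ↦ ?_, Set.Subset.antisymm ?_ ?_, ?_⟩
  · rintro _ ⟨u, -, rfl⟩
    exact trace_mem_HHalf hΩ u
  · obtain ⟨u, hu⟩ := hΩ.exists_isTrace hg
    obtain ⟨v, hv, huv⟩ := exists_mem_sub_mem_of_dense hdense hLc u
    have htrace : IsTrace Ω (u - v) g := by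
      simpa using hu.sub hΩ.isOpen (isTrace_zero_of_mem_testSubmodule hΩ.isOpen hv)
    exact ⟨u - v, ⟨htrace.1, huv⟩, htrace.trace_eq hΩ⟩
  · exact closure_minimal Set.inter_subset_right hLc
  · conv_lhs => rw [← closure_inter_eq_of_dense hdense hLc]
    exact closure_mono (Set.inter_subset_inter_left _ (testSubmodule_subset_H10 hΩ.isOpen))
  · obtain ⟨C, hC, hle⟩ := exists_h1Norm_le_of_finiteDimensional hΩ.isOpen Lcᗮ hH1
    exact ⟨C, hC, fun v hv ↦ ⟨hH1 v hv, hle v hv⟩⟩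

theorem mainTheorem4 {n : ℕ} (hn : 1 ≤ n) (Ω : Set (ConstrainedSobolev.Euc n))
    (hΩ : ConstrainedSobolev.IsBoundedLipschitzDomain Ω)
    (Lc : Submodule ℝ (ConstrainedSobolev.L2 Ω))
    (hLc : IsClosed (Lc : Set (ConstrainedSobolev.L2 Ω)))
    (m : ℕ) (φ : Fin m → ConstrainedSobolev.L2 Ω)
    (hφ : ∀ i, φ i ∈ ConstrainedSobolev.H1 Ω)
    (hspan : Lcᗮ = Submodule.span ℝ (Set.range φ)) :
    ConstrainedSobolev.trace Ω ''
        (ConstrainedSobolev.H1 Ω ∩ (Lc : Set (ConstrainedSobolev.L2 Ω))) =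
      ConstrainedSobolev.HHalf Ω ∧
    closure (ConstrainedSobolev.H10 Ω ∩ (Lc : Set (ConstrainedSobolev.L2 Ω))) =
      (Lc : Set (ConstrainedSobolev.L2 Ω)) ∧
    ∃ C : ℝ, 0 < C ∧ ∀ v ∈ Lcᗮ,
      v ∈ ConstrainedSobolev.H1 Ω ∧ ConstrainedSobolev.h1Norm Ω v ≤ C * ‖v‖ := by
  have : FiniteDimensional ℝ Lcᗮ := hspan ▸ FiniteDimensional.span_of_finite ℝ (Set.finite_range φ)
  exact mainTheorem4_general hΩ.isBoundedLipschitzOpen Lc hLc fun v hv ↦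
    ConstrainedSobolev.span_subset_H1 (Set.range_subset_iff.2 hφ) (hspan ▸ hv)
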